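/- Let $X$ be a smooth finite-dimensional (Hausdorff) manifold without boundary and let $\mathcal V = \mathcal V^+\oplus\mathcal V^-$ be a smooth real or complex super vector bundle of finite rank over $X$, with a smooth (linear) connection $\nabla$ that preserves the grading. Let $F\in\Omega^2(X,\mathrm{End}\,\mathcal V)$, $F(U,W)=[\nabla_U,\nabla_W]-\nabla_{[U,W]}$, be its curvature, and for a smooth curve $\gamma$ let $[\gamma\|_s^t]^{\mathcal V}:\mathcal V_{\gamma(s)}\to\mathcal V_{\gamma(t)}$ be the parallel transport. Let $\mathrm LX=C^\infty(S^1,X)$, $S^1=\mathbb R/\mathbb Z$, be the smooth loop space, with $T_\gamma \mathrm LX=C^\infty(S^1,\gamma^*TX)$, and let $\iota_{\dot\gamma}$ denote insertion, into the first slot, of the vector field $\gamma\mapsto\dot\gamma$ on $\mathrm LX$, which generates the rotation action of the circle. With $\Delta_N=\{0\le\tau_1\le\dots\le\tau_N\le1\}$ and $\tau_0:=0$, define for $N\ge 0$, $\gamma\in\mathrm LX$ and $V_1,\dots,V_{2N}\in T_\gamma\mathrm LX$ $$\mathrm{BCh}_N(\nabla,\mathcal V)[V_{2N},\dots,V_1]=(-2)^{-N}\sum_{\sigma\in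 S_{2N}}\mathrm{sgn}(\sigma)\int_{\Delta_N}\mathrm{str}_{\mathcal V}\Bigl([\gamma\|_{\tau_N}^1]^{\mathcal V}\prod_{j=1}^N F\bigl(V_{\sigma_{2j}}(\tau_j),V_{\sigma_{2j-1}}(\tau_j)\bigr)[\gamma\|_{\tau_{j-1}}^{\tau_j}]^{\mathcal V}\Bigr)\,d\tau ,$$ where the factors of the product are ordered with $j$ decreasing from left to right; for $N=0$ this is $\mathrm{str}_{\mathcal V}[\gamma\|_0^1]^{\mathcal V}$. Then each $\mathrm{BCh}_N(\nabla,\mathcal V)$ is a smooth differential form of degree $2N$ on $\mathrm LX$, and for every $N\ge0$ $$d\,\mathrm{BCh}_N(\nabla,\mathcal V)=-\iota_{\dot\gamma}\,\mathrm{BCh}_{N+1}(\nabla,\mathcal V).$$ Consequently the Bismut–Chern character $\mathrm{BCh}_T(\mathcal V,\nabla)=\sum_{N=0}^\infty T^N\,\mathrm{BCh}_N(\nabla,\mathcal V)$, a formal power series in $T$, is equivariantly closed: $d_T\,\mathrm{BCh}_T(\mathcal V,\nabla)=0$, where $d_T=d+T^{-1}\iota_{\dot\gamma}$. -/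

import Mathlib

open Bundle MeasureTheory
open scoped Manifold ContDiff

noncomputable section

namespace LoopSpace

/-! ### The smooth loop space -/

section Loops

variable (E : Type*) [NormedAddCommGroup E] [NormedSpace ℝ E]
  (X : Type*) [TopologicalSpace X] [ChartedSpace E X]

/-- A point of `LX = C^∞(S¹, X)`, `S¹ = ℝ/ℤ`: a smooth `1`-periodic map `ℝ → X`. -/
structure SmoothLoop where
  /-- the underlying periodic map -/
  toFun : ℝ → X
  smooth : ContMDiff 𝓘(ℝ, ℝ) 𝓘(ℝ, E) ∞ toFun
  periodic : Function.Periodic toFun 1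

instance : CoeFun (SmoothLoop E X) (fun _ => ℝ → X) := ⟨SmoothLoop.toFun⟩

/-- A smooth map `ℝᵐ → LX`, i.e. a smooth map `ℝᵐ × S¹ → X` (exponential law).
Since every point of a finite-dimensional manifold has a neighbourhood diffeomorphic to `ℝᵐ`,
these maps detect smoothness of functions, and exterior derivatives of forms, on `LX`. -/
structure Plot (m : ℕ) where
  /-- the underlying family of periodic maps -/
  toFun : (Fin m → ℝ) → ℝ → X
  smooth : ContMDiff 𝓘(ℝ, (Fin m → ℝ) × ℝ) 𝓘(ℝ, E) ∞ (fun p : (Fin m → ℝ) × ℝ => toFun p.1 p.2)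
  periodic : ∀ x, Function.Periodic (toFun x) 1

end Loops

section Tangent

variable {E : Type*} [NormedAddCommGroup E] [NormedSpace ℝ E]
  {X : Type*} [TopologicalSpace X] [ChartedSpace E X]

/-- The loop `Φ(x) ∈ LX`. -/
def Plot.loop {m : ℕ} (Φ : Plot E X m) (x : Fin m → ℝ) : SmoothLoop E X where
  toFun := Φ.toFun x
  smooth := Φ.smooth.comp (contDiff_prodMk_right x).contMDiff
  periodic := Φ.periodic x

theorem periodic_mk_iff {γ : ℝ → X} (hγ : Function.Periodic γ 1)
    (v : ∀ t, TangentSpace 𝓘(ℝ, E) (γ t)) :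
    Function.Periodic (fun t => (⟨γ t, v t⟩ : TangentBundle 𝓘(ℝ, E) X)) 1 ↔
      ∀ t, (v (t + 1) : E) = v t := by
  refine forall_congr' fun t => ?_
  simp only [TotalSpace.mk.injEq]
  exact ⟨fun h => eq_of_heq h.2, fun h => ⟨hγ t, heq_of_eq h⟩⟩

theorem mfderiv_add_period {A : Type*} [NormedAddCommGroup A] [NormedSpace ℝ A] {f : A → X}
    (hf : ContMDiff 𝓘(ℝ, A) 𝓘(ℝ, E) ∞ f) {c : A} (hc : ∀ p, f (p + c) = f p) (p w : A) :
    (mfderiv 𝓘(ℝ, A) 𝓘(ℝ, E) f (p + c) w : E) = mfderiv 𝓘(ℝ, A) 𝓘(ℝ, E) f p w := by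
  have hT : HasMFDerivAt 𝓘(ℝ, A) 𝓘(ℝ, A) (fun q : A => q + c) p (ContinuousLinearMap.id ℝ A) :=
    ((hasFDerivAt_id p).add_const c).hasMFDerivAt
  have hF : HasMFDerivAt 𝓘(ℝ, A) 𝓘(ℝ, E) f (p + c) (mfderiv 𝓘(ℝ, A) 𝓘(ℝ, E) f (p + c)) :=
    ((hf.mdifferentiable (by simp)) (p + c)).hasMFDerivAt
  have h := (HasMFDerivAt.comp p hF hT).mfderiv
  have hfc : (f ∘ fun q : A => q + c) = f := funext hc
  have key : ∀ g : A → X, g = f → ∀ L : A →L[ℝ] E,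
      (mfderiv 𝓘(ℝ, A) 𝓘(ℝ, E) g p : A →L[ℝ] E) = L →
      (mfderiv 𝓘(ℝ, A) 𝓘(ℝ, E) f p : A →L[ℝ] E) = L := by
    rintro g rfl L hL
    exact hL
  exact (congrArg (fun L : A →L[ℝ] E => L w) (key _ hfc _ h)).symm

variable [IsManifold 𝓘(ℝ, E) ∞ X]

theorem contMDiff_mfderiv_apply {A : Type*} [NormedAddCommGroup A] [NormedSpace ℝ A] {f : A → X}
    (hf : ContMDiff 𝓘(ℝ, A) 𝓘(ℝ, E) ∞ f) (w : A) :
    ContMDiff 𝓘(ℝ, A) 𝓘(ℝ, E).tangent ∞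
      (fun p => (⟨f p, mfderiv 𝓘(ℝ, A) 𝓘(ℝ, E) f p w⟩ : TangentBundle 𝓘(ℝ, E) X)) := by
  have h1 : ContMDiff 𝓘(ℝ, A).tangent 𝓘(ℝ, E).tangent ∞ (tangentMap 𝓘(ℝ, A) 𝓘(ℝ, E) f) :=
    hf.contMDiff_tangentMap (by simp)
  have h2 : ContMDiff 𝓘(ℝ, A) 𝓘(ℝ, A).tangent ∞
      (fun p : A => (⟨p, w⟩ : TangentBundle 𝓘(ℝ, A) A)) := by
    intro p
    refine contMDiffAt_section p |>.2 ?_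
    simpa using contMDiffAt_const
  exact h1.comp h2

/-- The tangent space `T_γ LX = C^∞(S¹, γ^* TX)`: smooth (periodic) vector fields along `γ`. -/
def LoopTangent (γ : SmoothLoop E X) : Submodule ℝ (∀ t, TangentSpace 𝓘(ℝ, E) (γ t)) where
  carrier := {v |
    ContMDiff 𝓘(ℝ, ℝ) 𝓘(ℝ, E).tangent ∞ (fun t => (⟨γ t, v t⟩ : TangentBundle 𝓘(ℝ, E) X)) ∧
    Function.Periodic (fun t => (⟨γ t, v t⟩ : TangentBundle 𝓘(ℝ, E) X)) 1}
  zero_mem' := by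
    refine ⟨fun t => ?_, (periodic_mk_iff γ.periodic _).2 fun t => rfl⟩
    exact ((contMDiff_zeroSection ℝ (TangentSpace 𝓘(ℝ, E) : X → Type _)).comp γ.smooth) t
  add_mem' := by
    rintro v w ⟨hv, hv'⟩ ⟨hw, hw'⟩
    rw [periodic_mk_iff γ.periodic] at hv' hw'
    refine ⟨fun t => ?_, (periodic_mk_iff γ.periodic _).2 fun t => ?_⟩
    · have h1 := (contMDiffAt_totalSpace.1 (hv t)).2
      have h2 := (contMDiffAt_totalSpace.1 (hw t)).2
      refine contMDiffAt_totalSpace.2 ⟨γ.smooth t, (h1.add h2).congr_of_eventuallyEq ?_⟩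
      have hb := γ.smooth.continuous.continuousAt.preimage_mem_nhds
        ((trivializationAt E (TangentSpace 𝓘(ℝ, E)) (γ t)).open_baseSet.mem_nhds
          (FiberBundle.mem_baseSet_trivializationAt' (γ t)))
      filter_upwards [hb] with s hs
      exact ((trivializationAt E (TangentSpace 𝓘(ℝ, E)) (γ t)).linear ℝ hs).map_add _ _
    · exact congrArg₂ (fun a b : E => a + b) (hv' t) (hw' t)
  smul_mem' := by
    rintro c v ⟨hv, hv'⟩
    rw [periodic_mk_iff γ.periodic] at hv'
    refine ⟨fun t => ?_, (periodic_mk_iff γ.periodic _).2 fun t => ?_⟩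
    · have h1 := (contMDiffAt_totalSpace.1 (hv t)).2
      have hc : ContMDiffAt 𝓘(ℝ, ℝ) 𝓘(ℝ, ℝ) ∞ (fun _ : ℝ => c) t := contMDiffAt_const
      refine contMDiffAt_totalSpace.2 ⟨γ.smooth t, (hc.smul h1).congr_of_eventuallyEq ?_⟩
      have hb := γ.smooth.continuous.continuousAt.preimage_mem_nhds
        ((trivializationAt E (TangentSpace 𝓘(ℝ, E)) (γ t)).open_baseSet.mem_nhds
          (FiberBundle.mem_baseSet_trivializationAt' (γ t)))
      filter_upwards [hb] with s hs
      exact ((trivializationAt E (TangentSpace 𝓘(ℝ, E)) (γ t)).linear ℝ hs).map_smul _ _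
    · exact congrArg (fun a : E => c • a) (hv' t)

/-- The generating vector field `γ ↦ γ̇` of the rotation action of the circle on `LX`. -/
def velocity (γ : SmoothLoop E X) : LoopTangent γ :=
  ⟨fun t => mfderiv 𝓘(ℝ, ℝ) 𝓘(ℝ, E) γ t (1 : ℝ),
    contMDiff_mfderiv_apply γ.smooth (1 : ℝ),
    (periodic_mk_iff γ.periodic _).2 fun t =>
      mfderiv_add_period γ.smooth (c := (1 : ℝ)) γ.periodic t 1⟩

/-- A smooth family `x ↦ W(x) ∈ T_{Φ(x)} LX` of tangent vectors of `LX` along `Φ`. -/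
structure PlotField {m : ℕ} (Φ : Plot E X m) where
  /-- the underlying family of vector fields -/
  toFun : ∀ x t, TangentSpace 𝓘(ℝ, E) (Φ.toFun x t)
  smooth : ContMDiff 𝓘(ℝ, (Fin m → ℝ) × ℝ) 𝓘(ℝ, E).tangent ∞
    (fun p : (Fin m → ℝ) × ℝ => (⟨Φ.toFun p.1 p.2, toFun p.1 p.2⟩ : TangentBundle 𝓘(ℝ, E) X))
  periodic : ∀ x, Function.Periodic
    (fun t => (⟨Φ.toFun x t, toFun x t⟩ : TangentBundle 𝓘(ℝ, E) X)) 1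

/-- The value `W(x) ∈ T_{Φ(x)} LX`. -/
def PlotField.at {m : ℕ} {Φ : Plot E X m} (W : PlotField Φ) (x : Fin m → ℝ) :
    LoopTangent (Φ.loop x) :=
  ⟨W.toFun x, W.smooth.comp (contDiff_prodMk_right x).contMDiff, W.periodic x⟩

/-- The derivative `x ↦ dΦ_x(v) ∈ T_{Φ(x)} LX` of a plot in the constant direction `v`. -/
def Plot.push {m : ℕ} (Φ : Plot E X m) (v : Fin m → ℝ) : PlotField Φ where
  toFun x t := mfderiv 𝓘(ℝ, (Fin m → ℝ) × ℝ) 𝓘(ℝ, E)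
    (fun p : (Fin m → ℝ) × ℝ => Φ.toFun p.1 p.2) (x, t) (v, (0 : ℝ))
  smooth := contMDiff_mfderiv_apply Φ.smooth (v, (0 : ℝ))
  periodic x := (periodic_mk_iff (Φ.periodic x) _).2 fun t => by
    have key : ∀ q, q = ((x, t + 1) : (Fin m → ℝ) × ℝ) →
        (mfderiv 𝓘(ℝ, (Fin m → ℝ) × ℝ) 𝓘(ℝ, E)
          (fun p : (Fin m → ℝ) × ℝ => Φ.toFun p.1 p.2) q (v, (0 : ℝ)) : E) =
        mfderiv 𝓘(ℝ, (Fin m → ℝ) × ℝ) 𝓘(ℝ, E)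
          (fun p : (Fin m → ℝ) × ℝ => Φ.toFun p.1 p.2) (x, t) (v, (0 : ℝ)) →
        (mfderiv 𝓘(ℝ, (Fin m → ℝ) × ℝ) 𝓘(ℝ, E)
          (fun p : (Fin m → ℝ) × ℝ => Φ.toFun p.1 p.2) (x, t + 1) (v, (0 : ℝ)) : E) =
        mfderiv 𝓘(ℝ, (Fin m → ℝ) × ℝ) 𝓘(ℝ, E)
          (fun p : (Fin m → ℝ) × ℝ => Φ.toFun p.1 p.2) (x, t) (v, (0 : ℝ)) := by
      rintro q rfl h
      exact h
    exact key _ (by simp) (mfderiv_add_period Φ.smooth (c := ((0 : Fin m → ℝ), (1 : ℝ)))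
      (fun p => by simpa using Φ.periodic p.1 p.2) (x, t) (v, (0 : ℝ)))

/-! ### Differential forms on the loop space -/

section Forms

variable (K : Type*) [RCLike K]

variable (E X) in
/-- An assignment of a `K`-valued function of `k` tangent vectors to every loop. It is a
differential form on `LX` if it satisfies `IsForm`. -/
abbrev Cochain (k : ℕ) := ∀ γ : SmoothLoop E X, (Fin k → LoopTangent γ) → K

variable {K} {k : ℕ}

/-- `θ` is a smooth differential form of degree `k` on `LX`: on every tangent space it is an
alternating `ℝ`-multilinear map, and it depends smoothly on the loop and the tangent vectors,
i.e. it takes smooth families of loops and tangent vectors to smooth functions. -/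
structure IsForm (θ : Cochain E X K k) : Prop where
  alternating : ∀ γ, ∃ A : LoopTangent γ [⋀^Fin k]→ₗ[ℝ] K, ∀ U, θ γ U = A U
  smooth : ∀ (m : ℕ) (Φ : Plot E X m) (W : Fin k → PlotField Φ),
    ContDiff ℝ ∞ (fun x => θ (Φ.loop x) (fun i => (W i).at x))

/-- `η = dθ`: both are smooth differential forms on `LX`, and `Φ^* η = d(Φ^* θ)` for every
smooth map `Φ : ℝᵐ → LX`, where `d` on the right is the exterior derivative on `ℝᵐ` (written out
on constant vector fields). Any tangent vectors `V₀, …, V_k` at a loop are of the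
form `dΦ_0(e_0), …, dΦ_0(e_k)` for some `Φ`, so that `η` is determined by `θ`. -/
structure HasExtDeriv (θ : Cochain E X K k) (η : Cochain E X K (k + 1)) : Prop where
  isForm : IsForm θ
  isForm_deriv : IsForm η
  pullback : ∀ (m : ℕ) (Φ : Plot E X m) (x : Fin m → ℝ) (v : Fin (k + 1) → Fin m → ℝ),
    η (Φ.loop x) (fun i => (Φ.push (v i)).at x) =
      ∑ i : Fin (k + 1), (-1 : K) ^ (i : ℕ) *
        fderiv ℝ (fun y => θ (Φ.loop y) (fun j => (Φ.push (v (i.succAbove j))).at y)) x (v i)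

/-- Insertion `ι_{γ̇}` of the vector field `γ̇` into the first slot. -/
def insertVelocity (θ : Cochain E X K (k + 1)) : Cochain E X K k :=
  fun γ U => θ γ (Fin.cons (velocity γ) U)

variable (E X K) in
/-- Formal series `∑_{N ∈ ℤ} T^N θ_N`; `Θ N k` is the component of degree `k` of `θ_N`. -/
abbrev Series := ℤ → ∀ k : ℕ, Cochain E X K k

/-- `Ψ = d_T Θ`, where `d_T = d + T⁻¹ ι_{γ̇}` is the equivariant differential (`D` is `dΘ`,
taken in each power of `T` and each degree; it has no component of degree `0`). -/
def HasEquivariantDeriv (Θ Ψ : Series E X K) : Prop :=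
  ∃ D : Series E X K,
    (∀ N k, HasExtDeriv (Θ N k) (D N (k + 1))) ∧ (∀ N, D N 0 = 0) ∧
    ∀ N k, Ψ N k = D N k + insertVelocity (Θ (N + 1) (k + 1))

end Forms

end Tangent

/-! ### Super vector bundles with connection -/

section Bundle

variable {K : Type*} [RCLike K]
  {E : Type*} [NormedAddCommGroup E] [NormedSpace ℝ E]
  {X : Type*} [TopologicalSpace X] [ChartedSpace E X] [IsManifold 𝓘(ℝ, E) ∞ X]
  {F : Type*} [NormedAddCommGroup F] [NormedSpace ℝ F]
  {V : X → Type*} [TopologicalSpace (TotalSpace F V)]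
  [∀ x, AddCommGroup (V x)] [∀ x, Module ℝ (V x)] [∀ x, Module K (V x)]
  [∀ x, TopologicalSpace (V x)] [∀ x, IsTopologicalAddGroup (V x)]
  [∀ x, ContinuousSMul ℝ (V x)] [FiberBundle F V] [VectorBundle ℝ F V]

variable (K E F V) in
/-- A smooth `ℤ/2`-grading of the `K`-vector bundle `V`, given by its grading operator `Ξ`,
whose `±1` eigenbundles are the even and the odd part of `V`. -/
structure Grading where
  /-- the grading operator -/
  op : ∀ x, V x →ₗ[K] V x
  involutive : ∀ x w, op x (op x w) = w
  smooth : ContMDiff (𝓘(ℝ, E).prod 𝓘(ℝ, F)) (𝓘(ℝ, E).prod 𝓘(ℝ, F)) ∞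
    (fun p : TotalSpace F V => (⟨p.1, op p.1 p.2⟩ : TotalSpace F V))

/-- The connection is `K`-linear and preserves the grading (`∇Ξ = 0`). -/
structure IsGradedConnection (cov : CovariantDerivative 𝓘(ℝ, E) F V) (Ξ : Grading K E F V) :
    Prop where
  smul : ∀ (c : K) (σ : ∀ x, V x) (x : X),
    MDifferentiableAt 𝓘(ℝ, E) (𝓘(ℝ, E).prod 𝓘(ℝ, F)) (fun y => (⟨y, σ y⟩ : TotalSpace F V)) x →
    ∀ v, cov (fun y => c • σ y) x v = c • cov σ x v
  grading : ∀ (σ : ∀ x, V x) (x : X),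
    MDifferentiableAt 𝓘(ℝ, E) (𝓘(ℝ, E).prod 𝓘(ℝ, F)) (fun y => (⟨y, σ y⟩ : TotalSpace F V)) x →
    ∀ v, cov (fun y => Ξ.op y (σ y)) x v = Ξ.op x (cov σ x v)

/-- `R` is the curvature of `∇`:
`R(U, W) σ = ∇_U ∇_W σ - ∇_W ∇_U σ - ∇_{[U, W]} σ` for smooth vector fields and sections. -/
def IsCurvature (cov : CovariantDerivative 𝓘(ℝ, E) F V)
    (R : ∀ x : X, TangentSpace 𝓘(ℝ, E) x → TangentSpace 𝓘(ℝ, E) x → (V x →ₗ[K] V x)) : Prop :=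
  ∀ (U W : ∀ x : X, TangentSpace 𝓘(ℝ, E) x) (σ : ∀ x, V x),
    ContMDiff 𝓘(ℝ, E) 𝓘(ℝ, E).tangent ∞ (fun y => (⟨y, U y⟩ : TangentBundle 𝓘(ℝ, E) X)) →
    ContMDiff 𝓘(ℝ, E) 𝓘(ℝ, E).tangent ∞ (fun y => (⟨y, W y⟩ : TangentBundle 𝓘(ℝ, E) X)) →
    ContMDiff 𝓘(ℝ, E) (𝓘(ℝ, E).prod 𝓘(ℝ, F)) ∞ (fun y => (⟨y, σ y⟩ : TotalSpace F V)) →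
    ∀ x, R x (U x) (W x) (σ x) =
      cov (fun y => cov σ y (W y)) x (U x) - cov (fun y => cov σ y (U y)) x (W x) -
        cov σ x (VectorField.mlieBracket 𝓘(ℝ, E) U W x)

open Classical in
variable (K) in
/-- The curvature `F ∈ Ω²(X, End V)`: the unique tensor with `IsCurvature` (which exists for every
smooth `K`-linear connection on a Hausdorff manifold). -/
def curvature (cov : CovariantDerivative 𝓘(ℝ, E) F V) :
    ∀ x : X, TangentSpace 𝓘(ℝ, E) x → TangentSpace 𝓘(ℝ, E) x → (V x →ₗ[K] V x) :=
  if h : ∃ R : ∀ x : X, TangentSpace 𝓘(ℝ, E) x → TangentSpace 𝓘(ℝ, E) x → (V x →ₗ[K] V x),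
    IsCurvature cov R then h.choose else 0

/-- The covariant derivative `∇s/dt` of a section `s` along `γ`. In the local
frame `e_a` of the trivialization at `γ t`, for `s = ∑ sᵃ e_a`, it is
`∑ (dsᵃ/dt) e_a + sᵃ ∇_{γ̇} e_a`; `FiberBundle.extend F (s t)` is the local
section `∑ sᵃ(t) e_a` with constant coefficients. -/
def covDerivAlong (cov : CovariantDerivative 𝓘(ℝ, E) F V) (γ : ℝ → X) (s : ∀ t, V (γ t)) (t : ℝ) :
    V (γ t) :=
  (trivializationAt F V (γ t)).symm (γ t)
      (deriv (fun r => (trivializationAt F V (γ t) ⟨γ r, s r⟩).2) t) +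
    cov (FiberBundle.extend F (s t)) (γ t) (mfderiv 𝓘(ℝ, ℝ) 𝓘(ℝ, E) γ t (1 : ℝ))

/-- `P s t : V_{γ(s)} → V_{γ(t)}` is the parallel transport along `γ`: `P s s = id`, and
`t ↦ P s t w` is a smooth parallel section along `γ` for every `w ∈ V_{γ(s)}`. -/
structure IsParallelTransport (cov : CovariantDerivative 𝓘(ℝ, E) F V) (γ : ℝ → X)
    (P : ∀ s t : ℝ, V (γ s) →ₗ[K] V (γ t)) : Prop where
  refl : ∀ s, P s s = LinearMap.id
  smooth : ∀ s w, ContMDiff 𝓘(ℝ, ℝ) (𝓘(ℝ, E).prod 𝓘(ℝ, F)) ∞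
    (fun t => (⟨γ t, P s t w⟩ : TotalSpace F V))
  parallel : ∀ s w t, covDerivAlong cov γ (fun r => P s r w) t = 0

open Classical in
variable (K) in
/-- The parallel transport `[γ‖_s^t]`: the unique family with `IsParallelTransport` (which exists
for every smooth curve and smooth `K`-linear connection). -/
def parallelTransport (cov : CovariantDerivative 𝓘(ℝ, E) F V) (γ : ℝ → X) :
    ∀ s t : ℝ, V (γ s) →ₗ[K] V (γ t) :=
  if h : ∃ P : ∀ s t : ℝ, V (γ s) →ₗ[K] V (γ t), IsParallelTransport cov γ P then h.choose else 0

/-! ### The Bismut–Chern forms -/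

/-- `[γ‖_{τ_N}^t] R_N(τ_N) [γ‖_{τ_{N-1}}^{τ_N}] ⋯ R_1(τ_1) [γ‖_0^{τ_1}] : V_{γ(0)} → V_{γ(t)}`
for fields `R_1, …, R_N` of endomorphisms along `γ` (indexed from `0` in the code). -/
def transportProd (cov : CovariantDerivative 𝓘(ℝ, E) F V) (γ : ℝ → X) :
    ∀ (N : ℕ) (_ : Fin N → ∀ t : ℝ, V (γ t) →ₗ[K] V (γ t)) (_ : Fin N → ℝ) (t : ℝ),
      V (γ 0) →ₗ[K] V (γ t)
  | 0, _, _, t => parallelTransport K cov γ 0 t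
  | N + 1, R, τ, t =>
      parallelTransport K cov γ (τ (Fin.last N)) t ∘ₗ R (Fin.last N) (τ (Fin.last N)) ∘ₗ
        transportProd cov γ N (Fin.init R) (Fin.init τ) (τ (Fin.last N))

/-- The supertrace of a linear map `V_{γ(0)} → V_{γ(1)} = V_{γ(0)}`. -/
def loopStr (Ξ : Grading K E F V) (γ : SmoothLoop E X) (A : V (γ 0) →ₗ[K] V (γ 1)) : K :=
  have h : γ 1 = γ 0 := by simpa using γ.periodic 0
  LinearMap.trace K (V (γ 0)) (Ξ.op (γ 0) ∘ₗ (h ▸ A))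

/-- The simplex `Δ_N = {0 ≤ τ_1 ≤ ⋯ ≤ τ_N ≤ 1}`. -/
def simplex (N : ℕ) : Set (Fin N → ℝ) := {τ | Monotone τ ∧ ∀ i, τ i ∈ Set.Icc (0 : ℝ) 1}

/-- The Bismut–Chern form `BCh_N(∇, V)`. The arguments are listed as `[V_{2N}, …, V_1]`,
so `V_i` is the entry `2N - i` of the tuple `U` (`i - 1 ↦ Fin.rev (i - 1)` on indices). -/
def BCh (cov : CovariantDerivative 𝓘(ℝ, E) F V) (Ξ : Grading K E F V) (N : ℕ) :
    Cochain E X K (2 * N) := fun γ U =>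
  ((-2 : K) ^ N)⁻¹ * ∑ σ : Equiv.Perm (Fin (2 * N)), ((Equiv.Perm.sign σ : ℤ) : K) *
    ∫ τ in simplex N, loopStr Ξ γ (transportProd cov γ N
      (fun j t => curvature K cov (γ t)
        ((U (Fin.rev (σ ⟨2 * j + 1, by omega⟩)) : ∀ t, TangentSpace 𝓘(ℝ, E) (γ t)) t)
        ((U (Fin.rev (σ ⟨2 * j, by omega⟩)) : ∀ t, TangentSpace 𝓘(ℝ, E) (γ t)) t)) τ 1)

/-- The Bismut–Chern character `BCh_T(V, ∇) = ∑_{N ≥ 0} T^N BCh_N(∇, V)`. -/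
def BChCharacter (cov : CovariantDerivative 𝓘(ℝ, E) F V) (Ξ : Grading K E F V) : Series E X K
  | .ofNat N, k => if h : 2 * N = k then h ▸ BCh cov Ξ N else 0
  | .negSucc _, _ => 0

end Bundle

end LoopSpace

end

open Bundle MeasureTheory
open scoped Manifold ContDiff

noncomputable section

set_option linter.unusedSectionVars false

namespace LoopSpace

/-! ### Smooth dependence of integrals over compact sets on a parameter -/

section ParametricIntegral

variable {P : Type} [NormedAddCommGroup P] [NormedSpace ℝ P] [FiniteDimensional ℝ P]
  {α : Type*} [NormedAddCommGroup α] [NormedSpace ℝ α] [MeasurableSpace α] [BorelSpace α]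
  [SecondCountableTopology α] {μ : Measure α} [IsLocallyFiniteMeasure μ] {S : Set α}

/-! Everything is tested on plots, that is, on smooth families f(x, t) of loops with x in a vector
space A. The pulled-back bundle over A × ℝ has a global frame that is parallel in the direction of t
(`exists_temporal_frame`). In this temporal gauge the connection form a has no dt-component and
every transport along a loop becomes the identity matrix. The holonomy survives only in a matrix
q(x), which compares the frames at times 1 and 0 and also absorbs the grading operator Ξ, so that
the supertrace becomes an ordinary trace. Hence (`BCh_eq`) BCh_N is (-2)^{-N} times the
antisymmetrization of the Chen integral of tr(q F(t_0) F(t_1) ⋯) over 1 ≥ t_0 ≥ t_1 ≥ ⋯ ≥ 0.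

Three identities carry the computation of d. Since ∇Ξ = 0, dq = q a(1) - a(0) q
(`fderiv_inFrame_grading`). Since a has no dt-component, F(∂_t, v) = ∂_t a(v) (`curvature_frame`).
By the Bianchi identity (`formCurv_bianchi`) the cyclic sums of dF + [a, F] vanish, so after
antisymmetrization the derivative of a factor F(t_j) may be replaced by -[a(t_j), F(t_j)]. By
cyclicity of the trace, the terms that remain regroup (`trace_telescope`) into a sum over the N + 1
gaps between consecutive times, in which a(upper end) - a(lower end) is inserted into the product.
This difference is the integral of F(∂_t, v) over the gap, so Fubini turns the sum into Chen
integrals over the (N + 1)-simplex with one factor F(∂_t, v) (`TemporalGauge.chen_insertNth`).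

On the other side, inserting γ̇ into BCh_{N+1} places ∂_t in each of the 2N + 2 positions. The two
positions inside one curvature factor contribute equally, because F is antisymmetric. The resulting
2 against the extra normalization (-2)^{-1} leaves the sign -1 (`TemporalGauge.extDeriv_chen`,
`BCh_extDeriv`). Equivariant closedness is this identity read off power by power in T.

The inputs are smooth dependence of linear differential equations on parameters
(`exists_contDiff_linearODE`), which yields parallel frames and parallel transport, and the fact
that covariant derivatives along an arbitrary map commute up to the pulled-back curvature
(`covAlong_comm`). The alternating property and smoothness of the forms are read off in the same
gauge (`BCh_alternating`, `BCh_smooth`). -/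

theorem hasFDerivAt_setIntegral_of_contDiff (hS : IsCompact S)
    {W : Type*} [NormedAddCommGroup W] [NormedSpace ℝ W] {G : P → α → W}
    (hG : ContDiff ℝ 1 (Function.uncurry G)) (x : P) :
    HasFDerivAt (fun x => ∫ a in S, G x a ∂μ) (∫ a in S, fderiv ℝ (fun y => G y a) x ∂μ) x := by
  have hd : Continuous (Function.uncurry fun y a => fderiv ℝ (fun z => G z a) y) := by
    have h : ContDiff ℝ 1 (Function.uncurry fun (q : P × α) (z : P) => G z q.2) :=
      hG.comp (contDiff_snd.prodMk (contDiff_snd.comp contDiff_fst))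
    exact (ContDiff.fderiv (n := 0) h contDiff_fst (by simp)).continuous
  have : ProperSpace P := FiniteDimensional.proper ℝ P
  obtain ⟨C, hC⟩ := ((isCompact_closedBall x 1).prod hS).exists_bound_of_continuousOn
    hd.continuousOn
  have hfin : IsFiniteMeasure (μ.restrict S) := ⟨by rw [Measure.restrict_apply_univ]; exact hS.measure_lt_top⟩
  have hcont : ∀ y, Continuous (G y) := fun y =>
    hG.continuous.comp (Continuous.prodMk_right y)
  refine hasFDerivAt_integral_of_dominated_of_fderiv_le (𝕜 := ℝ) (F := G)
    (F' := fun y a => fderiv ℝ (fun z => G z a) y) (bound := fun _ => C)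
    (Metric.closedBall_mem_nhds x one_pos) ?_ ?_ ?_ ?_ ?_ ?_
  · exact Filter.Eventually.of_forall fun y => (hcont y).aestronglyMeasurable
  · exact (hcont x).continuousOn.integrableOn_compact hS
  · exact ((hd.comp (Continuous.prodMk_right x)).continuousOn.integrableOn_compact
      hS).aestronglyMeasurable
  · filter_upwards [ae_restrict_mem hS.measurableSet] with a ha y hy
    exact hC (y, a) ⟨hy, ha⟩
  · exact integrable_const C
  · refine Filter.Eventually.of_forall fun a y _ => ?_
    exact ((hG.comp (contDiff_id.prodMk contDiff_const)).differentiable (by simp) y).hasFDerivAt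

/-- Induction on the order of differentiability: the derivative is again such an integral, with
values in `P →L[ℝ] W`. This is why `W` is generalized and why `P` lives in `Type`, so that the value
space stays in one universe. -/
theorem contDiff_setIntegral (hS : IsCompact S)
    {W : Type*} [NormedAddCommGroup W] [NormedSpace ℝ W] {G : P → α → W}
    (hG : ContDiff ℝ ∞ (Function.uncurry G)) :
    ContDiff ℝ ∞ (fun x => ∫ a in S, G x a ∂μ) := by
  refine contDiff_infty.2 fun n => ?_
  induction n generalizing W with
  | zero =>
    exact contDiff_zero.2 (continuous_parametric_integral_of_continuous hG.continuous hS)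
  | succ n ih =>
    have hd : ∀ x, HasFDerivAt (fun x => ∫ a in S, G x a ∂μ)
        (∫ a in S, fderiv ℝ (fun y => G y a) x ∂μ) x :=
      hasFDerivAt_setIntegral_of_contDiff hS (hG.of_le (by exact_mod_cast le_top))
    push_cast
    refine contDiff_succ_iff_fderiv.2 ⟨fun x => (hd x).differentiableAt, by simp, ?_⟩
    rw [show fderiv ℝ (fun x => ∫ a in S, G x a ∂μ) =
      fun x => ∫ a in S, fderiv ℝ (fun y => G y a) x ∂μ from funext fun x => (hd x).fderiv]
    refine ih ?_
    have h : ContDiff ℝ ∞ (Function.uncurry fun (q : P × α) (z : P) => G z q.2) :=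
      hG.comp (contDiff_snd.prodMk (contDiff_snd.comp contDiff_fst))
    exact ContDiff.fderiv (n := ∞) h contDiff_fst (by simp)

end ParametricIntegral

/-! ### Linear differential equations depending smoothly on a parameter -/

section LinearODE

/-- The Picard iterates of `∂y/∂t = M y`, `y(x, 0) = y₀(x)`; the integral over `[0, t]` is
rescaled to `[0, 1]`. -/
def picardIter {A : Type} {G : Type*} [NormedAddCommGroup G] [NormedSpace ℝ G]
    (M : A × ℝ → G →L[ℝ] G) (y₀ : A → G) : ℕ → A × ℝ → G
  | 0, p => y₀ p.1
  | n + 1, p => y₀ p.1 +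
      ∫ s in Set.Icc (0 : ℝ) 1, p.2 • M (p.1, s * p.2) (picardIter M y₀ n (p.1, s * p.2))

/-- The rescaled form has a fixed domain of integration, which suits `contDiff_setIntegral`; this
usual form is the one to which the fundamental theorem of calculus applies. -/
theorem picardIter_succ_eq {A : Type} {G : Type*} [NormedAddCommGroup G] [NormedSpace ℝ G]
    (M : A × ℝ → G →L[ℝ] G) (y₀ : A → G) (n : ℕ) (x : A) (t : ℝ) :
    picardIter M y₀ (n + 1) (x, t) =
      y₀ x + ∫ s in (0 : ℝ)..t, M (x, s) (picardIter M y₀ n (x, s)) := by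
  have h := intervalIntegral.smul_integral_comp_mul_right (a := 0) (b := 1)
    (fun s => M (x, s) (picardIter M y₀ n (x, s))) t
  rw [zero_mul, one_mul] at h
  rw [← h, ← intervalIntegral.integral_smul, intervalIntegral.integral_of_le zero_le_one,
    ← integral_Icc_eq_integral_Ioc]
  rfl

variable {A : Type} [NormedAddCommGroup A] [NormedSpace ℝ A]
  {G : Type*} [NormedAddCommGroup G] [NormedSpace ℝ G]

theorem contDiff_partial_fderiv {W : Type*} [NormedAddCommGroup W] [NormedSpace ℝ W]
    {g : A × ℝ → W} (hg : ContDiff ℝ ∞ g) :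
    ContDiff ℝ ∞ fun p : A × ℝ => fderiv ℝ (fun x => g (x, p.2)) p.1 :=
  ContDiff.fderiv (n := ∞) (f := fun (p : A × ℝ) x => g (x, p.2))
    (hg.comp (contDiff_snd.prodMk (contDiff_snd.comp contDiff_fst))) contDiff_fst (by simp)

variable [FiniteDimensional ℝ A]

theorem continuous_picardIter {M : A × ℝ → G →L[ℝ] G} {y₀ : A → G} (hM : Continuous M)
    (hy : Continuous y₀) (n : ℕ) : Continuous (picardIter M y₀ n) := by
  have : ProperSpace A := FiniteDimensional.proper ℝ A
  induction n with
  | zero => exact hy.comp continuous_fst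
  | succ n ih =>
    refine (hy.comp continuous_fst).add
      (continuous_parametric_integral_of_continuous ?_ isCompact_Icc)
    have h : Continuous fun q : (A × ℝ) × ℝ => (q.1.1, q.2 * q.1.2) := by fun_prop
    exact (continuous_snd.comp continuous_fst).smul ((hM.comp h).clm_apply (ih.comp h))

theorem contDiff_picardIter {M : A × ℝ → G →L[ℝ] G} {y₀ : A → G} (hM : ContDiff ℝ ∞ M)
    (hy : ContDiff ℝ ∞ y₀) (n : ℕ) : ContDiff ℝ ∞ (picardIter M y₀ n) := by
  induction n with
  | zero => exact hy.comp contDiff_fst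
  | succ n ih =>
    refine (hy.comp contDiff_fst).add (contDiff_setIntegral isCompact_Icc ?_)
    have h : ContDiff ℝ ∞ fun q : (A × ℝ) × ℝ => (q.1.1, q.2 * q.1.2) := by fun_prop
    exact (contDiff_snd.comp contDiff_fst).smul ((hM.comp h).clm_apply (ih.comp h))

/-- The terms of an exponential series: each iteration contributes a factor `C * |t|` and one more
integration of a power of the rescaled time. -/
theorem norm_picardIter_sub_le {M : A × ℝ → G →L[ℝ] G} {y₀ : A → G} (hM : Continuous M)
    (hy : Continuous y₀) {D : Set A} {T C C₀ : ℝ} (hC : 0 ≤ C)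
    (hMC : ∀ x ∈ D, ∀ t, |t| ≤ T → ‖M (x, t)‖ ≤ C) (hyC : ∀ x ∈ D, ‖y₀ x‖ ≤ C₀)
    (n : ℕ) {x : A} (hx : x ∈ D) {t : ℝ} (ht : |t| ≤ T) :
    ‖picardIter M y₀ (n + 1) (x, t) - picardIter M y₀ n (x, t)‖ ≤
      C₀ * ((C * |t|) ^ (n + 1) / (n + 1).factorial) := by
  have hst : ∀ s ∈ Set.Icc (0 : ℝ) 1, |s * t| ≤ T := fun s hs => by
    rw [abs_mul, abs_of_nonneg hs.1]
    exact (mul_le_of_le_one_left (abs_nonneg t) hs.2).trans ht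
  have hint : ∀ n, IntegrableOn
      (fun s : ℝ => t • M (x, s * t) (picardIter M y₀ n (x, s * t))) (Set.Icc 0 1) := by
    intro n
    refine Continuous.integrableOn_Icc ?_
    have h : Continuous fun s : ℝ => (x, s * t) := by fun_prop
    exact ((hM.comp h).clm_apply ((continuous_picardIter hM hy n).comp h)).const_smul t
  -- Integrating `s ^ k` over `[0, 1]` gives `1 / (k + 1)`, which is what builds the factorial.
  have key : ∀ (f : ℝ → G) (c : ℝ) (k : ℕ), (∀ s ∈ Set.Icc (0 : ℝ) 1, ‖f s‖ ≤ c * s ^ k) →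
      ‖∫ s in Set.Icc (0 : ℝ) 1, f s‖ ≤ c / (k + 1) := by
    intro f c k hf
    rw [integral_Icc_eq_integral_Ioc, ← intervalIntegral.integral_of_le zero_le_one]
    refine (intervalIntegral.norm_integral_le_of_norm_le (g := fun s => c * s ^ k) zero_le_one
      (Filter.Eventually.of_forall fun s hs => hf s ⟨hs.1.le, hs.2⟩)
      (by apply Continuous.intervalIntegrable; fun_prop)).trans (le_of_eq ?_)
    rw [intervalIntegral.integral_const_mul, integral_pow]
    simp [div_eq_mul_inv]
  induction n generalizing t with
  | zero =>
    have h : ‖∫ s in Set.Icc (0 : ℝ) 1, t • M (x, s * t) (y₀ x)‖ ≤ (C₀ * (C * |t|)) / ((0 : ℕ) + 1) := by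
      refine key _ _ 0 fun s hs => ?_
      rw [norm_smul, Real.norm_eq_abs, pow_zero, mul_one]
      calc |t| * ‖M (x, s * t) (y₀ x)‖ ≤ |t| * (C * C₀) := by
            gcongr
            exact ((M (x, s * t)).le_opNorm _).trans
              (mul_le_mul (hMC x hx _ (hst s hs)) (hyC x hx) (norm_nonneg _) hC)
        _ = C₀ * (C * |t|) := by ring
    simpa [picardIter] using h
  | succ n ih =>
    have h1 : picardIter M y₀ (n + 1 + 1) (x, t) - picardIter M y₀ (n + 1) (x, t) =
        ∫ s in Set.Icc (0 : ℝ) 1, t • M (x, s * t) (picardIter M y₀ (n + 1) (x, s * t) -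
          picardIter M y₀ n (x, s * t)) := by
      simp only [map_sub, smul_sub]
      rw [integral_sub (hint _) (hint _)]
      conv_lhs => rw [picardIter]
      rw [show picardIter M y₀ (n + 1) (x, t) = y₀ x + ∫ s in Set.Icc (0 : ℝ) 1,
        t • M (x, s * t) (picardIter M y₀ n (x, s * t)) from rfl]
      simp
    rw [h1]
    refine (key _ (|t| * (C * (C₀ * ((C * |t|) ^ (n + 1) / (n + 1).factorial)))) (n + 1)
      fun s hs => ?_).trans (le_of_eq ?_)
    · rw [norm_smul, Real.norm_eq_abs]
      have h2 := ih (hst s hs) (fun r hr => by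
        rw [abs_mul, abs_of_nonneg hr.1]
        exact (mul_le_of_le_one_left (abs_nonneg _) hr.2).trans (hst s hs)) (by
          intro k
          refine Continuous.integrableOn_Icc ?_
          have h : Continuous fun r : ℝ => (x, r * (s * t)) := by fun_prop
          exact ((hM.comp h).clm_apply ((continuous_picardIter hM hy k).comp h)).const_smul _)
      have h3 : ‖M (x, s * t) (picardIter M y₀ (n + 1) (x, s * t) -
          picardIter M y₀ n (x, s * t))‖ ≤
          C * (C₀ * ((C * |s * t|) ^ (n + 1) / (n + 1).factorial)) :=
        ((M (x, s * t)).le_opNorm _).trans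
          (mul_le_mul (hMC x hx _ (hst s hs)) h2 (norm_nonneg _) hC)
      calc _ ≤ |t| * (C * (C₀ * ((C * |s * t|) ^ (n + 1) / (n + 1).factorial))) := by gcongr
        _ = _ := by rw [abs_mul, abs_of_nonneg hs.1, mul_pow, mul_pow, mul_pow]; ring
    · rw [Nat.factorial_succ (n + 1)]
      push_cast
      field_simp
      ring

/-- The iterates are partial sums of their successive differences, and the exponential bound makes
the Weierstrass test apply on a compact box around every point. -/
theorem exists_tendsto_picardIter [CompleteSpace G] {M : A × ℝ → G →L[ℝ] G} {y₀ : A → G}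
    (hM : Continuous M) (hy : Continuous y₀) :
    ∃ y : A × ℝ → G, TendstoLocallyUniformly (picardIter M y₀) y Filter.atTop := by
  have : ProperSpace A := FiniteDimensional.proper ℝ A
  let d : ℕ → A × ℝ → G := fun n p => picardIter M y₀ (n + 1) p - picardIter M y₀ n p
  refine ⟨fun p => y₀ p.1 + ∑' n, d n p, ?_⟩
  have hsum : ∀ N p, y₀ p.1 + ∑ n ∈ Finset.range N, d n p = picardIter M y₀ N p := by
    intro N p
    rw [Finset.sum_range_sub (fun n => picardIter M y₀ n p)]
    simp [picardIter]
  refine Metric.tendstoLocallyUniformly_iff.2 fun ε hε p => ?_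
  set D := Metric.closedBall p.1 1
  set T := |p.2| + 1
  have hK : IsCompact (D ×ˢ Set.Icc (-T) T) := (isCompact_closedBall _ _).prod isCompact_Icc
  obtain ⟨C, hC⟩ := hK.exists_bound_of_continuousOn hM.continuousOn
  obtain ⟨C₀, hC₀⟩ := (isCompact_closedBall p.1 1).exists_bound_of_continuousOn hy.continuousOn
  have hp0 : p.1 ∈ D := Metric.mem_closedBall_self zero_le_one
  have hT : (0 : ℝ) ≤ T := by positivity
  have hC0 : 0 ≤ C := (norm_nonneg _).trans (hC (p.1, 0) ⟨hp0, by simpa using hT⟩)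
  have hC₀0 : 0 ≤ C₀ := (norm_nonneg _).trans (hC₀ p.1 hp0)
  have hb : ∀ n, ∀ q ∈ D ×ˢ Set.Icc (-T) T,
      ‖d n q‖ ≤ C₀ * ((C * T) ^ (n + 1) / (n + 1).factorial) := by
    rintro n ⟨x, t⟩ ⟨hx, ht⟩
    have ht' : |t| ≤ T := abs_le.2 ht
    refine (norm_picardIter_sub_le hM hy hC0 (fun x hx t ht => hC (x, t) ⟨hx, abs_le.1 ht⟩)
      hC₀ n hx ht').trans ?_
    gcongr
  have hs : Summable fun n => C₀ * ((C * T) ^ (n + 1) / (n + 1).factorial) :=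
    ((summable_nat_add_iff 1).2 (Real.summable_pow_div_factorial (C * T))).mul_left C₀
  have hu := tendstoUniformlyOn_tsum_nat hs hb
  have hmem : D ×ˢ Set.Icc (-T) T ∈ nhds p := by
    refine prod_mem_nhds (Metric.closedBall_mem_nhds _ one_pos) (Icc_mem_nhds ?_ ?_)
    · have := neg_abs_le p.2; simp only [T]; linarith
    · have := le_abs_self p.2; simp only [T]; linarith
  rw [Metric.tendstoUniformlyOn_iff] at hu
  refine ⟨_, hmem, ?_⟩
  filter_upwards [hu ε hε] with N hN q hq
  rw [← hsum N q, dist_add_left]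
  exact hN q hq

/-- The linear equation satisfied by `(∂y/∂x, y)` when `∂y/∂t = M y`. -/
def prolong (M : A × ℝ → G →L[ℝ] G) (p : A × ℝ) :
    ((A →L[ℝ] G) × G) →L[ℝ] ((A →L[ℝ] G) × G) :=
  (ContinuousLinearMap.inl ℝ (A →L[ℝ] G) G).comp
      ((ContinuousLinearMap.compL ℝ A G G (M p)).comp (ContinuousLinearMap.fst ℝ _ _) +
        (fderiv ℝ (fun x => M (x, p.2)) p.1).flip.comp (ContinuousLinearMap.snd ℝ _ _)) +
    (ContinuousLinearMap.inr ℝ (A →L[ℝ] G) G).comp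
      ((M p).comp (ContinuousLinearMap.snd ℝ _ _))

theorem contDiff_prolong [FiniteDimensional ℝ G] {M : A × ℝ → G →L[ℝ] G}
    (hM : ContDiff ℝ ∞ M) : ContDiff ℝ ∞ (prolong M) := by
  refine contDiff_clm_apply_iff.2 fun Z => ?_
  have h : ∀ p, prolong M p Z =
      ((M p).comp Z.1 + (fderiv ℝ (fun x => M (x, p.2)) p.1).flip Z.2, M p Z.2) := fun p => by
    simp [prolong]
  simp only [h]
  refine ContDiff.prodMk (contDiff_clm_apply_iff.2 fun v => ?_) (hM.clm_apply contDiff_const)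
  exact (hM.clm_apply contDiff_const).add
    (((contDiff_partial_fderiv hM).clm_apply contDiff_const).clm_apply contDiff_const)

/-- Differentiating the Picard recursion in `x` gives the Picard recursion of the prolonged
equation. So convergence of the `x`-derivatives is convergence of Picard iterates once more and
needs no new estimate. -/
theorem picardIter_prolong {M : A × ℝ → G →L[ℝ] G} {y₀ : A → G} [CompleteSpace G]
    (hM : ContDiff ℝ ∞ M) (hy : ContDiff ℝ ∞ y₀) (n : ℕ) (p : A × ℝ) :
    picardIter (prolong M) (fun x => (fderiv ℝ y₀ x, y₀ x)) n p =
      (fderiv ℝ (fun x => picardIter M y₀ n (x, p.2)) p.1, picardIter M y₀ n p) := by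
  induction n generalizing p with
  | zero => rfl
  | succ n ih =>
    obtain ⟨x, t⟩ := p
    have hyn := contDiff_picardIter hM hy n
    have hsm : ContDiff ℝ ∞ (Function.uncurry fun (x : A) (s : ℝ) =>
        t • M (x, s * t) (picardIter M y₀ n (x, s * t))) := by
      have h : ContDiff ℝ ∞ fun q : A × ℝ => (q.1, q.2 * t) := by fun_prop
      exact ((hM.comp h).clm_apply (hyn.comp h)).const_smul t
    have hfd := hasFDerivAt_setIntegral_of_contDiff (μ := volume) isCompact_Icc
      (S := Set.Icc (0 : ℝ) 1) (hsm.of_le (by exact_mod_cast le_top)) x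
    have hder : fderiv ℝ (fun x => picardIter M y₀ (n + 1) (x, t)) x = fderiv ℝ y₀ x +
        ∫ s in Set.Icc (0 : ℝ) 1, fderiv ℝ
          (fun x => t • M (x, s * t) (picardIter M y₀ n (x, s * t))) x :=
      (((hy.differentiable (by simp)) x).hasFDerivAt.add hfd).fderiv
    have hint : ∀ s, fderiv ℝ (fun x => t • M (x, s * t) (picardIter M y₀ n (x, s * t))) x =
        t • ((M (x, s * t)).comp (fderiv ℝ (fun x => picardIter M y₀ n (x, s * t)) x) +
          (fderiv ℝ (fun x => M (x, s * t)) x).flip (picardIter M y₀ n (x, s * t))) := by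
      intro s
      have h : ContDiff ℝ ∞ fun z : A => (z, s * t) := by fun_prop
      have h1 := ((hM.comp h).differentiable (by simp) x).hasFDerivAt
      have h2 := ((hyn.comp h).differentiable (by simp) x).hasFDerivAt
      exact ((h1.clm_apply h2).const_smul t).fderiv
    have hpr : ∀ s, t • prolong M (x, s * t) (picardIter (prolong M)
        (fun x => (fderiv ℝ y₀ x, y₀ x)) n (x, s * t)) =
        (fderiv ℝ (fun x => t • M (x, s * t) (picardIter M y₀ n (x, s * t))) x,
          t • M (x, s * t) (picardIter M y₀ n (x, s * t))) := by
      intro s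
      rw [ih, hint]
      simp [prolong]
    have hL : picardIter (prolong M) (fun x => (fderiv ℝ y₀ x, y₀ x)) (n + 1) (x, t) =
        (fderiv ℝ y₀ x, y₀ x) + ∫ s in Set.Icc (0 : ℝ) 1,
          (fderiv ℝ (fun x => t • M (x, s * t) (picardIter M y₀ n (x, s * t))) x,
          t • M (x, s * t) (picardIter M y₀ n (x, s * t))) := by
      conv_lhs => rw [picardIter]
      simp only [hpr]
    have hI1 : IntegrableOn (fun s => fderiv ℝ
        (fun x => t • M (x, s * t) (picardIter M y₀ n (x, s * t))) x) (Set.Icc 0 1) := by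
      refine Continuous.integrableOn_Icc ?_
      exact (contDiff_partial_fderiv hsm).continuous.comp (Continuous.prodMk_right x)
    have hI2 : IntegrableOn (fun s => t • M (x, s * t) (picardIter M y₀ n (x, s * t)))
        (Set.Icc 0 1) :=
      (hsm.continuous.comp (Continuous.prodMk_right x)).integrableOn_Icc
    rw [hL, hder, integral_pair hI1 hI2]
    rfl

/-- The time component of the derivative of the iterate `n + 1` involves only the iterate `n`, so
the total derivatives converge as soon as the `x`-derivatives and the iterates do. -/
theorem hasFDerivAt_picardIter [CompleteSpace G] {M : A × ℝ → G →L[ℝ] G} {y₀ : A → G}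
    (hM : ContDiff ℝ ∞ M) (hy : ContDiff ℝ ∞ y₀) (n : ℕ) (p : A × ℝ) :
    HasFDerivAt (picardIter M y₀ (n + 1))
      ((fderiv ℝ (fun x => picardIter M y₀ (n + 1) (x, p.2)) p.1).comp
          (ContinuousLinearMap.fst ℝ A ℝ) +
        (ContinuousLinearMap.snd ℝ A ℝ).smulRight (M p (picardIter M y₀ n p))) p := by
  have h := ((contDiff_picardIter hM hy (n + 1)).differentiable (by simp) p).hasFDerivAt
  obtain ⟨x, t⟩ := p
  have h1 : HasFDerivAt (fun z => picardIter M y₀ (n + 1) (z, t)) _ x :=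
    HasFDerivAt.comp (f := fun z : A => (z, t)) x h (hasFDerivAt_prodMk_left x t)
  have h2 : HasFDerivAt (fun s => picardIter M y₀ (n + 1) (x, s)) _ t :=
    HasFDerivAt.comp (f := fun s : ℝ => (x, s)) t h (hasFDerivAt_prodMk_right x t)
  have h3 : HasDerivAt (fun s => picardIter M y₀ (n + 1) (x, s))
      (M (x, t) (picardIter M y₀ n (x, t))) t := by
    have hc : Continuous fun s : ℝ => M (x, s) (picardIter M y₀ n (x, s)) :=
      (hM.continuous.comp (Continuous.prodMk_right x)).clm_apply
        ((continuous_picardIter hM.continuous hy.continuous n).comp (Continuous.prodMk_right x))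
    simp only [picardIter_succ_eq]
    exact (intervalIntegral.integral_hasDerivAt_right (hc.intervalIntegrable _ _)
      (hc.stronglyMeasurableAtFilter _ _) hc.continuousAt).const_add _
  have h4 := h3.unique h2.hasDerivAt
  refine h.congr_fderiv ?_
  refine ContinuousLinearMap.ext fun v => ?_
  rw [h1.fderiv, h4]
  simp only [add_apply, ContinuousLinearMap.comp_apply,
    ContinuousLinearMap.smulRight_apply, ContinuousLinearMap.coe_fst', ContinuousLinearMap.coe_snd',
    ContinuousLinearMap.inl_apply, ContinuousLinearMap.inr_apply]
  rw [← map_smul, ← map_add]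
  simp

/-- Continuous convergence passes through continuous operations, such as applying `M p` to the
iterates, by composing limits; local uniformity can then be recovered at the end. -/
theorem tendstoLocallyUniformly_iff_continuousConvergence {ι X β : Type*} [TopologicalSpace X]
    [PseudoMetricSpace β] {u : ι → X → β} {f : X → β} {l : Filter ι} (hf : Continuous f) :
    TendstoLocallyUniformly u f l ↔
      ∀ x, Filter.Tendsto (fun y : ι × X => u y.1 y.2) (l ×ˢ nhds x) (nhds (f x)) := by
  rw [tendstoLocallyUniformly_iff_forall_tendsto]
  refine forall_congr' fun x => ?_
  have hx : Filter.Tendsto (fun y : ι × X => f y.2) (l ×ˢ nhds x) (nhds (f x)) :=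
    (hf.tendsto x).comp Filter.tendsto_snd
  rw [tendsto_uniformity_iff_dist_tendsto_zero]
  constructor
  · intro h
    rw [tendsto_iff_dist_tendsto_zero] at hx ⊢
    refine squeeze_zero (fun _ => dist_nonneg) (fun y => ?_) (by simpa using h.add hx)
    rw [dist_comm (f y.2) (u y.1 y.2)]
    exact dist_triangle _ _ _
  · intro h
    simpa using hx.dist h

/-- Locally uniform convergence of the iterates together with their total derivatives makes the
limit differentiable, with the limiting derivative. -/
theorem exists_tendsto_prolong [FiniteDimensional ℝ G] {M : A × ℝ → G →L[ℝ] G} {y₀ : A → G}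
    (hM : ContDiff ℝ ∞ M) (hy : ContDiff ℝ ∞ y₀) {y : A × ℝ → G}
    (h : TendstoLocallyUniformly (picardIter M y₀) y Filter.atTop) :
    ∃ Y : A × ℝ → (A →L[ℝ] G) × G,
      TendstoLocallyUniformly (picardIter (prolong M) (fun x => (fderiv ℝ y₀ x, y₀ x)))
        Y Filter.atTop ∧ ∀ p, HasFDerivAt y
          ((Y p).1.comp (ContinuousLinearMap.fst ℝ A ℝ) +
            (ContinuousLinearMap.snd ℝ A ℝ).smulRight (M p (y p))) p := by
  have : CompleteSpace G := FiniteDimensional.complete ℝ G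
  have hy' : ContDiff ℝ ∞ fun x => (fderiv ℝ y₀ x, y₀ x) :=
    (hy.fderiv_right (m := ∞) (by simp)).prodMk hy
  obtain ⟨Y, hY⟩ := exists_tendsto_picardIter (contDiff_prolong hM).continuous hy'.continuous
  refine ⟨Y, hY, fun p => ?_⟩
  have hYc : Continuous Y := hY.continuous
    (Filter.Eventually.of_forall fun n =>
      continuous_picardIter (contDiff_prolong hM).continuous hy'.continuous n).frequently
  have hyc : Continuous y := h.continuous
    (Filter.Eventually.of_forall fun n =>
      continuous_picardIter hM.continuous hy.continuous n).frequently
  have hlim : Continuous fun p => (Y p).1.comp (ContinuousLinearMap.fst ℝ A ℝ) +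
      (ContinuousLinearMap.snd ℝ A ℝ).smulRight (M p (y p)) := by
    have h1 : Continuous fun p => (Y p).1.comp (ContinuousLinearMap.fst ℝ A ℝ) :=
      hYc.fst.clm_comp continuous_const
    have h2 : Continuous fun p => (ContinuousLinearMap.snd ℝ A ℝ).smulRight (M p (y p)) :=
      ((ContinuousLinearMap.smulRightL ℝ (A × ℝ) G (ContinuousLinearMap.snd ℝ A ℝ)).continuous.comp
        (hM.continuous.clm_apply hyc))
    exact h1.add h2
  refine hasFDerivAt_of_tendstoLocallyUniformlyOn (l := Filter.atTop) (s := Set.univ) isOpen_univ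
    (tendstoLocallyUniformlyOn_univ.2
      ((tendstoLocallyUniformly_iff_continuousConvergence hlim).2 fun q => ?_))
    (fun n q _ => hasFDerivAt_picardIter hM hy n q) (fun q _ => ?_) (Set.mem_univ p)
  -- The index is shifted because the derivative formula holds from the first proper iterate on.
  · have hs : Filter.Tendsto (fun z : ℕ × (A × ℝ) => (z.1 + 1, z.2)) (Filter.atTop ×ˢ nhds q)
        (Filter.atTop ×ˢ nhds q) :=
      ((Filter.tendsto_add_atTop_nat 1).comp Filter.tendsto_fst).prodMk Filter.tendsto_snd
    have h1 := ((tendstoLocallyUniformly_iff_continuousConvergence hYc).1 hY q).comp hs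
    have h2 := (tendstoLocallyUniformly_iff_continuousConvergence hyc).1 h q
    have h3 : Filter.Tendsto (fun z : ℕ × (A × ℝ) => M z.2) (Filter.atTop ×ˢ nhds q)
        (nhds (M q)) := (hM.continuous.tendsto q).comp Filter.tendsto_snd
    have h1' := (continuous_fst.tendsto _).comp h1
    simp only [Function.comp_def, picardIter_prolong hM hy] at h1'
    refine Filter.Tendsto.add ?_ ?_
    · exact (((ContinuousLinearMap.compL ℝ (A × ℝ) A G).flip
        (ContinuousLinearMap.fst ℝ A ℝ)).continuous.tendsto _).comp h1'
    · exact ((ContinuousLinearMap.smulRightL ℝ (A × ℝ) G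
        (ContinuousLinearMap.snd ℝ A ℝ)).continuous.tendsto _).comp
          ((isBoundedBilinearMap_apply.continuous.tendsto (M q, y q)).comp (h3.prodMk_nhds h2))
  · exact (TendstoLocallyUniformlyOn.tendsto_at (tendstoLocallyUniformlyOn_univ.2 h)
      (Set.mem_univ q)).comp (Filter.tendsto_add_atTop_nat 1)

/-- Bootstrapping: the derivative of `y` is algebraic in `M`, `y` and the limit `Y` of the prolonged
iterates, and `Y` is a limit of the same kind with values in `(A →L[ℝ] G) × G`. The induction
therefore runs over all value spaces. -/
theorem contDiff_of_tendsto_picardIter {A : Type} [NormedAddCommGroup A] [NormedSpace ℝ A]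
    [FiniteDimensional ℝ A] {G : Type*} [NormedAddCommGroup G] [NormedSpace ℝ G]
    [FiniteDimensional ℝ G] {M : A × ℝ → G →L[ℝ] G} {y₀ : A → G}
    (hM : ContDiff ℝ ∞ M) (hy : ContDiff ℝ ∞ y₀) {y : A × ℝ → G}
    (h : TendstoLocallyUniformly (picardIter M y₀) y Filter.atTop) :
    ContDiff ℝ ∞ y := by
  refine contDiff_infty.2 fun n => ?_
  induction n generalizing G with
  | zero =>
    exact contDiff_zero.2 (h.continuous (Filter.Eventually.of_forall fun n =>
      continuous_picardIter hM.continuous hy.continuous n).frequently)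
  | succ n ih =>
    obtain ⟨Y, hY, hd⟩ := exists_tendsto_prolong hM hy h
    have hy' : ContDiff ℝ ∞ fun x => (fderiv ℝ y₀ x, y₀ x) :=
      (hy.fderiv_right (m := ∞) (by simp)).prodMk hy
    have hYn : ContDiff ℝ n Y := ih (contDiff_prolong hM) hy' hY
    have hyn : ContDiff ℝ n y := ih hM hy h
    push_cast
    refine contDiff_succ_iff_fderiv.2 ⟨fun p => (hd p).differentiableAt, by simp, ?_⟩
    rw [show fderiv ℝ y = _ from funext fun p => (hd p).fderiv]
    have hMn : ContDiff ℝ n M := hM.of_le (by exact_mod_cast le_top)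
    exact (hYn.fst.clm_comp contDiff_const).add (contDiff_const.smulRight (hMn.clm_apply hyn))

theorem exists_contDiff_linearODE {A : Type} [NormedAddCommGroup A] [NormedSpace ℝ A]
    [FiniteDimensional ℝ A] {G : Type*} [NormedAddCommGroup G] [NormedSpace ℝ G]
    [FiniteDimensional ℝ G] {M : A × ℝ → G →L[ℝ] G} {y₀ : A → G}
    (hM : ContDiff ℝ ∞ M) (hy : ContDiff ℝ ∞ y₀) :
    ∃ y : A × ℝ → G, ContDiff ℝ ∞ y ∧ (∀ x, y (x, 0) = y₀ x) ∧
      ∀ p, fderiv ℝ y p (0, 1) = M p (y p) := by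
  have : CompleteSpace G := FiniteDimensional.complete ℝ G
  obtain ⟨y, h⟩ := exists_tendsto_picardIter hM.continuous hy.continuous
  obtain ⟨Y, -, hY⟩ := exists_tendsto_prolong hM hy h
  refine ⟨y, contDiff_of_tendsto_picardIter hM hy h, fun x => ?_, fun p => ?_⟩
  -- At time `0` every iterate equals the initial value.
  · refine tendsto_nhds_unique (TendstoLocallyUniformlyOn.tendsto_at
      (tendstoLocallyUniformlyOn_univ.2 h) (Set.mem_univ (x, 0)))
      (tendsto_const_nhds.congr fun n => ?_)
    cases n <;> simp [picardIter]
  · simp [(hY p).fderiv]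

end LinearODE

/-! ### Connections in local trivializations -/

section Connection

variable {K : Type*} [RCLike K]
    {E : Type*} [NormedAddCommGroup E] [NormedSpace ℝ E]
    {X : Type*} [TopologicalSpace X] [ChartedSpace E X]
    {F : Type*} [NormedAddCommGroup F] [NormedSpace ℝ F]
    [NormedSpace K F]
    {V : X → Type*} [TopologicalSpace (TotalSpace F V)]
    [∀ x, AddCommGroup (V x)] [∀ x, Module ℝ (V x)] [∀ x, Module K (V x)]
    [∀ x, TopologicalSpace (V x)]
    [FiberBundle F V]

variable (F) in
/-- The coordinate of a vector in the trivialization at `b`. -/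
def coord (b : X) {y : X} (v : V y) : F := (trivializationAt F V b ⟨y, v⟩).2

variable (V) in
/-- The vector with given coordinate in the trivialization at `b`. -/
def ofCoord (b y : X) (w : F) : V y := (trivializationAt F V b).symm y w

variable {b y : X}

theorem coord_ofCoord (hy : y ∈ (trivializationAt F V b).baseSet) (w : F) :
    coord F b (ofCoord V b y w) = w := by
  simp [coord, ofCoord, hy]

theorem ofCoord_coord (hy : y ∈ (trivializationAt F V b).baseSet) (v : V y) :
    ofCoord V b y (coord F b v) = v := by
  simp [coord, ofCoord, hy]

theorem coord_add [VectorBundle ℝ F V] (hy : y ∈ (trivializationAt F V b).baseSet) (v v' : V y) :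
    coord F b (v + v') = coord F b v + coord F b v' :=
  ((trivializationAt F V b).linear ℝ hy).map_add v v'

theorem coord_smul [VectorBundle K F V] (hy : y ∈ (trivializationAt F V b).baseSet) (c : K)
    (v : V y) : coord F b (c • v) = c • coord F b v :=
  ((trivializationAt F V b).linear K hy).map_smul c v

theorem ofCoord_add [VectorBundle ℝ F V] (hy : y ∈ (trivializationAt F V b).baseSet) (w w' : F) :
    ofCoord V b y (w + w') = ofCoord V b y w + ofCoord V b y w' :=
  map_add ((trivializationAt F V b).linearEquivAt ℝ y hy).symm w w'

theorem ofCoord_smul [VectorBundle K F V] (hy : y ∈ (trivializationAt F V b).baseSet) (c : K)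
    (w : F) : ofCoord V b y (c • w) = c • ofCoord V b y w :=
  map_smul ((trivializationAt F V b).linearEquivAt K y hy).symm c w

theorem coord_self_mem (b : X) : b ∈ (trivializationAt F V b).baseSet :=
  FiberBundle.mem_baseSet_trivializationAt' b

theorem coord_injective (hy : y ∈ (trivializationAt F V b).baseSet) {v v' : V y}
    (h : coord F b v = coord F b v') : v = v' := by
  rw [← ofCoord_coord hy v, h, ofCoord_coord hy]

variable (K F V) in
/-- The trivialization at `b` as a linear equivalence on the fibre over `y`. -/
def coordEquiv [VectorBundle K F V] (hy : y ∈ (trivializationAt F V b).baseSet) : V y ≃ₗ[K] F :=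
  (trivializationAt F V b).linearEquivAt K y hy

theorem coordEquiv_symm_apply [VectorBundle K F V] (hy : y ∈ (trivializationAt F V b).baseSet)
    (w : F) : (coordEquiv K F V hy).symm w = ofCoord V b y w := rfl

variable [∀ x, IsTopologicalAddGroup (V x)] [∀ x, ContinuousSMul ℝ (V x)]

variable (K) in
/-- The connection form in the trivialization at `b`. -/
def connForm (cov : CovariantDerivative 𝓘(ℝ, E) F V) (b y : X) (v : TangentSpace 𝓘(ℝ, E) y)
    [FiniteDimensional K F] : F →L[K] F :=
  LinearMap.toContinuousLinearMap ((Module.finBasis K F).constr K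
    fun i => coord F b (cov (fun z => ofCoord V b z (Module.finBasis K F i)) y v))

variable [VectorBundle ℝ F V] [VectorBundle K F V] [IsManifold 𝓘(ℝ, E) ∞ X]
    [ContMDiffVectorBundle ∞ F V 𝓘(ℝ, E)]

section Smooth

omit [∀ x, IsTopologicalAddGroup (V x)] [∀ x, ContinuousSMul ℝ (V x)]

variable {B : Type*} [NormedAddCommGroup B] [NormedSpace ℝ B] {f : B → X} {p : B}
  {s : ∀ p, V (f p)}

theorem contMDiffAt_along_iff (hf : ContMDiffAt 𝓘(ℝ, B) 𝓘(ℝ, E) ∞ f p)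
    (hb : f p ∈ (trivializationAt F V b).baseSet) :
    ContMDiffAt 𝓘(ℝ, B) (𝓘(ℝ, E).prod 𝓘(ℝ, F)) ∞ (fun q => (⟨f q, s q⟩ : TotalSpace F V)) p ↔
      ContDiffAt ℝ ∞ (fun q => coord F b (s q)) p := by
  rw [(trivializationAt F V b).contMDiffAt_iff ((trivializationAt F V b).mem_source.2 hb)]
  rw [contMDiffAt_iff_contDiffAt]
  exact ⟨fun h => h.2, fun h => ⟨hf, h⟩⟩

theorem contMDiffAt_ofCoord (hy : y ∈ (trivializationAt F V b).baseSet) (w : F) :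
    ContMDiffAt 𝓘(ℝ, E) (𝓘(ℝ, E).prod 𝓘(ℝ, F)) ∞
      (fun z => (⟨z, ofCoord V b z w⟩ : TotalSpace F V)) y := by
  rw [(trivializationAt F V b).contMDiffAt_section_iff hy]
  refine (contMDiffAt_const (c := w)).congr_of_eventuallyEq ?_
  filter_upwards [(trivializationAt F V b).open_baseSet.mem_nhds hy] with z hz
  exact coord_ofCoord hz w

theorem mdifferentiableAt_ofCoord (hy : y ∈ (trivializationAt F V b).baseSet) (w : F) :
    MDifferentiableAt 𝓘(ℝ, E) (𝓘(ℝ, E).prod 𝓘(ℝ, F))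
      (fun z => (⟨z, ofCoord V b z w⟩ : TotalSpace F V)) y :=
  (contMDiffAt_ofCoord hy w).mdifferentiableAt (by simp)

theorem mdifferentiableAt_section_coord {σ : ∀ x, V x}
    (hy : y ∈ (trivializationAt F V b).baseSet) :
    MDifferentiableAt 𝓘(ℝ, E) (𝓘(ℝ, E).prod 𝓘(ℝ, F))
      (fun z => (⟨z, σ z⟩ : TotalSpace F V)) y ↔
    MDifferentiableAt 𝓘(ℝ, E) 𝓘(ℝ, F) (fun z => coord F b (σ z)) y := by
  have : ContMDiffVectorBundle 1 F V 𝓘(ℝ, E) := ContMDiffVectorBundle.of_le (n := ∞) (by simp)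
  exact (trivializationAt F V b).mdifferentiableAt_section_iff 𝓘(ℝ, E) σ hy

end Smooth

variable {cov : CovariantDerivative 𝓘(ℝ, E) F V}

theorem cov_sum {ι : Type*} (S : Finset ι) (σ : ι → ∀ x, V x)
    (h : ∀ i, MDifferentiableAt 𝓘(ℝ, E) (𝓘(ℝ, E).prod 𝓘(ℝ, F))
      (fun z => (⟨z, σ i z⟩ : TotalSpace F V)) y) :
    cov (fun z => ∑ i ∈ S, σ i z) y = ∑ i ∈ S, cov (σ i) y := by
  classical
  have : ContMDiffVectorBundle 1 F V 𝓘(ℝ, E) := ContMDiffVectorBundle.of_le (n := ∞) (by simp)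
  induction S using Finset.induction_on with
  | empty =>
    simp only [Finset.sum_empty]
    exact congrFun cov.zero y
  | insert i S hi ih =>
    simp only [Finset.sum_insert hi, ← ih]
    exact cov.isCovariantDerivativeOnUniv.add (h i) (.sum_section fun j _ => h j)

variable [FiniteDimensional ℝ F]

omit [FiniteDimensional ℝ F] in
-- Locality: a covariant derivative at a point depends only on the germ of the section, so local
-- frames can be exchanged with global sections.
theorem cov_congr {σ σ' : ∀ x, V x}
    (hσ : MDifferentiableAt 𝓘(ℝ, E) (𝓘(ℝ, E).prod 𝓘(ℝ, F))
      (fun z => (⟨z, σ z⟩ : TotalSpace F V)) y) (h : ∀ᶠ z in nhds y, σ z = σ' z) :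
    cov σ y = cov σ' y := by
  refine cov.isCovariantDerivativeOnUniv.congr_of_eventuallyEq hσ ?_ Filter.univ_mem h
  refine hσ.congr_of_eventuallyEq ?_
  filter_upwards [h] with z hz
  rw [hz]

/-- The local formula `∇σ = dσ + Γσ`, with `Γ` applied to vectors as a plain function. -/
theorem coord_cov_aux {σ : ∀ x, V x} (hy : y ∈ (trivializationAt F V b).baseSet)
    (hσ : MDifferentiableAt 𝓘(ℝ, E) (𝓘(ℝ, E).prod 𝓘(ℝ, F))
      (fun z => (⟨z, σ z⟩ : TotalSpace F V)) y) (v : TangentSpace 𝓘(ℝ, E) y) :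
    coord F b (cov σ y v) = mvfderiv 𝓘(ℝ, E) (fun z => coord F b (σ z)) y v +
        ∑ i, (Module.finBasis ℝ F).coord i (coord F b (σ y)) •
          coord F b (cov (fun z => ofCoord V b z (Module.finBasis ℝ F i)) y v) := by
  set β := Module.finBasis ℝ F
  let g : X → F := fun z => coord F b (σ z)
  have hg : MDifferentiableAt 𝓘(ℝ, E) 𝓘(ℝ, F) g y := (mdifferentiableAt_section_coord hy).1 hσ
  let c : Fin (Module.finrank ℝ F) → X → ℝ := fun i z => β.coord i (g z)
  have hL : ∀ i, HasMFDerivAt 𝓘(ℝ, E) 𝓘(ℝ, ℝ) (c i) y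
      ((LinearMap.toContinuousLinearMap (β.coord i)).comp (mfderiv 𝓘(ℝ, E) 𝓘(ℝ, F) g y)) :=
    fun i => (LinearMap.toContinuousLinearMap (β.coord i)).hasMFDerivAt.comp y hg.hasMFDerivAt
  have hb : ∀ᶠ z in nhds y, z ∈ (trivializationAt F V b).baseSet :=
    (trivializationAt F V b).open_baseSet.mem_nhds hy
  -- The section is expanded in the local frame with real coefficient functions, since the Leibniz
  -- rule of `cov` is over `ℝ`; the scalars `K` enter only in `coord_cov`.
  have hsum : ∀ᶠ z in nhds y, σ z = ∑ i, (c i • fun z => ofCoord V b z (β i)) z := by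
    filter_upwards [hb] with z hz
    have h := β.sum_repr (g z)
    rw [← ofCoord_coord hz (σ z)]
    change ofCoord V b z (g z) = _
    conv_lhs => rw [← h]
    have hm := map_sum ((trivializationAt F V b).linearEquivAt ℝ z hz).symm
      (fun i => β.repr (g z) i • β i) Finset.univ
    refine hm.trans (Finset.sum_congr rfl fun i _ => ?_)
    exact ofCoord_smul (K := ℝ) hz _ _
  have hmd : ∀ i, MDifferentiableAt 𝓘(ℝ, E) (𝓘(ℝ, E).prod 𝓘(ℝ, F))
      (fun z => (⟨z, (c i • fun z => ofCoord V b z (β i)) z⟩ : TotalSpace F V)) y :=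
    fun i => (hL i).mdifferentiableAt.smul_section (mdifferentiableAt_ofCoord hy (β i))
  have hcl : ∀ (S : Finset (Fin (Module.finrank ℝ F))) (u : Fin (Module.finrank ℝ F) → V y),
      coord F b (∑ i ∈ S, u i) = ∑ i ∈ S, coord F b (u i) := fun S u =>
    map_sum ((trivializationAt F V b).linearEquivAt ℝ y hy) u S
  rw [cov_congr hσ hsum, cov_sum Finset.univ _ hmd]
  have h1 : ∀ i, cov (c i • fun z => ofCoord V b z (β i)) y v =
      c i y • cov (fun z => ofCoord V b z (β i)) y v +
        (β.coord i (mvfderiv 𝓘(ℝ, E) g y v)) • ofCoord V b y (β i) := fun i => by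
    rw [cov.isCovariantDerivativeOnUniv.leibniz (mdifferentiableAt_ofCoord hy (β i))
      (hL i).mdifferentiableAt]
    have h2 : mvfderiv 𝓘(ℝ, E) (c i) y v = β.coord i (mvfderiv 𝓘(ℝ, E) g y v) := by
      simp only [mvfderiv, (hL i).mfderiv]
      rfl
    rw [← h2]
    rfl
  rw [sum_apply, hcl]
  simp only [h1, coord_add hy, coord_smul (K := ℝ) hy, coord_ofCoord hy, Finset.sum_add_distrib]
  rw [add_comm]
  congr 1
  exact β.sum_repr (mvfderiv 𝓘(ℝ, E) g y v)

variable (K) in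
/-- The covariant derivative is linear over the scalars `K`. -/
def IsScalarLinear (cov : CovariantDerivative 𝓘(ℝ, E) F V) : Prop :=
  ∀ (c : K) (σ : ∀ x, V x) (x : X),
    MDifferentiableAt 𝓘(ℝ, E) (𝓘(ℝ, E).prod 𝓘(ℝ, F)) (fun y => (⟨y, σ y⟩ : TotalSpace F V)) x →
    ∀ v, cov (fun y => c • σ y) x v = c • cov σ x v

variable [FiniteDimensional K F]

/-- `connForm` is prescribed on a `K`-basis and extended linearly. The covariant derivative of a
constant section is itself `K`-linear in the constant, so the two agree on all of `F`. -/
theorem connForm_apply (hK : IsScalarLinear K cov) (hy : y ∈ (trivializationAt F V b).baseSet)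
    (v : TangentSpace 𝓘(ℝ, E) y) (w : F) :
    connForm K cov b y v w = coord F b (cov (fun z => ofCoord V b z w) y v) := by
  have hb : ∀ᶠ z in nhds y, z ∈ (trivializationAt F V b).baseSet :=
    (trivializationAt F V b).open_baseSet.mem_nhds hy
  let L : F →ₗ[K] F :=
    { toFun := fun w => coord F b (cov (fun z => ofCoord V b z w) y v)
      map_add' := fun w w' => by
        have h : cov (fun z => ofCoord V b z (w + w')) y =
            cov ((fun z => ofCoord V b z w) + fun z => ofCoord V b z w') y :=
          cov_congr (mdifferentiableAt_ofCoord hy _) (hb.mono fun z hz => ofCoord_add hz w w')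
        rw [h, cov.isCovariantDerivativeOnUniv.add (mdifferentiableAt_ofCoord hy _)
          (mdifferentiableAt_ofCoord hy _)]
        exact coord_add hy _ _
      map_smul' := fun c w => by
        have h : cov (fun z => ofCoord V b z (c • w)) y =
            cov (fun z => c • ofCoord V b z w) y :=
          cov_congr (mdifferentiableAt_ofCoord hy _) (hb.mono fun z hz => ofCoord_smul hz c w)
        rw [h, hK c _ y (mdifferentiableAt_ofCoord hy w)]
        exact coord_smul hy _ _ }
  have : (Module.finBasis K F).constr K
      (fun i => coord F b (cov (fun z => ofCoord V b z (Module.finBasis K F i)) y v)) = L :=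
    (Module.finBasis K F).ext fun i => by simp [L]
  exact congrArg (fun T : F →ₗ[K] F => T w) this

/-- The local formula `∇σ = dσ + Γσ`. -/
theorem coord_cov [IsScalarTower ℝ K F] (hK : IsScalarLinear K cov) {σ : ∀ x, V x}
    (hy : y ∈ (trivializationAt F V b).baseSet)
    (hσ : MDifferentiableAt 𝓘(ℝ, E) (𝓘(ℝ, E).prod 𝓘(ℝ, F))
      (fun z => (⟨z, σ z⟩ : TotalSpace F V)) y) (v : TangentSpace 𝓘(ℝ, E) y) :
    coord F b (cov σ y v) = mvfderiv 𝓘(ℝ, E) (fun z => coord F b (σ z)) y v +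
      connForm K cov b y v (coord F b (σ y)) := by
  rw [coord_cov_aux hy hσ v]
  congr 1
  simp only [← connForm_apply hK hy]
  conv_rhs => rw [← (Module.finBasis ℝ F).sum_repr (coord F b (σ y))]
  rw [map_sum]
  exact Finset.sum_congr rfl fun i _ =>
    (((connForm K cov b y v).restrictScalars ℝ).map_smul _ _).symm

theorem connForm_add (hK : IsScalarLinear K cov) (hy : y ∈ (trivializationAt F V b).baseSet)
    (v v' : TangentSpace 𝓘(ℝ, E) y) :
    connForm K cov b y (v + v') = connForm K cov b y v + connForm K cov b y v' := by
  ext w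
  rw [add_apply, connForm_apply hK hy, connForm_apply hK hy, connForm_apply hK hy,
    map_add, coord_add hy]

theorem connForm_smul [IsScalarTower ℝ K F] (hK : IsScalarLinear K cov)
    (hy : y ∈ (trivializationAt F V b).baseSet)
    (c : ℝ) (v : TangentSpace 𝓘(ℝ, E) y) :
    connForm K cov b y (c • v) = c • connForm K cov b y v := by
  ext w
  rw [smul_apply, connForm_apply hK hy, connForm_apply hK hy, map_smul,
    coord_smul (K := ℝ) hy]

end Connection

/-! ### Covariant derivatives of sections along a map -/

section Along

variable {K : Type*} [RCLike K]
    {E : Type*} [NormedAddCommGroup E] [NormedSpace ℝ E]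
    {X : Type*} [TopologicalSpace X] [ChartedSpace E X]
    {F : Type*} [NormedAddCommGroup F] [NormedSpace ℝ F] [FiniteDimensional ℝ F]
    [NormedSpace K F] [IsScalarTower ℝ K F] [FiniteDimensional K F]
    {V : X → Type*} [TopologicalSpace (TotalSpace F V)]
    [∀ x, AddCommGroup (V x)] [∀ x, Module ℝ (V x)] [∀ x, Module K (V x)]
    [∀ x, TopologicalSpace (V x)]
    [∀ x, IsTopologicalAddGroup (V x)] [∀ x, ContinuousSMul ℝ (V x)]
    [FiberBundle F V] [VectorBundle ℝ F V] [VectorBundle K F V] [IsManifold 𝓘(ℝ, E) ∞ X]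
    [ContMDiffVectorBundle ∞ F V 𝓘(ℝ, E)]
    {B' : Type*} [NormedAddCommGroup B'] [NormedSpace ℝ B']
    {B : Type*} [NormedAddCommGroup B] [NormedSpace ℝ B]

/-- The covariant derivative `∇_v s` at `p` of a section `s` along `f : B → X`. -/
def covAlong (cov : CovariantDerivative 𝓘(ℝ, E) F V) (f : B → X) (s : ∀ p, V (f p)) (p v : B) :
    V (f p) :=
  ofCoord V (f p) (f p) (fderiv ℝ (fun q => coord F (f p) (s q)) p v) +
    cov (FiberBundle.extend F (s p)) (f p) (mfderiv 𝓘(ℝ, B) 𝓘(ℝ, E) f p v)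

variable {cov : CovariantDerivative 𝓘(ℝ, E) F V}

theorem covDerivAlong_eq (γ : ℝ → X) (s : ∀ t, V (γ t)) (t : ℝ) :
    covDerivAlong cov γ s t = covAlong cov γ s t 1 := rfl

theorem hasFDerivAt_comp_mvfderiv {W : Type*} [NormedAddCommGroup W] [NormedSpace ℝ W] {g : X → W}
    {f : B → X} {p : B} (hg : MDifferentiableAt 𝓘(ℝ, E) 𝓘(ℝ, W) g (f p))
    (hf : MDifferentiableAt 𝓘(ℝ, B) 𝓘(ℝ, E) f p) :
    HasFDerivAt (fun q => g (f q))
      ((mvfderiv 𝓘(ℝ, E) g (f p)).comp (mfderiv 𝓘(ℝ, B) 𝓘(ℝ, E) f p) : B →L[ℝ] W) p :=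
  (HasMFDerivAt.comp p hg.hasMFDerivAt hf.hasMFDerivAt).hasFDerivAt

theorem mvfderiv_congr {W : Type*} [NormedAddCommGroup W] [NormedSpace ℝ W] {g g' : X → W}
    {y : X} (h : g =ᶠ[nhds y] g') (v : TangentSpace 𝓘(ℝ, E) y) :
    mvfderiv 𝓘(ℝ, E) g y v = mvfderiv 𝓘(ℝ, E) g' y v := by
  have := h.mfderiv_eq (I := 𝓘(ℝ, E)) (I' := 𝓘(ℝ, W))
  exact congrArg (fun L : E →L[ℝ] W => L v) this

section

variable {f : B → X} {s : ∀ p, V (f p)} {p : B} {b : X}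

theorem differentiableAt_coord
    (hs : MDifferentiableAt 𝓘(ℝ, B) (𝓘(ℝ, E).prod 𝓘(ℝ, F))
      (fun q => (⟨f q, s q⟩ : TotalSpace F V)) p)
    (hb : f p ∈ (trivializationAt F V b).baseSet) :
    DifferentiableAt ℝ (fun q => coord F b (s q)) p := by
  have : ContMDiffVectorBundle 1 F V 𝓘(ℝ, E) := ContMDiffVectorBundle.of_le (n := ∞) (by simp)
  have h := ((trivializationAt F V b).mdifferentiableAt_totalSpace_iff 𝓘(ℝ, E)
    (fun q => (⟨f q, s q⟩ : TotalSpace F V)) ((trivializationAt F V b).mem_source.2 hb)).1 hs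
  exact h.2.differentiableAt

theorem mdifferentiableAt_base
    (hs : MDifferentiableAt 𝓘(ℝ, B) (𝓘(ℝ, E).prod 𝓘(ℝ, F))
      (fun q => (⟨f q, s q⟩ : TotalSpace F V)) p) :
    MDifferentiableAt 𝓘(ℝ, B) 𝓘(ℝ, E) f p :=
  ((mdifferentiableAt_totalSpace 𝓘(ℝ, E) _).1 hs).1

theorem eventually_mem_baseSet (hf : ContinuousAt f p)
    (hb : f p ∈ (trivializationAt F V b).baseSet) :
    ∀ᶠ q in nhds p, f q ∈ (trivializationAt F V b).baseSet :=
  hf.preimage_mem_nhds ((trivializationAt F V b).open_baseSet.mem_nhds hb)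

/-- The local formula `∇_v s = D_v s + Γ(df v) s` along a map. -/
theorem coord_covAlong (hK : IsScalarLinear K cov)
    (hs : MDifferentiableAt 𝓘(ℝ, B) (𝓘(ℝ, E).prod 𝓘(ℝ, F))
      (fun q => (⟨f q, s q⟩ : TotalSpace F V)) p)
    (hb : f p ∈ (trivializationAt F V b).baseSet) (v : B) :
    coord F b (covAlong cov f s p v) = fderiv ℝ (fun q => coord F b (s q)) p v +
      connForm K cov b (f p) (mfderiv 𝓘(ℝ, B) 𝓘(ℝ, E) f p v) (coord F b (s p)) := by
  have : ContMDiffVectorBundle 1 F V 𝓘(ℝ, E) := ContMDiffVectorBundle.of_le (n := ∞) (by simp)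
  have hf := mdifferentiableAt_base hs
  have hc : f p ∈ (trivializationAt F V (f p)).baseSet := coord_self_mem (f p)
  -- The transition function from the trivialization at `f p`, where `covAlong` is defined, to the
  -- one at `b`. Its derivative occurs on both sides: from the product rule for the coordinates of
  -- `s`, and from `∇` of the extension that is constant at `f p`.
  let g : X → F →L[ℝ] F := fun y =>
    ((trivializationAt F V (f p)).coordChangeL ℝ (trivializationAt F V b) y : F →L[ℝ] F)
  have hg : MDifferentiableAt 𝓘(ℝ, E) 𝓘(ℝ, F →L[ℝ] F) g (f p) :=
    (contMDiffAt_coordChangeL (n := 1) (IB := 𝓘(ℝ, E)) hc hb).mdifferentiableAt (by simp)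
  have hgapp : ∀ y, y ∈ (trivializationAt F V (f p)).baseSet →
      y ∈ (trivializationAt F V b).baseSet → ∀ w, g y w = coord F b (ofCoord V (f p) y w) :=
    fun y h1 h2 w => Trivialization.coordChangeL_apply _ _ ⟨h1, h2⟩ w
  have hd := differentiableAt_coord hs hc
  have e1 : (fun q => coord F b (s q)) =ᶠ[nhds p] fun q => g (f q) (coord F (f p) (s q)) := by
    filter_upwards [eventually_mem_baseSet hf.continuousAt hc,
      eventually_mem_baseSet hf.continuousAt hb] with q h1 h2
    rw [hgapp _ h1 h2, ofCoord_coord h1]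
  have h1 := (hasFDerivAt_comp_mvfderiv hg hf).clm_apply hd.hasFDerivAt
  rw [e1.fderiv_eq, h1.fderiv]
  rw [covAlong, coord_add hb, ← hgapp _ hc hb, coord_cov hK hb
    ((FiberBundle.contMDiffAt_extend 𝓘(ℝ, E) F (s p) (k := 1)).mdifferentiableAt (by simp))]
  rw [FiberBundle.extend_apply_self]
  have e2 : (fun z => coord F b (FiberBundle.extend F (s p) z)) =ᶠ[nhds (f p)]
      fun z => g z (coord F (f p) (s p)) := by
    filter_upwards [(trivializationAt F V (f p)).open_baseSet.mem_nhds hc,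
      (trivializationAt F V b).open_baseSet.mem_nhds hb] with z h1 h2
    rw [hgapp z h1 h2]
    rfl
  rw [mvfderiv_congr e2]
  have h3 : mvfderiv 𝓘(ℝ, E) (fun z => g z (coord F (f p) (s p))) (f p)
      (mfderiv 𝓘(ℝ, B) 𝓘(ℝ, E) f p v) =
      (mvfderiv 𝓘(ℝ, E) g (f p) (mfderiv 𝓘(ℝ, B) 𝓘(ℝ, E) f p v)) (coord F (f p) (s p)) := by
    have h4 : HasMFDerivAt 𝓘(ℝ, E) 𝓘(ℝ, F) (fun z => g z (coord F (f p) (s p))) (f p)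
        ((ContinuousLinearMap.apply ℝ F (coord F (f p) (s p))).comp
          (mfderiv 𝓘(ℝ, E) 𝓘(ℝ, F →L[ℝ] F) g (f p))) :=
      (ContinuousLinearMap.apply ℝ F (coord F (f p) (s p))).hasMFDerivAt.comp (f p)
        hg.hasMFDerivAt
    simp only [mvfderiv, h4.mfderiv]
    rfl
  rw [h3, ← add_assoc]
  rfl

/-- The chain rule, read in one trivialization: both the coordinate derivative and the connection
form depend on the direction only through the differential of `φ`. -/
theorem covAlong_comp (hK : IsScalarLinear K cov) {φ : B' → B} {q : B'}
    (hs : MDifferentiableAt 𝓘(ℝ, B) (𝓘(ℝ, E).prod 𝓘(ℝ, F))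
      (fun q => (⟨f q, s q⟩ : TotalSpace F V)) (φ q))
    (hφ : DifferentiableAt ℝ φ q) (v : B') :
    covAlong cov (fun r => f (φ r)) (fun r => s (φ r)) q v =
      covAlong cov f s (φ q) (fderiv ℝ φ q v) := by
  have hb : f (φ q) ∈ (trivializationAt F V (f (φ q))).baseSet := coord_self_mem _
  have hs' : MDifferentiableAt 𝓘(ℝ, B') (𝓘(ℝ, E).prod 𝓘(ℝ, F))
      (fun r => (⟨f (φ r), s (φ r)⟩ : TotalSpace F V)) q :=
    hs.comp q hφ.mdifferentiableAt
  refine coord_injective hb ?_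
  rw [coord_covAlong hK hs' hb, coord_covAlong hK hs hb]
  have h1 := (HasFDerivAt.comp q (differentiableAt_coord hs hb).hasFDerivAt
    hφ.hasFDerivAt).fderiv
  have h2 := (HasMFDerivAt.comp q (mdifferentiableAt_base hs).hasMFDerivAt
    hφ.hasFDerivAt.hasMFDerivAt).mfderiv
  have h1' : fderiv ℝ (fun r => coord F (f (φ q)) (s (φ r))) q v =
      fderiv ℝ (fun r => coord F (f (φ q)) (s r)) (φ q) (fderiv ℝ φ q v) :=
    congrArg (fun L : B' →L[ℝ] F => L v) h1
  have h2' : (mfderiv 𝓘(ℝ, B') 𝓘(ℝ, E) (fun r => f (φ r)) q v : E) =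
      mfderiv 𝓘(ℝ, B) 𝓘(ℝ, E) f (φ q) (fderiv ℝ φ q v) :=
    congrArg (fun L : B' →L[ℝ] E => L v) h2
  rw [h1']
  congr 1
  exact congrArg (fun u : E => connForm K cov (f (φ q)) (f (φ q)) u (coord F (f (φ q)) (s (φ q)))) h2'

theorem covAlong_pullback (hK : IsScalarLinear K cov) {σ : ∀ x, V x}
    (hσ : MDifferentiableAt 𝓘(ℝ, E) (𝓘(ℝ, E).prod 𝓘(ℝ, F))
      (fun z => (⟨z, σ z⟩ : TotalSpace F V)) (f p))
    (hf : MDifferentiableAt 𝓘(ℝ, B) 𝓘(ℝ, E) f p) (v : B) :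
    covAlong cov f (fun q => σ (f q)) p v = cov σ (f p) (mfderiv 𝓘(ℝ, B) 𝓘(ℝ, E) f p v) := by
  have hb : f p ∈ (trivializationAt F V (f p)).baseSet := coord_self_mem _
  refine coord_injective hb ?_
  have hs : MDifferentiableAt 𝓘(ℝ, B) (𝓘(ℝ, E).prod 𝓘(ℝ, F))
      (fun r => (⟨f r, σ (f r)⟩ : TotalSpace F V)) p := hσ.comp p hf
  rw [coord_covAlong hK hs hb, coord_cov hK hb hσ]
  rw [(hasFDerivAt_comp_mvfderiv ((mdifferentiableAt_section_coord hb).1 hσ) hf).fderiv]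
  rfl

theorem covAlong_congr {s' : ∀ p, V (f p)}
    (h : ∀ᶠ q in nhds p, s q = s' q) (v : B) : covAlong cov f s p v = covAlong cov f s' p v := by
  have e : (fun q => coord F (f p) (s q)) =ᶠ[nhds p] fun q => coord F (f p) (s' q) :=
    h.mono fun q hq => by simp only [hq]
  rw [covAlong, covAlong, e.fderiv_eq, h.self_of_nhds]

end

end Along

/-! ### Smoothness of operator-valued maps -/

section SmoothOperators

variable {K : Type*} [RCLike K] {F : Type*} [NormedAddCommGroup F] [NormedSpace ℝ F]
    [NormedSpace K F] [IsScalarTower ℝ K F] [FiniteDimensional K F] [FiniteDimensional ℝ F]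
    {B : Type*} [NormedAddCommGroup B] [NormedSpace ℝ B]

/-- In finite dimension an operator is a fixed linear function of its values on a basis, so
pointwise smoothness suffices. -/
theorem contDiffAt_clm_of_apply {n : ℕ∞ω} {g : B → F →L[K] F} {p : B}
    (h : ∀ w, ContDiffAt ℝ n (fun q => g q w) p) : ContDiffAt ℝ n g p := by
  let β := Module.finBasis K F
  let Λ : (Fin (Module.finrank K F) → F) →ₗ[ℝ] (F →L[K] F) :=
    ((β.constr K).trans LinearMap.toContinuousLinearMap).toLinearMap.restrictScalars ℝ
  have hg : g = fun q => LinearMap.toContinuousLinearMap Λ (fun i => g q (β i)) := by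
    funext q
    ext w
    exact (congrArg (fun T : F →ₗ[K] F => T w) (β.constr_self K (g q : F →ₗ[K] F))).symm
  rw [hg]
  exact (LinearMap.toContinuousLinearMap Λ).contDiff.contDiffAt.comp p
    (contDiffAt_pi.2 fun i => h (β i))

theorem contDiff_clm_of_apply {n : ℕ∞ω} {g : B → F →L[K] F}
    (h : ∀ w, ContDiff ℝ n (fun q => g q w)) : ContDiff ℝ n g :=
  contDiff_iff_contDiffAt.2 fun _ => contDiffAt_clm_of_apply fun w => (h w).contDiffAt

variable (K F) in
/-- Application of `K`-linear operators as a real bilinear map. -/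
def applyL : (F →L[K] F) →L[ℝ] F →L[ℝ] F :=
  (ContinuousLinearMap.restrictScalarsL K F F ℝ ℝ)

theorem applyL_apply (T : F →L[K] F) (w : F) : applyL K F T w = T w := rfl

theorem contDiffAt_clm_apply {n : ℕ∞ω} {g : B → F →L[K] F} {c : B → F} {p : B}
    (hg : ContDiffAt ℝ n g p) (hc : ContDiffAt ℝ n c p) :
    ContDiffAt ℝ n (fun q => g q (c q)) p :=
  ((applyL K F).contDiff.contDiffAt.comp p hg).clm_apply hc

theorem fderiv_clm_apply_apply {g : B → F →L[K] F} {c : B → F} {p : B}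
    (hg : DifferentiableAt ℝ g p) (hc : DifferentiableAt ℝ c p) (v : B) :
    fderiv ℝ (fun q => g q (c q)) p v = fderiv ℝ g p v (c p) + g p (fderiv ℝ c p v) := by
  have h1 : HasFDerivAt (fun q => applyL K F (g q)) ((applyL K F).comp (fderiv ℝ g p)) p :=
    (applyL K F).hasFDerivAt.comp p hg.hasFDerivAt
  have h := (h1.clm_apply hc.hasFDerivAt).fderiv
  have h2 : fderiv ℝ (fun q => g q (c q)) p = _ := h
  rw [h2, add_comm]
  rfl

end SmoothOperators

/-! ### Extending local frames to global smooth sections -/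

section Extension

variable
    {E : Type*} [NormedAddCommGroup E] [NormedSpace ℝ E] [FiniteDimensional ℝ E]
    {X : Type*} [TopologicalSpace X] [T2Space X] [ChartedSpace E X] [IsManifold 𝓘(ℝ, E) ∞ X]
    {F : Type*} [NormedAddCommGroup F] [NormedSpace ℝ F]
    {V : X → Type*} [TopologicalSpace (TotalSpace F V)]
    [∀ x, AddCommGroup (V x)] [∀ x, Module ℝ (V x)] [∀ x, TopologicalSpace (V x)]
    [FiberBundle F V] [VectorBundle ℝ F V] [ContMDiffVectorBundle ∞ F V 𝓘(ℝ, E)]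

/-- A local section which is constant in a trivialization extends to a global smooth section. -/
theorem exists_global_ofCoord {b y : X} (hy : y ∈ (trivializationAt F V b).baseSet) (w : F) :
    ∃ σ : ∀ x, V x, ContMDiff 𝓘(ℝ, E) (𝓘(ℝ, E).prod 𝓘(ℝ, F)) ∞
      (fun z => (⟨z, σ z⟩ : TotalSpace F V)) ∧ ∀ᶠ z in nhds y, σ z = ofCoord V b z w := by
  obtain ⟨ψ, -, hψ⟩ := (SmoothBumpFunction.nhds_basis_tsupport (I := 𝓘(ℝ, E)) y).mem_iff.1
    ((trivializationAt F V b).open_baseSet.mem_nhds hy)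
  refine ⟨fun z => ψ z • ofCoord V b z w, ?_, ?_⟩
  · rw [← contMDiffOn_univ]
    have h := ContMDiffOn.smul_section_of_tsupport (I := 𝓘(ℝ, E)) (F := F) (V := V) (n := ∞)
      (u := (trivializationAt F V b).baseSet) (s := fun z => ofCoord V b z w)
      (ψ := ψ) ψ.contMDiff.contMDiffOn (trivializationAt F V b).open_baseSet hψ
      (fun z hz => (contMDiffAt_ofCoord hz w).contMDiffWithinAt)
    exact h.contMDiffOn
  · filter_upwards [ψ.eventuallyEq_one] with z hz
    simp [hz]

end Extension

/-! ### Trivializations of the tangent bundle in charts -/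

section Tangent

variable
    {E : Type*} [NormedAddCommGroup E] [NormedSpace ℝ E]
    {X : Type*} [TopologicalSpace X] [ChartedSpace E X] [IsManifold 𝓘(ℝ, E) ∞ X] {b y : X}

theorem mem_tangent_baseSet :
    y ∈ (trivializationAt E (TangentSpace 𝓘(ℝ, E) : X → Type _) b).baseSet ↔
      y ∈ (chartAt E b).source := by
  rw [TangentBundle.trivializationAt_baseSet]

theorem coord_tangent (hy : y ∈ (chartAt E b).source) (u : TangentSpace 𝓘(ℝ, E) y) :
    coord E b u = mfderiv 𝓘(ℝ, E) 𝓘(ℝ, E) (extChartAt 𝓘(ℝ, E) b) y u := by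
  have h := congrArg (fun L : E →L[ℝ] E => L u)
    (TangentBundle.continuousLinearMapAt_trivializationAt (I := 𝓘(ℝ, E)) hy)
  refine Eq.trans ?_ h
  exact (congrFun (Trivialization.coe_linearMapAt_of_mem (R := ℝ) _
    (mem_tangent_baseSet.2 hy)) u).symm

theorem ofCoord_tangent (hy : y ∈ (chartAt E b).source) (u : E) :
    (ofCoord (TangentSpace 𝓘(ℝ, E) : X → Type _) b y u : E) =
      mfderiv 𝓘(ℝ, E) 𝓘(ℝ, E) (extChartAt 𝓘(ℝ, E) b).symm (extChartAt 𝓘(ℝ, E) b y) u := by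
  have h := TangentBundle.symmL_trivializationAt (I := 𝓘(ℝ, E)) hy
  rw [modelWithCornersSelf_coe, Set.range_id, mfderivWithin_univ] at h
  refine Eq.trans ?_ (congrArg (fun L : E →L[ℝ] E => L u) h)
  exact ((trivializationAt E (TangentSpace 𝓘(ℝ, E) : X → Type _) b).symmL_apply (R := ℝ)
    (mem_tangent_baseSet.2 hy) u).symm

theorem coord_tangent_self (u : TangentSpace 𝓘(ℝ, E) b) : coord E b u = u := by
  rw [coord_tangent (mem_chart_source E b)]
  have h := mfderiv_extChartAt_self (I := 𝓘(ℝ, E)) (x := b)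
  exact congrArg (fun L : E →L[ℝ] E => L u) h

end Tangent

/-! ### Curvature of a connection on a trivial bundle -/

section Flat

variable {K : Type*} [RCLike K] {F : Type*} [NormedAddCommGroup F] [NormedSpace ℝ F]
    [NormedSpace K F] [IsScalarTower ℝ K F] [FiniteDimensional K F] [FiniteDimensional ℝ F]
    {B : Type*} [NormedAddCommGroup B] [NormedSpace ℝ B]
    {E : Type*} [NormedAddCommGroup E] [NormedSpace ℝ E]

variable (K F) in
theorem finiteDimensional_real_end : FiniteDimensional ℝ (F →L[K] F) :=
  Module.Finite.trans K (F →L[K] F)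

theorem contDiffAt_constr [FiniteDimensional ℝ E] {W : Type*} [NormedAddCommGroup W]
    [NormedSpace ℝ W] [FiniteDimensional ℝ W]
    {n : ℕ∞ω} {g : Fin (Module.finrank ℝ E) → B → W} {p : B}
    (h : ∀ i, ContDiffAt ℝ n (g i) p) :
    ContDiffAt ℝ n (fun q => LinearMap.toContinuousLinearMap
      ((Module.finBasis ℝ E).constr ℝ fun i => g i q)) p := by
  let Λ : (Fin (Module.finrank ℝ E) → W) →ₗ[ℝ] (E →L[ℝ] W) :=
    (((Module.finBasis ℝ E).constr ℝ).trans LinearMap.toContinuousLinearMap).toLinearMap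
  exact (LinearMap.toContinuousLinearMap Λ).contDiff.contDiffAt.comp p (contDiffAt_pi.2 h)

/-- The curvature `dM + M ∧ M` of the connection form `M`. -/
def flatCurv (M : B → B →L[ℝ] F →L[K] F) (p u v : B) : F →L[K] F :=
  fderiv ℝ M p u v - fderiv ℝ M p v u + (M p u ∘L M p v - M p v ∘L M p u)

/-- The second derivatives of `g` cancel by symmetry, the mixed terms `M (dg)` cancel in pairs, and
the derivatives of `U` and `W` assemble into the Lie bracket. -/
theorem flatCurv_eq {M : B → B →L[ℝ] F →L[K] F} {p : B} (hM : DifferentiableAt ℝ M p)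
    {g : B → F} (hg : ContDiffAt ℝ ∞ g p) {U W : B → B} (hU : DifferentiableAt ℝ U p)
    (hW : DifferentiableAt ℝ W p) :
    (fderiv ℝ (fun q => fderiv ℝ g q (W q) + M q (W q) (g q)) p (U p) +
        M p (U p) (fderiv ℝ g p (W p) + M p (W p) (g p))) -
      (fderiv ℝ (fun q => fderiv ℝ g q (U q) + M q (U q) (g q)) p (W p) +
        M p (W p) (fderiv ℝ g p (U p) + M p (U p) (g p))) -
      (fderiv ℝ g p (VectorField.lieBracket ℝ U W p) +
        M p (VectorField.lieBracket ℝ U W p) (g p)) = flatCurv M p (U p) (W p) (g p) := by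
  have hg1 : DifferentiableAt ℝ g p := hg.differentiableAt (by simp)
  have hg2 : DifferentiableAt ℝ (fderiv ℝ g) p :=
    (hg.fderiv_right (m := 1) (by norm_cast)).differentiableAt (by simp)
  have hsymm : IsSymmSndFDerivAt ℝ g p := hg.isSymmSndFDerivAt (by simp; norm_cast)
  have key : ∀ {Y : B → B} (_ : DifferentiableAt ℝ Y p) (u : B),
      fderiv ℝ (fun q => fderiv ℝ g q (Y q) + M q (Y q) (g q)) p u =
        fderiv ℝ (fderiv ℝ g) p u (Y p) + fderiv ℝ g p (fderiv ℝ Y p u) +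
        (fderiv ℝ M p u (Y p) (g p) + M p (fderiv ℝ Y p u) (g p) +
          M p (Y p) (fderiv ℝ g p u)) := by
    intro Y hY u
    have h1 := (hg2.hasFDerivAt.clm_apply hY.hasFDerivAt)
    have h2 := (hM.hasFDerivAt.clm_apply hY.hasFDerivAt)
    have h3 : HasFDerivAt (fun q => applyL K F (M q (Y q))) _ p :=
      (applyL K F).hasFDerivAt.comp p h2
    have h4 := (h1.add (h3.clm_apply hg1.hasFDerivAt)).fderiv
    have h5 := congrArg (fun L : B →L[ℝ] F => L u) h4
    refine Eq.trans h5 ?_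
    simp only [add_apply, ContinuousLinearMap.comp_apply, ContinuousLinearMap.flip_apply,
      map_add, applyL_apply]
    abel
  rw [key hW, key hU, hsymm.eq (U p) (W p)]
  simp only [flatCurv, VectorField.lieBracket, map_sub, map_add, sub_apply, add_apply,
    ContinuousLinearMap.comp_apply]
  abel

set_option synthInstance.maxHeartbeats 200000 in
-- Naturality of `dM + M ∧ M`: the only terms that are not tensorial contain the second derivative
-- of `h`, and they cancel by symmetry.
theorem flatCurv_pullback {M : E → E →L[ℝ] F →L[K] F} {M' : B → B →L[ℝ] F →L[K] F} {h : B → E}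
    {p : B} (hh : ContDiffAt ℝ ∞ h p) (hM : DifferentiableAt ℝ M (h p))
    (hM' : ∀ᶠ q in nhds p, ∀ v, M' q v = M (h q) (fderiv ℝ h q v)) (u v : B) :
    flatCurv M' p u v = flatCurv M (h p) (fderiv ℝ h p u) (fderiv ℝ h p v) := by
  have hh1 : DifferentiableAt ℝ h p := hh.differentiableAt (by simp)
  have hh2 : DifferentiableAt ℝ (fderiv ℝ h) p :=
    (hh.fderiv_right (m := 1) (by norm_cast)).differentiableAt (by simp)
  have hsymm : IsSymmSndFDerivAt ℝ h p := hh.isSymmSndFDerivAt (by simp; norm_cast)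
  have hMh : HasFDerivAt (fun q => M (h q)) ((fderiv ℝ M (h p)).comp (fderiv ℝ h p)) p :=
    HasFDerivAt.comp (g := M) (f := h) p hM.hasFDerivAt hh1.hasFDerivAt
  have e : M' =ᶠ[nhds p] fun q => (M (h q)).comp (fderiv ℝ h q) :=
    hM'.mono fun q hq => ContinuousLinearMap.ext hq
  have key : ∀ u v, fderiv ℝ M' p u v =
      fderiv ℝ M (h p) (fderiv ℝ h p u) (fderiv ℝ h p v) +
        M (h p) (fderiv ℝ (fderiv ℝ h) p u v) := by
    intro u v
    rw [e.fderiv_eq, (hMh.clm_comp hh2.hasFDerivAt).fderiv]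
    simp only [add_apply, ContinuousLinearMap.comp_apply, ContinuousLinearMap.flip_apply,
      ContinuousLinearMap.compL_apply]
    abel
  have hp := hM'.self_of_nhds
  rw [flatCurv, flatCurv, key, key, hp u, hp v, hsymm.eq u v]
  abel

end Flat

/-! ### Smoothness of the connection form -/

section SmoothConnection

variable {K : Type*} [RCLike K]
    {E : Type*} [NormedAddCommGroup E] [NormedSpace ℝ E] [FiniteDimensional ℝ E]
    {X : Type*} [TopologicalSpace X] [T2Space X] [ChartedSpace E X] [IsManifold 𝓘(ℝ, E) ∞ X]
    {F : Type*} [NormedAddCommGroup F] [NormedSpace ℝ F] [FiniteDimensional ℝ F]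
    [NormedSpace K F] [IsScalarTower ℝ K F] [FiniteDimensional K F]
    {V : X → Type*} [TopologicalSpace (TotalSpace F V)]
    [∀ x, AddCommGroup (V x)] [∀ x, Module ℝ (V x)] [∀ x, Module K (V x)]
    [∀ x, TopologicalSpace (V x)]
    [∀ x, IsTopologicalAddGroup (V x)] [∀ x, ContinuousSMul ℝ (V x)]
    [FiberBundle F V] [VectorBundle ℝ F V] [VectorBundle K F V]
    [ContMDiffVectorBundle ∞ F V 𝓘(ℝ, E)]
    {B : Type*} [NormedAddCommGroup B] [NormedSpace ℝ B]
    {cov : CovariantDerivative 𝓘(ℝ, E) F V}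

/-- The source `Y` is an arbitrary manifold, so that this serves both vector fields on `X` (with the
identity map) and fields along a map from a vector space. -/
theorem contMDiffAt_cov_along (hcov : CovariantDerivative.ContMDiffCovariantDerivative cov ∞)
    {H : Type*} [TopologicalSpace H] {B' : Type*} [NormedAddCommGroup B'] [NormedSpace ℝ B']
    {I : ModelWithCorners ℝ B' H} {Y : Type*} [TopologicalSpace Y] [ChartedSpace H Y]
    {σ : ∀ x, V x} (hσ : ContMDiff 𝓘(ℝ, E) (𝓘(ℝ, E).prod 𝓘(ℝ, F)) ∞
      (fun z => (⟨z, σ z⟩ : TotalSpace F V))) {f : Y → X} {p : Y}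
    {u : ∀ q, TangentSpace 𝓘(ℝ, E) (f q)}
    (hu : ContMDiffAt I 𝓘(ℝ, E).tangent ∞
      (fun q => (⟨f q, u q⟩ : TangentBundle 𝓘(ℝ, E) X)) p) :
    ContMDiffAt I (𝓘(ℝ, E).prod 𝓘(ℝ, F)) ∞
      (fun q => (⟨f q, cov σ (f q) (u q)⟩ : TotalSpace F V)) p := by
  have h1 := hcov.contMDiff.contMDiff (σ := σ) hσ.contMDiffOn
  have hf : ContMDiffAt I 𝓘(ℝ, E) ∞ f p := (contMDiffAt_totalSpace.1 hu).1
  have h2 := (contMDiffOn_univ.1 h1 (f p)).comp p hf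
  exact ContMDiffAt.clm_bundle_apply (E₁ := (TangentSpace 𝓘(ℝ, E) : X → Type _)) (E₂ := V)
    (ϕ := fun q => cov σ (f q)) h2 hu

/-- Smoothness of `∇` is known on global sections only. A constant local section is therefore
replaced by a global one with the same germ, which does not change `∇` nearby. -/
theorem contDiffAt_connForm (hcov : CovariantDerivative.ContMDiffCovariantDerivative cov ∞)
    (hK : IsScalarLinear K cov) {f : B → X} {p : B}
    {u : ∀ q, TangentSpace 𝓘(ℝ, E) (f q)}
    (hu : ContMDiffAt 𝓘(ℝ, B) 𝓘(ℝ, E).tangent ∞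
      (fun q => (⟨f q, u q⟩ : TangentBundle 𝓘(ℝ, E) X)) p)
    {b : X} (hb : f p ∈ (trivializationAt F V b).baseSet) :
    ContDiffAt ℝ ∞ (fun q => connForm K cov b (f q) (u q)) p := by
  have hf : ContMDiffAt 𝓘(ℝ, B) 𝓘(ℝ, E) ∞ f p := (contMDiffAt_totalSpace.1 hu).1
  refine contDiffAt_clm_of_apply fun w => ?_
  obtain ⟨σ, hσ, hev⟩ := exists_global_ofCoord (E := E) hb w
  have h1 := (contMDiffAt_along_iff hf hb).1 (contMDiffAt_cov_along hcov hσ hu)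
  refine h1.congr_of_eventuallyEq ?_
  filter_upwards [eventually_mem_baseSet hf.continuousAt hb,
    hf.continuousAt.eventually hev.eventually_nhds] with q hq hq'
  rw [connForm_apply hK hq]
  exact congrArg (fun L : TangentSpace 𝓘(ℝ, E) (f q) →L[ℝ] V (f q) => coord F b (L (u q)))
    (cov_congr (hσ.mdifferentiableAt (by simp)) hq').symm

theorem eventually_mdifferentiableAt {f : B → X} {p : B} {s : ∀ p, V (f p)}
    (hs : ContMDiffAt 𝓘(ℝ, B) (𝓘(ℝ, E).prod 𝓘(ℝ, F)) ∞
      (fun q => (⟨f q, s q⟩ : TotalSpace F V)) p) :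
    ∀ᶠ q in nhds p, MDifferentiableAt 𝓘(ℝ, B) (𝓘(ℝ, E).prod 𝓘(ℝ, F))
      (fun q => (⟨f q, s q⟩ : TotalSpace F V)) q := by
  have : IsManifold (𝓘(ℝ, E).prod 𝓘(ℝ, F)) 1 (TotalSpace F V) :=
    IsManifold.of_le (n := ∞) (by simp)
  have h1 : ContMDiffAt 𝓘(ℝ, B) (𝓘(ℝ, E).prod 𝓘(ℝ, F)) ((1 : ℕ) : ℕ∞ω)
      (fun q => (⟨f q, s q⟩ : TotalSpace F V)) p := hs.of_le (by simp)
  have h := (contMDiffAt_iff_contMDiffAt_nhds (by simp)).1 h1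
  exact h.mono fun q hq => hq.mdifferentiableAt (by simp)

theorem contMDiffAt_covAlong (hcov : CovariantDerivative.ContMDiffCovariantDerivative cov ∞)
    (hK : IsScalarLinear K cov) {f : B → X} (hf : ContMDiff 𝓘(ℝ, B) 𝓘(ℝ, E) ∞ f) {p : B}
    {s : ∀ p, V (f p)}
    (hs : ContMDiffAt 𝓘(ℝ, B) (𝓘(ℝ, E).prod 𝓘(ℝ, F)) ∞
      (fun q => (⟨f q, s q⟩ : TotalSpace F V)) p) (v : B) :
    ContMDiffAt 𝓘(ℝ, B) (𝓘(ℝ, E).prod 𝓘(ℝ, F)) ∞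
      (fun q => (⟨f q, covAlong cov f s q v⟩ : TotalSpace F V)) p := by
  have hb : f p ∈ (trivializationAt F V (f p)).baseSet := coord_self_mem _
  rw [contMDiffAt_along_iff hf.contMDiffAt hb] at hs ⊢
  have h1 := contDiffAt_connForm (F := F) hcov hK (contMDiff_mfderiv_apply hf v p) hb
  have h2 : ContDiffAt ℝ ∞ (fun q => fderiv ℝ (fun q => coord F (f p) (s q)) q v) p :=
    (hs.fderiv_right (m := ∞) (by simp)).clm_apply contDiffAt_const
  refine (h2.add (contDiffAt_clm_apply h1 hs)).congr_of_eventuallyEq ?_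
  rw [← contMDiffAt_along_iff hf.contMDiffAt hb] at hs
  filter_upwards [eventually_mdifferentiableAt hs,
    eventually_mem_baseSet hf.continuous.continuousAt hb] with q hq hq'
  exact coord_covAlong hK hq hq' v

/-! ### Existence of the curvature -/

variable (K) in
/-- The connection form in the trivialization and the chart at `b`. -/
def chartConn (cov : CovariantDerivative 𝓘(ℝ, E) F V) (b : X) (e : E) : E →L[ℝ] F →L[K] F :=
  LinearMap.toContinuousLinearMap ((Module.finBasis ℝ E).constr ℝ fun i =>
    connForm K cov b ((extChartAt 𝓘(ℝ, E) b).symm e)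
      (ofCoord (TangentSpace 𝓘(ℝ, E) : X → Type _) b ((extChartAt 𝓘(ℝ, E) b).symm e)
        (Module.finBasis ℝ E i)))

theorem eventually_chart (b : X) : ∀ᶠ e in nhds (extChartAt 𝓘(ℝ, E) b b),
    e ∈ (extChartAt 𝓘(ℝ, E) b).target ∧
    (extChartAt 𝓘(ℝ, E) b).symm e ∈ (chartAt E b).source ∧
      (extChartAt 𝓘(ℝ, E) b).symm e ∈ (trivializationAt F V b).baseSet := by
  have h0 := extChartAt_target_mem_nhds (I := 𝓘(ℝ, E)) b
  have h1 : ContinuousAt (extChartAt 𝓘(ℝ, E) b).symm (extChartAt 𝓘(ℝ, E) b b) :=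
    continuousAt_extChartAt_symm b
  have h2 : (extChartAt 𝓘(ℝ, E) b).symm (extChartAt 𝓘(ℝ, E) b b) = b := extChartAt_to_inv b
  have h3 := h1.preimage_mem_nhds ((trivializationAt F V b).open_baseSet.mem_nhds
    (h2.symm ▸ coord_self_mem b))
  filter_upwards [h0, h3] with e he he'
  refine ⟨he, ?_, he'⟩
  have := (extChartAt 𝓘(ℝ, E) b).map_target he
  rwa [extChartAt_source] at this

theorem chartConn_apply (hK : IsScalarLinear K cov) {b : X} {e : E}
    (h1 : (extChartAt 𝓘(ℝ, E) b).symm e ∈ (chartAt E b).source)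
    (h2 : (extChartAt 𝓘(ℝ, E) b).symm e ∈ (trivializationAt F V b).baseSet) (u : E) :
    chartConn K cov b e u = connForm K cov b ((extChartAt 𝓘(ℝ, E) b).symm e)
      (ofCoord (TangentSpace 𝓘(ℝ, E) : X → Type _) b ((extChartAt 𝓘(ℝ, E) b).symm e) u) := by
  have h3 := mem_tangent_baseSet.2 h1
  let L : E →ₗ[ℝ] F →L[K] F :=
    { toFun := fun u => connForm K cov b ((extChartAt 𝓘(ℝ, E) b).symm e)
        (ofCoord (TangentSpace 𝓘(ℝ, E) : X → Type _) b ((extChartAt 𝓘(ℝ, E) b).symm e) u)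
      map_add' := fun u v => by rw [ofCoord_add h3, connForm_add hK h2]
      map_smul' := fun c u => by
        rw [ofCoord_smul (K := ℝ) h3, connForm_smul hK h2, RingHom.id_apply] }
  exact congrArg (fun T : E →ₗ[ℝ] F →L[K] F => T u) ((Module.finBasis ℝ E).constr_self ℝ L)

set_option synthInstance.maxHeartbeats 200000 in
theorem contDiffAt_chartConn (hcov : CovariantDerivative.ContMDiffCovariantDerivative cov ∞)
    (hK : IsScalarLinear K cov) (b : X) :
    ContDiffAt ℝ ∞ (chartConn K cov b) (extChartAt 𝓘(ℝ, E) b b) := by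
  have h2 : (extChartAt 𝓘(ℝ, E) b).symm (extChartAt 𝓘(ℝ, E) b b) = b := extChartAt_to_inv b
  have hf : ContMDiffAt 𝓘(ℝ, E) 𝓘(ℝ, E) ∞ (extChartAt 𝓘(ℝ, E) b).symm
      (extChartAt 𝓘(ℝ, E) b b) :=
    (contMDiffOn_extChartAt_symm b).contMDiffAt (extChartAt_target_mem_nhds b)
  have := finiteDimensional_real_end K F
  refine contDiffAt_constr (W := F →L[K] F) fun i => ?_
  refine contDiffAt_connForm (B := E) hcov hK ?_ (h2.symm ▸ coord_self_mem b)
  have hb' : (extChartAt 𝓘(ℝ, E) b).symm (extChartAt 𝓘(ℝ, E) b b) ∈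
      (trivializationAt E (TangentSpace 𝓘(ℝ, E) : X → Type _) b).baseSet :=
    h2.symm ▸ coord_self_mem b
  refine (contMDiffAt_along_iff (V := (TangentSpace 𝓘(ℝ, E) : X → Type _)) hf hb').2 ?_
  refine (contDiffAt_const (c := Module.finBasis ℝ E i)).congr_of_eventuallyEq ?_
  filter_upwards [eventually_chart (F := E) (V := (TangentSpace 𝓘(ℝ, E) : X → Type _)) b]
    with e he
  exact coord_ofCoord he.2.2 _

end SmoothConnection

/-! ### The curvature in charts -/

section Curvature

variable {K : Type*} [RCLike K]
    {E : Type*} [NormedAddCommGroup E] [NormedSpace ℝ E] [FiniteDimensional ℝ E]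
    {X : Type*} [TopologicalSpace X] [T2Space X] [ChartedSpace E X] [IsManifold 𝓘(ℝ, E) ∞ X]
    {F : Type*} [NormedAddCommGroup F] [NormedSpace ℝ F] [FiniteDimensional ℝ F]
    [NormedSpace K F] [IsScalarTower ℝ K F] [FiniteDimensional K F]
    {V : X → Type*} [TopologicalSpace (TotalSpace F V)]
    [∀ x, AddCommGroup (V x)] [∀ x, Module ℝ (V x)] [∀ x, Module K (V x)]
    [∀ x, TopologicalSpace (V x)]
    [∀ x, IsTopologicalAddGroup (V x)] [∀ x, ContinuousSMul ℝ (V x)]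
    [FiberBundle F V] [VectorBundle ℝ F V] [VectorBundle K F V]
    [ContMDiffVectorBundle ∞ F V 𝓘(ℝ, E)]
    {B : Type*} [NormedAddCommGroup B] [NormedSpace ℝ B]
    {cov : CovariantDerivative 𝓘(ℝ, E) F V}

theorem chartConn_coord (hK : IsScalarLinear K cov) {b y : X} (h1 : y ∈ (chartAt E b).source)
    (h2 : y ∈ (trivializationAt F V b).baseSet) (v : TangentSpace 𝓘(ℝ, E) y) :
    chartConn K cov b (extChartAt 𝓘(ℝ, E) b y) (coord E b v) = connForm K cov b y v := by
  have hy : (extChartAt 𝓘(ℝ, E) b).symm (extChartAt 𝓘(ℝ, E) b y) = y :=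
    (extChartAt 𝓘(ℝ, E) b).left_inv (by rwa [extChartAt_source])
  have h := chartConn_apply hK (b := b) (e := extChartAt 𝓘(ℝ, E) b y) (by rwa [hy])
    (by rwa [hy]) (coord E b v)
  refine h.trans ?_
  refine (congrArg (fun z => connForm K cov b z
    (ofCoord (TangentSpace 𝓘(ℝ, E) : X → Type _) b z (coord E b v))) hy).trans ?_
  rw [ofCoord_coord (mem_tangent_baseSet.2 h1)]

theorem mdifferentiableAt_chart_symm {b y : X} (h1 : y ∈ (chartAt E b).source) :
    MDifferentiableAt 𝓘(ℝ, E) 𝓘(ℝ, E) (extChartAt 𝓘(ℝ, E) b).symm (extChartAt 𝓘(ℝ, E) b y) := by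
  have h := mdifferentiableWithinAt_extChartAt_symm (I := 𝓘(ℝ, E)) (x := b)
    ((extChartAt 𝓘(ℝ, E) b).map_source (by rwa [extChartAt_source] : y ∈ _))
  rwa [modelWithCornersSelf_coe, Set.range_id, mdifferentiableWithinAt_univ] at h

theorem mvfderiv_eq_fderiv_chart {W : Type*} [NormedAddCommGroup W] [NormedSpace ℝ W] {g : X → W}
    {b y : X} (h1 : y ∈ (chartAt E b).source) (hg : MDifferentiableAt 𝓘(ℝ, E) 𝓘(ℝ, W) g y)
    (v : TangentSpace 𝓘(ℝ, E) y) :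
    mvfderiv 𝓘(ℝ, E) g y v =
      fderiv ℝ (fun e => g ((extChartAt 𝓘(ℝ, E) b).symm e)) (extChartAt 𝓘(ℝ, E) b y)
        (coord E b v) := by
  have hy : (extChartAt 𝓘(ℝ, E) b).symm (extChartAt 𝓘(ℝ, E) b y) = y :=
    (extChartAt 𝓘(ℝ, E) b).left_inv (by rwa [extChartAt_source])
  have h := hasFDerivAt_comp_mvfderiv (g := g) (f := (extChartAt 𝓘(ℝ, E) b).symm)
    (p := extChartAt 𝓘(ℝ, E) b y) (by rwa [hy]) (mdifferentiableAt_chart_symm h1)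
  rw [h.fderiv]
  have h3 := ofCoord_tangent h1 (coord E b v)
  rw [ofCoord_coord (mem_tangent_baseSet.2 h1)] at h3
  have h4 : (mvfderiv 𝓘(ℝ, E) g ((extChartAt 𝓘(ℝ, E) b).symm (extChartAt 𝓘(ℝ, E) b y)) :
    E →L[ℝ] W) = mvfderiv 𝓘(ℝ, E) g y :=
    congrArg (β := E →L[ℝ] W) (fun z => mvfderiv 𝓘(ℝ, E) g z) hy
  refine Eq.trans ?_ (congrArg (fun L : E →L[ℝ] W => L (mfderiv 𝓘(ℝ, E) 𝓘(ℝ, E)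
    (extChartAt 𝓘(ℝ, E) b).symm (extChartAt 𝓘(ℝ, E) b y) (coord E b v))) h4).symm
  exact congrArg (fun z : E => (mvfderiv 𝓘(ℝ, E) g y : E →L[ℝ] W) z) h3

theorem coord_cov_chart (hK : IsScalarLinear K cov) {b y : X} (h1 : y ∈ (chartAt E b).source)
    (h2 : y ∈ (trivializationAt F V b).baseSet) {σ : ∀ x, V x}
    (hσ : MDifferentiableAt 𝓘(ℝ, E) (𝓘(ℝ, E).prod 𝓘(ℝ, F))
      (fun z => (⟨z, σ z⟩ : TotalSpace F V)) y) (v : TangentSpace 𝓘(ℝ, E) y) :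
    coord F b (cov σ y v) =
      fderiv ℝ (fun e => coord F b (σ ((extChartAt 𝓘(ℝ, E) b).symm e))) (extChartAt 𝓘(ℝ, E) b y)
        (coord E b v) +
      chartConn K cov b (extChartAt 𝓘(ℝ, E) b y) (coord E b v) (coord F b (σ y)) := by
  rw [coord_cov hK h2 hσ, mvfderiv_eq_fderiv_chart h1 ((mdifferentiableAt_section_coord h2).1 hσ),
    chartConn_coord hK h1 h2]

/-- The pullback by the inverse chart inverts the differential of that inverse, and this is the
differential of the chart itself, i.e. the tangent coordinate. -/
theorem mpullback_chart {b : X} (U : ∀ x : X, TangentSpace 𝓘(ℝ, E) x) {e : E}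
    (he : e ∈ (extChartAt 𝓘(ℝ, E) b).target) :
    (VectorField.mpullbackWithin 𝓘(ℝ, E) 𝓘(ℝ, E) (extChartAt 𝓘(ℝ, E) b).symm U
      (Set.range 𝓘(ℝ, E)) e : E) = coord E b (U ((extChartAt 𝓘(ℝ, E) b).symm e)) := by
  have hs := (extChartAt 𝓘(ℝ, E) b).map_target he
  rw [extChartAt_source] at hs
  rw [coord_tangent hs, VectorField.mpullbackWithin_apply]
  have h1 := mfderivWithin_extChartAt_symm_comp_mfderiv_extChartAt (I := 𝓘(ℝ, E)) (x := b) he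
  have h2 := mfderiv_extChartAt_comp_mfderivWithin_extChartAt_symm (I := 𝓘(ℝ, E)) (x := b) he
  exact congrArg (fun L : E →L[ℝ] E => L (U ((extChartAt 𝓘(ℝ, E) b).symm e)))
    (ContinuousLinearMap.inverse_eq (M := E) (M₂ := E) h1 h2)

/-- At the centre of the chart the differential of the chart is the identity, so no factor remains
in front of the flat bracket. -/
theorem mlieBracket_chart (b : X) (U W : ∀ x : X, TangentSpace 𝓘(ℝ, E) x) :
    coord E b (VectorField.mlieBracket 𝓘(ℝ, E) U W b) =
      VectorField.lieBracket ℝ (fun e => coord E b (U ((extChartAt 𝓘(ℝ, E) b).symm e)))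
        (fun e => coord E b (W ((extChartAt 𝓘(ℝ, E) b).symm e))) (extChartAt 𝓘(ℝ, E) b b) := by
  rw [coord_tangent_self, ← VectorField.mlieBracketWithin_univ,
    VectorField.mlieBracketWithin_apply]
  have h := mfderiv_extChartAt_self (I := 𝓘(ℝ, E)) (x := b)
  have h' : ∀ L : E →L[ℝ] E, L = ContinuousLinearMap.id ℝ E → ∀ z, L.inverse z = z := by
    rintro _ rfl z
    simp
  refine (h' _ h _).trans ?_
  have hu : (extChartAt 𝓘(ℝ, E) b).symm ⁻¹' Set.univ ∩ Set.range 𝓘(ℝ, E) = Set.univ := by simp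
  rw [hu]
  refine (congrFun (VectorField.lieBracketWithin_univ (𝕜 := ℝ) (E := E)) _).trans ?_
  have ht := extChartAt_target_mem_nhds (I := 𝓘(ℝ, E)) b
  refine Filter.EventuallyEq.lieBracket_vectorField_eq ?_ ?_
  · filter_upwards [ht] with e he using mpullback_chart U he
  · filter_upwards [ht] with e he using mpullback_chart W he

variable (K) in
/-- The curvature at `b`, computed in the chart and the trivialization at `b`. -/
def chartCurv (cov : CovariantDerivative 𝓘(ℝ, E) F V) (b : X) (u w : TangentSpace 𝓘(ℝ, E) b) :
    V b →ₗ[K] V b :=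
  (coordEquiv K F V (coord_self_mem b)).symm.toLinearMap ∘ₗ
    (flatCurv (chartConn K cov b) (extChartAt 𝓘(ℝ, E) b b) (coord E b u) (coord E b w) :
      F →ₗ[K] F) ∘ₗ (coordEquiv K F V (coord_self_mem b)).toLinearMap

theorem coord_chartCurv (b : X) (u w : TangentSpace 𝓘(ℝ, E) b) (v : V b) :
    coord F b (chartCurv K cov b u w v) =
      flatCurv (chartConn K cov b) (extChartAt 𝓘(ℝ, E) b b) (coord E b u) (coord E b w)
        (coord F b v) :=
  coord_ofCoord (coord_self_mem b) _

theorem contDiffAt_coord_chart {b : X} {σ : ∀ x, V x}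
    (hσ : ContMDiffAt 𝓘(ℝ, E) (𝓘(ℝ, E).prod 𝓘(ℝ, F)) ∞
      (fun y => (⟨y, σ y⟩ : TotalSpace F V)) b) :
    ContDiffAt ℝ ∞ (fun e => coord F b (σ ((extChartAt 𝓘(ℝ, E) b).symm e)))
      (extChartAt 𝓘(ℝ, E) b b) := by
  have h2 : (extChartAt 𝓘(ℝ, E) b).symm (extChartAt 𝓘(ℝ, E) b b) = b := extChartAt_to_inv b
  have hf : ContMDiffAt 𝓘(ℝ, E) 𝓘(ℝ, E) ∞ (extChartAt 𝓘(ℝ, E) b).symm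
      (extChartAt 𝓘(ℝ, E) b b) :=
    (contMDiffOn_extChartAt_symm b).contMDiffAt (extChartAt_target_mem_nhds b)
  exact (contMDiffAt_along_iff hf (h2.symm ▸ coord_self_mem b)).1
    (ContMDiffAt.comp (extChartAt 𝓘(ℝ, E) b b) (by rwa [h2]) hf)

/-- Near `b` the local formula `∇σ = dσ + Γσ` may be differentiated once more, which reduces the
claim to `flatCurv_eq` in the chart. -/
theorem isCurvature_chartCurv (hcov : CovariantDerivative.ContMDiffCovariantDerivative cov ∞)
    (hK : IsScalarLinear K cov) : IsCurvature cov (chartCurv K cov) := by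
  intro U W σ hU hW hσ b
  have hb : b ∈ (trivializationAt F V b).baseSet := coord_self_mem b
  have hc : b ∈ (chartAt E b).source := mem_chart_source E b
  refine coord_injective hb ?_
  rw [coord_chartCurv]
  have hsub : ∀ v v' : V b, coord F b (v - v') = coord F b v - coord F b v' :=
    fun v v' => map_sub (coordEquiv ℝ F V hb) v v'
  have hsmooth : ∀ {Y : ∀ x : X, TangentSpace 𝓘(ℝ, E) x},
      ContMDiff 𝓘(ℝ, E) 𝓘(ℝ, E).tangent ∞ (fun y => (⟨y, Y y⟩ : TangentBundle 𝓘(ℝ, E) X)) →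
      MDifferentiableAt 𝓘(ℝ, E) (𝓘(ℝ, E).prod 𝓘(ℝ, F))
      (fun z => (⟨z, cov σ z (Y z)⟩ : TotalSpace F V)) b := fun {Y} hY =>
    (contMDiffAt_cov_along (f := fun z : X => z) hcov hσ (hY b)).mdifferentiableAt (by simp)
  have hσd : ∀ y, MDifferentiableAt 𝓘(ℝ, E) (𝓘(ℝ, E).prod 𝓘(ℝ, F))
      (fun z => (⟨z, σ z⟩ : TotalSpace F V)) y := fun y => hσ.mdifferentiableAt (by simp)
  have hev : ∀ Y : ∀ x : X, TangentSpace 𝓘(ℝ, E) x,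
      (fun e => coord F b (cov σ ((extChartAt 𝓘(ℝ, E) b).symm e)
        (Y ((extChartAt 𝓘(ℝ, E) b).symm e)))) =ᶠ[nhds (extChartAt 𝓘(ℝ, E) b b)] fun e =>
      fderiv ℝ (fun e => coord F b (σ ((extChartAt 𝓘(ℝ, E) b).symm e))) e
        (coord E b (Y ((extChartAt 𝓘(ℝ, E) b).symm e))) +
      chartConn K cov b e (coord E b (Y ((extChartAt 𝓘(ℝ, E) b).symm e)))
        (coord F b (σ ((extChartAt 𝓘(ℝ, E) b).symm e))) := fun Y => by
    filter_upwards [eventually_chart (F := F) (V := V) b] with e he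
    have h := coord_cov_chart hK he.2.1 he.2.2 (hσd _) (Y ((extChartAt 𝓘(ℝ, E) b).symm e))
    rwa [(extChartAt 𝓘(ℝ, E) b).right_inv he.1] at h
  have h0 : (extChartAt 𝓘(ℝ, E) b).symm (extChartAt 𝓘(ℝ, E) b b) = b := extChartAt_to_inv b
  have hY0 : ∀ Y : ∀ x : X, TangentSpace 𝓘(ℝ, E) x,
      coord E b (Y ((extChartAt 𝓘(ℝ, E) b).symm (extChartAt 𝓘(ℝ, E) b b))) = coord E b (Y b) :=
    fun Y => by rw [h0]
  have hσ0 : coord F b (σ ((extChartAt 𝓘(ℝ, E) b).symm (extChartAt 𝓘(ℝ, E) b b))) =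
      coord F b (σ b) := by rw [h0]
  have hM : DifferentiableAt ℝ (chartConn K cov b) (extChartAt 𝓘(ℝ, E) b b) :=
    (contDiffAt_chartConn hcov hK b).differentiableAt (by simp)
  have key := flatCurv_eq hM (contDiffAt_coord_chart (hσ b))
    ((contDiffAt_coord_chart (V := (TangentSpace 𝓘(ℝ, E) : X → Type _)) (hU b)).differentiableAt
      (by simp))
    ((contDiffAt_coord_chart (V := (TangentSpace 𝓘(ℝ, E) : X → Type _)) (hW b)).differentiableAt
      (by simp))
  rw [hsub, hsub, coord_cov_chart hK hc hb (hsmooth hW), coord_cov_chart hK hc hb (hsmooth hU),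
    (hev W).fderiv_eq, (hev U).fderiv_eq, coord_cov_chart hK hc hb (hσd b) (U b),
    coord_cov_chart hK hc hb (hσd b) (W b), coord_cov_chart hK hc hb (hσd b),
    mlieBracket_chart]
  simp only [hY0, hσ0] at key
  exact key.symm

theorem exists_global_section {b : X} (v : V b) :
    ∃ σ : ∀ x, V x, ContMDiff 𝓘(ℝ, E) (𝓘(ℝ, E).prod 𝓘(ℝ, F)) ∞
      (fun z => (⟨z, σ z⟩ : TotalSpace F V)) ∧ σ b = v := by
  obtain ⟨σ, h1, h2⟩ := exists_global_ofCoord (E := E) (coord_self_mem (F := F) (V := V) b) (coord F b v)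
  exact ⟨σ, h1, h2.self_of_nhds.trans (ofCoord_coord (coord_self_mem b) v)⟩

/-- Every vector is the value of a global smooth section or vector field, obtained with a bump
function, so the defining formula determines the tensor at each point. -/
theorem IsCurvature.unique
    {R R' : ∀ x : X, TangentSpace 𝓘(ℝ, E) x → TangentSpace 𝓘(ℝ, E) x → (V x →ₗ[K] V x)}
    (h : IsCurvature cov R) (h' : IsCurvature cov R') : R = R' := by
  funext b u w
  ext v
  obtain ⟨σ, hσ, rfl⟩ := exists_global_section (E := E) (F := F) v
  obtain ⟨U, hU, rfl⟩ := exists_global_section (E := E) (F := E)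
    (V := (TangentSpace 𝓘(ℝ, E) : X → Type _)) u
  obtain ⟨W, hW, rfl⟩ := exists_global_section (E := E) (F := E)
    (V := (TangentSpace 𝓘(ℝ, E) : X → Type _)) w
  rw [h U W σ hU hW hσ b, h' U W σ hU hW hσ b]

theorem curvature_eq_chartCurv (hcov : CovariantDerivative.ContMDiffCovariantDerivative cov ∞)
    (hK : IsScalarLinear K cov) : curvature K cov = chartCurv K cov := by
  have h : ∃ R : ∀ x : X, TangentSpace 𝓘(ℝ, E) x → TangentSpace 𝓘(ℝ, E) x → (V x →ₗ[K] V x),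
    IsCurvature cov R := ⟨_, isCurvature_chartCurv hcov hK⟩
  rw [curvature, dif_pos h]
  exact h.choose_spec.unique (isCurvature_chartCurv hcov hK)

/-- The commutator of covariant derivatives along a map is the pulled back curvature. -/
theorem covAlong_comm (hcov : CovariantDerivative.ContMDiffCovariantDerivative cov ∞)
    (hK : IsScalarLinear K cov) {f : B → X} (hf : ContMDiff 𝓘(ℝ, B) 𝓘(ℝ, E) ∞ f) {p : B}
    {s : ∀ p, V (f p)}
    (hs : ContMDiffAt 𝓘(ℝ, B) (𝓘(ℝ, E).prod 𝓘(ℝ, F)) ∞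
      (fun q => (⟨f q, s q⟩ : TotalSpace F V)) p) (u v : B) :
    covAlong cov f (fun q => covAlong cov f s q v) p u -
      covAlong cov f (fun q => covAlong cov f s q u) p v =
    curvature K cov (f p) (mfderiv 𝓘(ℝ, B) 𝓘(ℝ, E) f p u) (mfderiv 𝓘(ℝ, B) 𝓘(ℝ, E) f p v)
      (s p) := by
  have hb : f p ∈ (trivializationAt F V (f p)).baseSet := coord_self_mem _
  refine coord_injective hb ?_
  have hsub : ∀ v v' : V (f p), coord F (f p) (v - v') = coord F (f p) v - coord F (f p) v' :=
    fun v v' => map_sub (coordEquiv ℝ F V hb) v v'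
  have hd : ∀ v : B, MDifferentiableAt 𝓘(ℝ, B) (𝓘(ℝ, E).prod 𝓘(ℝ, F))
      (fun q => (⟨f q, covAlong cov f s q v⟩ : TotalSpace F V)) p := fun v =>
    (contMDiffAt_covAlong hcov hK hf hs v).mdifferentiableAt (by simp)
  rw [curvature_eq_chartCurv hcov hK, hsub]
  refine Eq.trans ?_ (coord_chartCurv (cov := cov) (f p) _ _ (s p)).symm
  set h : B → E := fun q => extChartAt 𝓘(ℝ, E) (f p) (f q) with hh
  have hhs : ContDiffAt ℝ ∞ h p := contMDiffAt_iff_contDiffAt.1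
    ((contMDiffAt_extChartAt (I := 𝓘(ℝ, E)) (x := f p)).comp p (hf p))
  -- The pullback of the connection form by the map in the chart. In these terms the commutator is
  -- the flat curvature of `M` in the constant directions `u` and `v`, whose bracket vanishes, and
  -- `flatCurv_pullback` transfers it to the chart of `X`.
  let M : B → B →L[ℝ] F →L[K] F := fun q => (chartConn K cov (f p) (h q)).comp (fderiv ℝ h q)
  have hsrc : ∀ᶠ q in nhds p, f q ∈ (chartAt E (f p)).source :=
    hf.continuous.continuousAt.preimage_mem_nhds (chart_source_mem_nhds E (f p))
  have hcoord : ∀ q, f q ∈ (chartAt E (f p)).source → ∀ v,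
      coord E (f p) (mfderiv 𝓘(ℝ, B) 𝓘(ℝ, E) f q v) = fderiv ℝ h q v := fun q hq v => by
    rw [coord_tangent hq]
    have h3 := HasMFDerivAt.comp q (mdifferentiableAt_extChartAt (I := 𝓘(ℝ, E)) hq).hasMFDerivAt
      (hf.mdifferentiableAt (by simp)).hasMFDerivAt
    have h4 : (mfderiv 𝓘(ℝ, B) 𝓘(ℝ, E) h q : B →L[ℝ] E) = _ := h3.mfderiv
    rw [mfderiv_eq_fderiv] at h4
    exact (congrArg (fun L : B →L[ℝ] E => L v) h4).symm
  have hMeq : ∀ q, f q ∈ (chartAt E (f p)).source → f q ∈ (trivializationAt F V (f p)).baseSet →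
      ∀ v, M q v = connForm K cov (f p) (f q) (mfderiv 𝓘(ℝ, B) 𝓘(ℝ, E) f q v) :=
    fun q hq hq' v => (congrArg (fun z : E => chartConn K cov (f p) (h q) z)
      (hcoord q hq v)).symm.trans (chartConn_coord hK hq hq' _)
  have hcd := contDiffAt_chartConn hcov hK (f p)
  have hMd : DifferentiableAt ℝ M p := by
    have h1 : ContDiffAt ℝ ∞ (fun q => chartConn K cov (f p) (h q)) p :=
      ContDiffAt.comp (g := chartConn K cov (f p)) (f := h) p hcd hhs
    exact ((h1.differentiableAt (by simp)).clm_comp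
      ((hhs.fderiv_right (m := 1) (by norm_cast)).differentiableAt (by simp)))
  have hg := (contMDiffAt_along_iff hf.contMDiffAt hb).1 hs
  have key := flatCurv_eq hMd hg (differentiableAt_const u) (differentiableAt_const v)
  have hlie : VectorField.lieBracket ℝ (fun _ : B => u) (fun _ => v) p = 0 := by
    simp [VectorField.lieBracket]
  rw [hlie] at key
  simp only [map_zero, zero_apply, add_zero, sub_zero] at key
  rw [flatCurv_pullback hhs (hcd.differentiableAt (by simp))
    (Filter.Eventually.of_forall fun q v => rfl) u v] at key
  have hp := hsrc.self_of_nhds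
  have hloc : ∀ q, f q ∈ (chartAt E (f p)).source → f q ∈ (trivializationAt F V (f p)).baseSet →
      ∀ (s : ∀ p, V (f p)), MDifferentiableAt 𝓘(ℝ, B) (𝓘(ℝ, E).prod 𝓘(ℝ, F))
        (fun q => (⟨f q, s q⟩ : TotalSpace F V)) q → ∀ v,
      coord F (f p) (covAlong cov f s q v) =
        fderiv ℝ (fun q => coord F (f p) (s q)) q v + M q v (coord F (f p) (s q)) :=
    fun q hq hq' s hs v => (coord_covAlong hK hs hq' v).trans
      (congrArg (fun T : F →L[K] F => fderiv ℝ (fun q => coord F (f p) (s q)) q v +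
        T (coord F (f p) (s q))) (hMeq q hq hq' v).symm)
  have hev : ∀ v, (fun q => coord F (f p) (covAlong cov f s q v)) =ᶠ[nhds p] fun q =>
      fderiv ℝ (fun q => coord F (f p) (s q)) q v + M q v (coord F (f p) (s q)) := fun v => by
    filter_upwards [eventually_mdifferentiableAt hs, hsrc,
      eventually_mem_baseSet hf.continuous.continuousAt hb] with q hq hq1 hq2
    exact hloc q hq1 hq2 s hq v
  have hsd := (eventually_mdifferentiableAt hs).self_of_nhds
  rw [hloc p hp hb _ (hd v), hloc p hp hb _ (hd u), (hev v).fderiv_eq, (hev u).fderiv_eq,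
    hloc p hp hb s hsd v, hloc p hp hb s hsd u, key]
  exact congrArg₂ (fun a b : E => flatCurv (chartConn K cov (f p)) (h p) a b (coord F (f p) (s p)))
    (hcoord p hp u).symm (hcoord p hp v).symm

end Curvature

/-! ### Bilinearity and smoothness of the curvature -/

section Curvature

variable {K : Type*} [RCLike K]
    {E : Type*} [NormedAddCommGroup E] [NormedSpace ℝ E] [FiniteDimensional ℝ E]
    {X : Type*} [TopologicalSpace X] [T2Space X] [ChartedSpace E X] [IsManifold 𝓘(ℝ, E) ∞ X]
    {F : Type*} [NormedAddCommGroup F] [NormedSpace ℝ F] [FiniteDimensional ℝ F]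
    [NormedSpace K F] [IsScalarTower ℝ K F] [FiniteDimensional K F]
    {V : X → Type*} [TopologicalSpace (TotalSpace F V)]
    [∀ x, AddCommGroup (V x)] [∀ x, Module ℝ (V x)] [∀ x, Module K (V x)]
    [∀ x, TopologicalSpace (V x)]
    [∀ x, IsTopologicalAddGroup (V x)] [∀ x, ContinuousSMul ℝ (V x)]
    [FiberBundle F V] [VectorBundle ℝ F V] [VectorBundle K F V]
    [ContMDiffVectorBundle ∞ F V 𝓘(ℝ, E)]
    {B : Type*} [NormedAddCommGroup B] [NormedSpace ℝ B]
    {cov : CovariantDerivative 𝓘(ℝ, E) F V}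

theorem flatCurv_swap (M : B → B →L[ℝ] F →L[K] F) (p u v : B) :
    flatCurv M p u v = -flatCurv M p v u := by
  simp only [flatCurv]
  abel

set_option synthInstance.maxHeartbeats 200000 in
theorem flatCurv_add_left (M : B → B →L[ℝ] F →L[K] F) (p u u' v : B) :
    flatCurv M p (u + u') v = flatCurv M p u v + flatCurv M p u' v := by
  simp only [flatCurv, map_add, add_apply, ContinuousLinearMap.add_comp,
    ContinuousLinearMap.comp_add]
  abel

set_option synthInstance.maxHeartbeats 200000 in
theorem flatCurv_smul_left (M : B → B →L[ℝ] F →L[K] F) (p : B) (c : ℝ) (u v : B) :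
    flatCurv M p (c • u) v = c • flatCurv M p u v := by
  ext w
  simp only [flatCurv, map_smul, smul_apply, add_apply, sub_apply,
    ContinuousLinearMap.comp_apply, smul_add, smul_sub]
  -- What remains is that the `K`-linear operator `M p v` commutes with the real scalar `c`.
  congr 2
  exact ((M p v).restrictScalars ℝ).map_smul c _

theorem curvature_swap (hcov : CovariantDerivative.ContMDiffCovariantDerivative cov ∞)
    (hK : IsScalarLinear K cov) (b : X) (u v : TangentSpace 𝓘(ℝ, E) b) :
    curvature K cov b u v = -curvature K cov b v u := by
  ext s
  have hb : b ∈ (trivializationAt F V b).baseSet := coord_self_mem b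
  refine coord_injective hb ?_
  have h : coord F b (-(curvature K cov b v u s)) = -coord F b (curvature K cov b v u s) :=
    map_neg (coordEquiv K F V hb) _
  rw [LinearMap.neg_apply, h, curvature_eq_chartCurv hcov hK, coord_chartCurv, coord_chartCurv,
    flatCurv_swap]
  rfl

theorem curvature_add_left (hcov : CovariantDerivative.ContMDiffCovariantDerivative cov ∞)
    (hK : IsScalarLinear K cov) (b : X) (u u' v : TangentSpace 𝓘(ℝ, E) b) :
    curvature K cov b (u + u') v = curvature K cov b u v + curvature K cov b u' v := by
  ext s
  have hb : b ∈ (trivializationAt F V b).baseSet := coord_self_mem b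
  refine coord_injective hb ?_
  rw [LinearMap.add_apply, coord_add hb, curvature_eq_chartCurv hcov hK, coord_chartCurv,
    coord_chartCurv, coord_chartCurv, coord_add (coord_self_mem b), flatCurv_add_left]
  rfl

theorem curvature_smul_left (hcov : CovariantDerivative.ContMDiffCovariantDerivative cov ∞)
    (hK : IsScalarLinear K cov) (b : X) (c : ℝ) (u v : TangentSpace 𝓘(ℝ, E) b) (s : V b) :
    curvature K cov b (c • u) v s = c • curvature K cov b u v s := by
  have hb : b ∈ (trivializationAt F V b).baseSet := coord_self_mem b
  refine coord_injective hb ?_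
  rw [coord_smul (K := ℝ) hb, curvature_eq_chartCurv hcov hK, coord_chartCurv,
    coord_chartCurv, coord_smul (K := ℝ) (coord_self_mem b), flatCurv_smul_left]
  rfl

/-- The curvature, applied to a fixed vector, as a bilinear map. -/
def curvatureBilin (hcov : CovariantDerivative.ContMDiffCovariantDerivative cov ∞)
    (hK : IsScalarLinear K cov) (b : X) (s : V b) :
    TangentSpace 𝓘(ℝ, E) b →ₗ[ℝ] TangentSpace 𝓘(ℝ, E) b →ₗ[ℝ] V b :=
  LinearMap.mk₂ ℝ (fun u v => curvature K cov b u v s)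
    (fun u u' v => by rw [curvature_add_left hcov hK]; rfl)
    (fun c u v => curvature_smul_left hcov hK b c u v s)
    (fun u v v' => by
      rw [curvature_swap hcov hK, curvature_add_left hcov hK, curvature_swap hcov hK b u v,
        curvature_swap hcov hK b u v', LinearMap.neg_apply, LinearMap.add_apply,
        LinearMap.neg_apply, LinearMap.neg_apply, neg_add])
    (fun c u v => by
      rw [curvature_swap hcov hK, curvature_swap hcov hK b u v, LinearMap.neg_apply,
        LinearMap.neg_apply, curvature_smul_left hcov hK, smul_neg])

theorem curvatureBilin_apply (hcov : CovariantDerivative.ContMDiffCovariantDerivative cov ∞)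
    (hK : IsScalarLinear K cov) (b : X) (s : V b) (u v : TangentSpace 𝓘(ℝ, E) b) :
    curvatureBilin hcov hK b s u v = curvature K cov b u v s := rfl

/-- A field of endomorphisms along `f` is smooth if it is on sections which are constant in a
trivialization. -/
theorem contMDiffAt_end_apply {f : B → X} {p : B} (hf : ContMDiffAt 𝓘(ℝ, B) 𝓘(ℝ, E) ∞ f p)
    {b : X} (hb : f p ∈ (trivializationAt F V b).baseSet) (T : ∀ q, V (f q) →ₗ[K] V (f q))
    (hT : ∀ w : F, ContMDiffAt 𝓘(ℝ, B) (𝓘(ℝ, E).prod 𝓘(ℝ, F)) ∞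
      (fun q => (⟨f q, T q (ofCoord V b (f q) w)⟩ : TotalSpace F V)) p) {s : ∀ q, V (f q)}
    (hs : ContMDiffAt 𝓘(ℝ, B) (𝓘(ℝ, E).prod 𝓘(ℝ, F)) ∞
      (fun q => (⟨f q, s q⟩ : TotalSpace F V)) p) :
    ContMDiffAt 𝓘(ℝ, B) (𝓘(ℝ, E).prod 𝓘(ℝ, F)) ∞
      (fun q => (⟨f q, T q (s q)⟩ : TotalSpace F V)) p := by
  rw [contMDiffAt_along_iff hf hb] at hs ⊢
  -- The matrix of `T` in the trivialization at `b`; the total maps `linearMapAt` and `symmₗ` make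
  -- it defined also outside the base set.
  let g : B → F →L[K] F := fun q => LinearMap.toContinuousLinearMap
    ((trivializationAt F V b).linearMapAt K (f q) ∘ₗ T q ∘ₗ
      (trivializationAt F V b).symmₗ K (f q))
  have hg : ∀ q, f q ∈ (trivializationAt F V b).baseSet → ∀ w,
      g q w = coord F b (T q (ofCoord V b (f q) w)) := fun q hq w => by
    change (trivializationAt F V b).linearMapAt K (f q) (T q
      ((trivializationAt F V b).symmₗ K (f q) w)) = _
    rw [Trivialization.coe_linearMapAt_of_mem _ hq, Trivialization.symmₗ_apply _ hq]
    rfl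
  have hev := eventually_mem_baseSet hf.continuousAt hb
  have hgs : ContDiffAt ℝ ∞ g p := contDiffAt_clm_of_apply fun w =>
    ((contMDiffAt_along_iff hf hb).1 (hT w)).congr_of_eventuallyEq
      (hev.mono fun q hq => hg q hq w)
  refine (contDiffAt_clm_apply hgs hs).congr_of_eventuallyEq (hev.mono fun q hq => ?_)
  change _ = g q _
  rw [hg q hq, ofCoord_coord hq]

/-- For global fields every term of the defining formula is smooth, so smoothness needs no
computation in charts. -/
theorem contMDiff_curvature (hcov : CovariantDerivative.ContMDiffCovariantDerivative cov ∞)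
    (hK : IsScalarLinear K cov) {U W : ∀ x : X, TangentSpace 𝓘(ℝ, E) x} {σ : ∀ x, V x}
    (hU : ContMDiff 𝓘(ℝ, E) 𝓘(ℝ, E).tangent ∞ (fun y => (⟨y, U y⟩ : TangentBundle 𝓘(ℝ, E) X)))
    (hW : ContMDiff 𝓘(ℝ, E) 𝓘(ℝ, E).tangent ∞ (fun y => (⟨y, W y⟩ : TangentBundle 𝓘(ℝ, E) X)))
    (hσ : ContMDiff 𝓘(ℝ, E) (𝓘(ℝ, E).prod 𝓘(ℝ, F)) ∞
      (fun y => (⟨y, σ y⟩ : TotalSpace F V))) :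
    ContMDiff 𝓘(ℝ, E) (𝓘(ℝ, E).prod 𝓘(ℝ, F)) ∞
      (fun y => (⟨y, curvature K cov y (U y) (W y) (σ y)⟩ : TotalSpace F V)) := by
  have hc : ∀ {τ : ∀ x, V x} {Y : ∀ x : X, TangentSpace 𝓘(ℝ, E) x},
      ContMDiff 𝓘(ℝ, E) (𝓘(ℝ, E).prod 𝓘(ℝ, F)) ∞ (fun y => (⟨y, τ y⟩ : TotalSpace F V)) →
      ContMDiff 𝓘(ℝ, E) 𝓘(ℝ, E).tangent ∞ (fun y => (⟨y, Y y⟩ : TangentBundle 𝓘(ℝ, E) X)) →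
      ContMDiff 𝓘(ℝ, E) (𝓘(ℝ, E).prod 𝓘(ℝ, F)) ∞
        (fun y => (⟨y, cov τ y (Y y)⟩ : TotalSpace F V)) := fun hτ hY y =>
    contMDiffAt_cov_along (f := fun z : X => z) hcov hτ (hY y)
  have : IsManifold 𝓘(ℝ, E) (minSmoothness ℝ 2) X :=
    IsManifold.of_le (n := ∞) (by simp; norm_cast)
  have : IsManifold 𝓘(ℝ, E) (∞ + 1) X := IsManifold.of_le (n := ∞) (by simp)
  have hB : ContMDiff 𝓘(ℝ, E) 𝓘(ℝ, E).tangent ∞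
      (fun y => (⟨y, VectorField.mlieBracket 𝓘(ℝ, E) U W y⟩ : TangentBundle 𝓘(ℝ, E) X)) :=
    ContDiff.mlieBracket_vectorField (m := ⊤) (n := ⊤) hU hW (by simp)
  have h := ((hc (hc hσ hW) hU).sub_section (hc (hc hσ hU) hW)).sub_section (hc hσ hB)
  have hR := isCurvature_chartCurv hcov hK
  rw [← curvature_eq_chartCurv hcov hK] at hR
  convert h using 3 with y
  exact hR U W σ hU hW hσ y

/-- By bilinearity the vectors along `f` are expanded in global fields that form a frame near `f p`;
the coefficients are smooth, and the curvature of the frame fields is pulled back from `X`. -/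
theorem contMDiffAt_curvature_along (hcov : CovariantDerivative.ContMDiffCovariantDerivative cov ∞)
    (hK : IsScalarLinear K cov) {f : B → X} {p : B}
    {u v : ∀ q, TangentSpace 𝓘(ℝ, E) (f q)} {s : ∀ q, V (f q)}
    (hu : ContMDiffAt 𝓘(ℝ, B) 𝓘(ℝ, E).tangent ∞
      (fun q => (⟨f q, u q⟩ : TangentBundle 𝓘(ℝ, E) X)) p)
    (hv : ContMDiffAt 𝓘(ℝ, B) 𝓘(ℝ, E).tangent ∞
      (fun q => (⟨f q, v q⟩ : TangentBundle 𝓘(ℝ, E) X)) p)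
    (hs : ContMDiffAt 𝓘(ℝ, B) (𝓘(ℝ, E).prod 𝓘(ℝ, F)) ∞
      (fun q => (⟨f q, s q⟩ : TotalSpace F V)) p) :
    ContMDiffAt 𝓘(ℝ, B) (𝓘(ℝ, E).prod 𝓘(ℝ, F)) ∞
      (fun q => (⟨f q, curvature K cov (f q) (u q) (v q) (s q)⟩ : TotalSpace F V)) p := by
  have hf : ContMDiffAt 𝓘(ℝ, B) 𝓘(ℝ, E) ∞ f p := (contMDiffAt_totalSpace.1 hu).1
  have hb : f p ∈ (trivializationAt F V (f p)).baseSet := coord_self_mem _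
  have hbT : f p ∈ (trivializationAt E (TangentSpace 𝓘(ℝ, E) : X → Type _) (f p)).baseSet :=
    coord_self_mem _
  refine contMDiffAt_end_apply hf hb (fun q => curvature K cov (f q) (u q) (v q))
    (fun w => ?_) hs
  obtain ⟨ε, hε, hεe⟩ := exists_global_ofCoord (E := E) hb w
  let β := Module.finBasis ℝ E
  have hX := fun i => exists_global_ofCoord (E := E) hbT (β i)
  choose Y hY hYe using hX
  rw [contMDiffAt_along_iff hf hb]
  have hc : ∀ {u : ∀ q, TangentSpace 𝓘(ℝ, E) (f q)}, ContMDiffAt 𝓘(ℝ, B) 𝓘(ℝ, E).tangent ∞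
      (fun q => (⟨f q, u q⟩ : TangentBundle 𝓘(ℝ, E) X)) p → ∀ i,
      ContDiffAt ℝ ∞ (fun q => β.coord i (coord E (f p) (u q))) p := fun {u} hu i =>
    (LinearMap.toContinuousLinearMap (β.coord i)).contDiff.contDiffAt.comp p
      ((contMDiffAt_along_iff (V := (TangentSpace 𝓘(ℝ, E) : X → Type _)) hf hbT).1 hu)
  have hterm : ∀ i j, ContDiffAt ℝ ∞ (fun q =>
      coord F (f p) (curvature K cov (f q) (Y i (f q)) (Y j (f q)) (ε (f q)))) p := fun i j =>
    (contMDiffAt_along_iff hf hb).1 (ContMDiffAt.comp p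
      (contMDiff_curvature hcov hK (hY i) (hY j) hε (f p)) hf)
  have hsum : ContDiffAt ℝ ∞ (fun q => ∑ i, ∑ j, β.coord i (coord E (f p) (u q)) •
      β.coord j (coord E (f p) (v q)) •
      coord F (f p) (curvature K cov (f q) (Y i (f q)) (Y j (f q)) (ε (f q)))) p :=
    ContDiffAt.sum fun i _ => ContDiffAt.sum fun j _ =>
      (hc hu i).smul ((hc hv j).smul (hterm i j))
  refine hsum.congr_of_eventuallyEq ?_
  have hYall : ∀ᶠ y in nhds (f p), ∀ i, Y i y =
      ofCoord (TangentSpace 𝓘(ℝ, E) : X → Type _) (f p) y (β i) := Filter.eventually_all.2 hYe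
  filter_upwards [hf.continuousAt.eventually hεe, hf.continuousAt.eventually hYall,
    eventually_mem_baseSet hf.continuousAt hb, eventually_mem_baseSet hf.continuousAt hbT]
    with q h1 h2 h3 h4
  have hexp : ∀ x : TangentSpace 𝓘(ℝ, E) (f q),
      x = ∑ i, β.coord i (coord E (f p) x) • Y i (f q) := fun x => by
    have h5 := map_sum (coordEquiv ℝ E (TangentSpace 𝓘(ℝ, E) : X → Type _) h4).symm
      (fun i => β.coord i (coord E (f p) x) • β i) Finset.univ
    have h6 : ∑ i, β.coord i (coord E (f p) x) • β i = coord E (f p) x := β.sum_repr _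
    rw [h6, coordEquiv_symm_apply, ofCoord_coord h4] at h5
    refine h5.trans (Finset.sum_congr rfl fun i _ => ?_)
    rw [h2 i, map_smul]
    rfl
  have hcs : ∀ g : Fin (Module.finrank ℝ E) → V (f q),
      coord F (f p) (∑ i, g i) = ∑ i, coord F (f p) (g i) := fun g =>
    map_sum (coordEquiv ℝ F V h3) g Finset.univ
  rw [← h1, ← curvatureBilin_apply hcov hK]
  conv_lhs => rw [hexp (u q), hexp (v q)]
  rw [map_sum, hcs, Finset.sum_comm]
  refine Finset.sum_congr rfl fun j _ => ?_
  rw [map_sum, LinearMap.sum_apply, hcs]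
  refine Finset.sum_congr rfl fun i _ => ?_
  rw [map_smul, map_smul, LinearMap.smul_apply, coord_smul (K := ℝ) h3, coord_smul (K := ℝ) h3,
    smul_comm]
  rfl

end Curvature

/-! ### Smooth frames along a map -/

section Linv

variable {K : Type*} [Field K] {F W : Type*} [AddCommGroup F] [AddCommGroup W] [Module K F]
  [Module K W]

open Classical in
/-- The inverse of a bijective linear map, as a linear map. -/
def linv (T : F →ₗ[K] W) : W →ₗ[K] F :=
  if h : Function.Bijective T then (LinearEquiv.ofBijective T h).symm.toLinearMap else 0

theorem linv_apply_self {T : F →ₗ[K] W} (h : Function.Bijective T) (w : F) : linv T (T w) = w := by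
  rw [linv, dif_pos h]
  exact (LinearEquiv.ofBijective T h).symm_apply_apply w

theorem apply_linv {T : F →ₗ[K] W} (h : Function.Bijective T) (v : W) : T (linv T v) = v := by
  rw [linv, dif_pos h]
  exact (LinearEquiv.ofBijective T h).apply_symm_apply v

theorem bijective_linv {T : F →ₗ[K] W} (h : Function.Bijective T) :
    Function.Bijective (linv T) :=
  Function.bijective_iff_has_inverse.2 ⟨T, apply_linv h, linv_apply_self h⟩

end Linv

section Frames

variable {K : Type*} [RCLike K]
    {E : Type*} [NormedAddCommGroup E] [NormedSpace ℝ E] [FiniteDimensional ℝ E]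
    {X : Type*} [TopologicalSpace X] [T2Space X] [ChartedSpace E X] [IsManifold 𝓘(ℝ, E) ∞ X]
    {F : Type*} [NormedAddCommGroup F] [NormedSpace ℝ F] [FiniteDimensional ℝ F]
    [NormedSpace K F] [IsScalarTower ℝ K F] [FiniteDimensional K F]
    {V : X → Type*} [TopologicalSpace (TotalSpace F V)]
    [∀ x, AddCommGroup (V x)] [∀ x, Module ℝ (V x)] [∀ x, Module K (V x)]
    [∀ x, TopologicalSpace (V x)]
    [∀ x, IsTopologicalAddGroup (V x)] [∀ x, ContinuousSMul ℝ (V x)]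
    [FiberBundle F V] [VectorBundle ℝ F V] [VectorBundle K F V]
    [ContMDiffVectorBundle ∞ F V 𝓘(ℝ, E)]
    {B : Type*} [NormedAddCommGroup B] [NormedSpace ℝ B]
    {cov : CovariantDerivative 𝓘(ℝ, E) F V}

variable (K) in
/-- A family of linear maps `F → V (f q)` in the trivialization at `b`. -/
def frameCoord {f : B → X} (e : ∀ q, F →ₗ[K] V (f q)) (b : X) (q : B) : F →L[K] F :=
  LinearMap.toContinuousLinearMap ((trivializationAt F V b).linearMapAt K (f q) ∘ₗ e q)

section

variable {f : B → X} {e : ∀ q, F →ₗ[K] V (f q)} {b : X} {p q : B}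

theorem frameCoord_apply (hq : f q ∈ (trivializationAt F V b).baseSet) (w : F) :
    frameCoord K e b q w = coord F b (e q w) := by
  change (trivializationAt F V b).linearMapAt K (f q) (e q w) = _
  rw [Trivialization.coe_linearMapAt_of_mem _ hq]
  rfl

theorem contDiffAt_frameCoord (hf : ContMDiffAt 𝓘(ℝ, B) 𝓘(ℝ, E) ∞ f p)
    (hb : f p ∈ (trivializationAt F V b).baseSet)
    (he : ∀ w, ContMDiffAt 𝓘(ℝ, B) (𝓘(ℝ, E).prod 𝓘(ℝ, F)) ∞
      (fun q => (⟨f q, e q w⟩ : TotalSpace F V)) p) : ContDiffAt ℝ ∞ (frameCoord K e b) p :=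
  contDiffAt_clm_of_apply fun w => ((contMDiffAt_along_iff hf hb).1 (he w)).congr_of_eventuallyEq
    ((eventually_mem_baseSet hf.continuousAt hb).mono fun _ hq => frameCoord_apply hq w)

theorem coord_frame_apply_eventuallyEq (hf : ContMDiffAt 𝓘(ℝ, B) 𝓘(ℝ, E) ∞ f p)
    (hb : f p ∈ (trivializationAt F V b).baseSet) (c : B → F) :
    (fun q => coord F b (e q (c q))) =ᶠ[nhds p] fun q => frameCoord K e b q (c q) :=
  (eventually_mem_baseSet hf.continuousAt hb).mono fun _ hq => (frameCoord_apply hq _).symm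

theorem contMDiffAt_frame_apply (hf : ContMDiffAt 𝓘(ℝ, B) 𝓘(ℝ, E) ∞ f p)
    (he : ∀ w, ContMDiffAt 𝓘(ℝ, B) (𝓘(ℝ, E).prod 𝓘(ℝ, F)) ∞
      (fun q => (⟨f q, e q w⟩ : TotalSpace F V)) p) {c : B → F} (hc : ContDiffAt ℝ ∞ c p) :
    ContMDiffAt 𝓘(ℝ, B) (𝓘(ℝ, E).prod 𝓘(ℝ, F)) ∞
      (fun q => (⟨f q, e q (c q)⟩ : TotalSpace F V)) p := by
  have hb : f p ∈ (trivializationAt F V (f p)).baseSet := coord_self_mem _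
  rw [contMDiffAt_along_iff hf hb]
  exact (contDiffAt_clm_apply (contDiffAt_frameCoord hf hb he) hc).congr_of_eventuallyEq
    (coord_frame_apply_eventuallyEq hf hb c)

theorem bijective_frameCoord (hq : f q ∈ (trivializationAt F V b).baseSet) :
    Function.Bijective (frameCoord K e b q) ↔ Function.Bijective (e q) := by
  have h : (frameCoord K e b q : F → F) = coordEquiv K F V hq ∘ e q :=
    funext fun w => frameCoord_apply hq w
  rw [h]
  exact (coordEquiv K F V hq).bijective.of_comp_iff' _

/-- Coordinates of a smooth section in a smooth frame are smooth. -/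
theorem contDiffAt_of_frame_apply (hf : ContMDiffAt 𝓘(ℝ, B) 𝓘(ℝ, E) ∞ f p)
    (he : ∀ w, ContMDiffAt 𝓘(ℝ, B) (𝓘(ℝ, E).prod 𝓘(ℝ, F)) ∞
      (fun q => (⟨f q, e q w⟩ : TotalSpace F V)) p)
    (hbij : ∀ᶠ q in nhds p, Function.Bijective (e q)) {c : B → F} {s : ∀ q, V (f q)}
    (hs : ContMDiffAt 𝓘(ℝ, B) (𝓘(ℝ, E).prod 𝓘(ℝ, F)) ∞
      (fun q => (⟨f q, s q⟩ : TotalSpace F V)) p) (hc : ∀ᶠ q in nhds p, e q (c q) = s q) :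
    ContDiffAt ℝ ∞ c p := by
  have hb : f p ∈ (trivializationAt F V (f p)).baseSet := coord_self_mem _
  have hcomp : CompleteSpace F := FiniteDimensional.complete ℝ F
  let Y : B → F →L[ℝ] F := fun q => applyL K F (frameCoord K e (f p) q)
  have hY : ContDiffAt ℝ ∞ Y p :=
    (applyL K F).contDiff.contDiffAt.comp p (contDiffAt_frameCoord hf hb he)
  have hequiv : ∀ q, f q ∈ (trivializationAt F V (f p)).baseSet → Function.Bijective (e q) →
      ∃ L : F ≃L[ℝ] F, (L : F →L[ℝ] F) = Y q := fun q hq hq' =>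
    ⟨(LinearEquiv.ofBijective (Y q : F →ₗ[ℝ] F)
      ((bijective_frameCoord hq).2 hq')).toContinuousLinearEquiv, by ext; rfl⟩
  obtain ⟨L, hL⟩ := hequiv p hb hbij.self_of_nhds
  -- Inversion is smooth at an invertible operator, so the coordinates are a smooth inverse matrix
  -- applied to a smooth vector.
  have hinv : ContDiffAt ℝ ∞ (fun q => (Y q).inverse) p := by
    have h : ContDiffAt ℝ ∞ ContinuousLinearMap.inverse (Y p) := hL ▸ contDiffAt_map_inverse L
    exact h.comp p hY
  refine (hinv.clm_apply ((contMDiffAt_along_iff hf hb).1 hs)).congr_of_eventuallyEq ?_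
  filter_upwards [hbij, hc, eventually_mem_baseSet hf.continuousAt hb] with q h1 h2 h3
  obtain ⟨L, hL⟩ := hequiv q h3 h1
  rw [← hL, ContinuousLinearMap.inverse_equiv, ← h2, ← frameCoord_apply h3]
  have h4 : frameCoord K e (f p) q (c q) = L (c q) :=
    (congrArg (fun T : F →L[ℝ] F => T (c q)) hL).symm
  rw [h4]
  exact (L.symm_apply_apply _).symm

/-- The Leibniz rule `∇_v (e c) = e (D_v c) + (∇_v e) c`. -/
theorem covAlong_frame_apply (hK : IsScalarLinear K cov)
    (hf : ContMDiffAt 𝓘(ℝ, B) 𝓘(ℝ, E) ∞ f p)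
    (he : ∀ w, ContMDiffAt 𝓘(ℝ, B) (𝓘(ℝ, E).prod 𝓘(ℝ, F)) ∞
      (fun q => (⟨f q, e q w⟩ : TotalSpace F V)) p) {c : B → F} (hc : ContDiffAt ℝ ∞ c p) (v : B) :
    covAlong cov f (fun q => e q (c q)) p v =
      e p (fderiv ℝ c p v) + covAlong cov f (fun q => e q (c p)) p v := by
  have hb : f p ∈ (trivializationAt F V (f p)).baseSet := coord_self_mem _
  refine coord_injective hb ?_
  have hY := contDiffAt_frameCoord hf hb he
  rw [coord_add hb, coord_covAlong hK ((contMDiffAt_frame_apply hf he hc).mdifferentiableAt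
    (by simp)) hb, coord_covAlong hK ((he (c p)).mdifferentiableAt (by simp)) hb,
    (coord_frame_apply_eventuallyEq hf hb c).fderiv_eq,
    (coord_frame_apply_eventuallyEq hf hb (fun _ => c p)).fderiv_eq,
    fderiv_clm_apply_apply (hY.differentiableAt (by simp)) (hc.differentiableAt (by simp)),
    fderiv_clm_apply_apply (hY.differentiableAt (by simp)) (differentiableAt_const _),
    ← frameCoord_apply hb, ← frameCoord_apply hb]
  simp only [fderiv_fun_const, Pi.zero_apply, zero_apply, map_zero, add_zero]
  abel

end

/-- A smooth frame along `f` over `S`, which is parallel in the direction `d`. -/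
structure IsFrameOn (cov : CovariantDerivative 𝓘(ℝ, E) F V) (f : B → X) (d : B)
    (e : ∀ q, F →ₗ[K] V (f q)) (S : Set B) : Prop where
  bijective : ∀ q ∈ S, Function.Bijective (e q)
  smooth : ∀ q ∈ S, ∀ w, ContMDiffAt 𝓘(ℝ, B) (𝓘(ℝ, E).prod 𝓘(ℝ, F)) ∞
      (fun q => (⟨f q, e q w⟩ : TotalSpace F V)) q
  parallel : ∀ q ∈ S, ∀ w, covAlong cov f (fun q => e q w) q d = 0

theorem IsFrameOn.mono {f : B → X} {d : B} {e : ∀ q, F →ₗ[K] V (f q)} {S S' : Set B}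
    (h : IsFrameOn cov f d e S) (hS : S' ⊆ S) : IsFrameOn cov f d e S' :=
  ⟨fun q hq => h.bijective q (hS hq), fun q hq => h.smooth q (hS hq),
    fun q hq => h.parallel q (hS hq)⟩

theorem IsFrameOn.restrict {A : Type*} [NormedAddCommGroup A] [NormedSpace ℝ A] {f : A × ℝ → X}
    {e : ∀ q, F →ₗ[K] V (f q)} {S : Set (A × ℝ)} (hK : IsScalarLinear K cov)
    (h : IsFrameOn cov f (0, 1) e S) (x : A) :
    IsFrameOn cov (fun t => f (x, t)) 1 (fun t => e (x, t)) {t | (x, t) ∈ S} := by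
  have hφ : ∀ t : ℝ, HasFDerivAt (fun t : ℝ => (x, t)) (ContinuousLinearMap.inr ℝ A ℝ) t :=
    fun t => hasFDerivAt_prodMk_right x t
  refine ⟨fun t ht => h.bijective _ ht, fun t ht w => ?_, fun t ht w => ?_⟩
  · exact (h.smooth _ ht w).comp t (contDiff_prodMk_right x).contMDiff.contMDiffAt
  · have h1 := covAlong_comp (φ := fun t : ℝ => (x, t)) (q := t) hK
      ((h.smooth _ ht w).mdifferentiableAt (by simp)) (hφ t).differentiableAt 1
    rw [h1, (hφ t).fderiv]
    exact h.parallel _ ht w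

theorem eq_of_deriv_eq_zero {G : Type*} [NormedAddCommGroup G] [NormedSpace ℝ G] {c : ℝ → G}
    {a b : ℝ} (h : ∀ t ∈ Set.uIcc a b, HasDerivAt c 0 t) : c a = c b := by
  have h1 := Convex.norm_image_sub_le_of_norm_hasDerivWithin_le (C := 0) (f' := fun _ => (0 : G))
    (fun t ht => (h t ht).hasDerivWithinAt) (fun t _ => by simp) (convex_uIcc a b)
    Set.left_mem_uIcc Set.right_mem_uIcc
  rw [zero_mul] at h1
  exact (sub_eq_zero.1 (norm_le_zero_iff.1 h1)).symm

/-- A parallel section has constant coordinates in a parallel frame. -/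
theorem IsFrameOn.linv_eq {γ : ℝ → X} {e : ∀ t, F →ₗ[K] V (γ t)} {S : Set ℝ}
    (hK : IsScalarLinear K cov) (hγ : ContMDiff 𝓘(ℝ, ℝ) 𝓘(ℝ, E) ∞ γ)
    (h : IsFrameOn cov γ 1 e S) (hS : IsOpen S) {s : ∀ t, V (γ t)} {a b : ℝ}
    (hab : Set.uIcc a b ⊆ S)
    (hs : ∀ t ∈ Set.uIcc a b, ContMDiffAt 𝓘(ℝ, ℝ) (𝓘(ℝ, E).prod 𝓘(ℝ, F)) ∞
      (fun t => (⟨γ t, s t⟩ : TotalSpace F V)) t)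
    (hp : ∀ t ∈ Set.uIcc a b, covAlong cov γ s t 1 = 0) :
    linv (e a) (s a) = linv (e b) (s b) := by
  refine eq_of_deriv_eq_zero (c := fun t => linv (e t) (s t)) fun t ht => ?_
  have hev : ∀ᶠ r in nhds t, r ∈ S := hS.mem_nhds (hab ht)
  have hc : ∀ᶠ r in nhds t, e r (linv (e r) (s r)) = s r :=
    hev.mono fun r hr => apply_linv (h.bijective r hr) _
  have hcs : ContDiffAt ℝ ∞ (fun t => linv (e t) (s t)) t :=
    contDiffAt_of_frame_apply hγ.contMDiffAt (h.smooth t (hab ht))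
      (hev.mono fun r hr => h.bijective r hr) (hs t ht) hc
  -- With `s = e c` the Leibniz rule reads `∇s = e c' + (∇e) c`. Here `∇s` and `∇e` vanish and `e`
  -- is injective, so `c' = 0`.
  have h1 := covAlong_frame_apply hK hγ.contMDiffAt (h.smooth t (hab ht)) hcs 1
  rw [covAlong_congr hc, hp t ht, h.parallel t (hab ht), add_zero] at h1
  have h2 := (h.bijective t (hab ht)).1 (h1.symm.trans (map_zero (e t)).symm)
  have h3 := (hcs.differentiableAt (by simp)).hasDerivAt
  rwa [← fderiv_apply_one_eq_deriv, h2] at h3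

end Frames

/-! ### Cut-offs and linear equations with arbitrary initial time -/

section ODE

/-- The connection form in a trivialization is smooth only near a point, whereas the linear equation
is solved for globally smooth coefficients; a cut-off bridges the two. -/
theorem exists_contDiff_eventuallyEq {B : Type*} [NormedAddCommGroup B] [NormedSpace ℝ B]
    [FiniteDimensional ℝ B] {G : Type*} [NormedAddCommGroup G] [NormedSpace ℝ G] {g : B → G}
    {p : B} (hg : ∀ᶠ q in nhds p, ContDiffAt ℝ ∞ g q) :
    ∃ h : B → G, ContDiff ℝ ∞ h ∧ h =ᶠ[nhds p] g := by
  obtain ⟨r, hr, hball⟩ := Metric.mem_nhds_iff.1 hg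
  let ψ : ContDiffBump p := ⟨r / 3, r / 2, by positivity, by linarith⟩
  refine ⟨fun q => ψ q • g q, contDiff_iff_contDiffAt.2 fun q => ?_, ?_⟩
  · by_cases hq : q ∈ tsupport ψ
    · rw [ψ.tsupport_eq] at hq
      have hq' : q ∈ Metric.ball p r := Metric.closedBall_subset_ball (by
        change r / 2 < r; linarith) hq
      exact ψ.contDiff.contDiffAt.smul (hball hq')
    · refine (contDiffAt_const (c := (0 : G))).congr_of_eventuallyEq ?_
      filter_upwards [notMem_tsupport_iff_eventuallyEq.1 hq] with z hz
      simp [hz]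
  · filter_upwards [ψ.eventuallyEq_one] with z hz
    simp [hz]

theorem exists_contDiff_bilinearODE {A : Type} [NormedAddCommGroup A] [NormedSpace ℝ A]
    [FiniteDimensional ℝ A] {G : Type*} [NormedAddCommGroup G] [NormedSpace ℝ G]
    [FiniteDimensional ℝ G] (μ : G →ₗ[ℝ] G →ₗ[ℝ] G) {M : A × ℝ → G} (hM : ContDiff ℝ ∞ M)
    (y₀ : G) (t₀ : ℝ) :
    ∃ y : A × ℝ → G, ContDiff ℝ ∞ y ∧ (∀ x, y (x, t₀) = y₀) ∧
      ∀ p, fderiv ℝ y p (0, 1) = μ (M p) (y p) := by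
  let Λ : G →L[ℝ] G →L[ℝ] G := LinearMap.toContinuousLinearMap
    ((LinearMap.toContinuousLinearMap : (G →ₗ[ℝ] G) ≃ₗ[ℝ] (G →L[ℝ] G)).toLinearMap ∘ₗ μ)
  obtain ⟨y, hy, hy0, hy'⟩ := exists_contDiff_linearODE (A := A) (y₀ := fun _ => y₀)
    (M := fun p => Λ (M (p + (0, t₀))))
    (Λ.contDiff.comp (hM.comp (contDiff_id.add contDiff_const))) contDiff_const
  refine ⟨fun p => y (p - (0, t₀)), hy.comp (contDiff_id.sub contDiff_const), fun x => ?_,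
    fun p => ?_⟩
  · simpa using hy0 x
  · rw [fderiv_comp_sub, hy']
    simp [Λ]

end ODE

/-! ### Existence of frames that are parallel in time -/

section Frames

variable {K : Type*} [RCLike K]
    {E : Type*} [NormedAddCommGroup E] [NormedSpace ℝ E] [FiniteDimensional ℝ E]
    {X : Type*} [TopologicalSpace X] [T2Space X] [ChartedSpace E X] [IsManifold 𝓘(ℝ, E) ∞ X]
    {F : Type*} [NormedAddCommGroup F] [NormedSpace ℝ F] [FiniteDimensional ℝ F]
    [NormedSpace K F] [IsScalarTower ℝ K F] [FiniteDimensional K F]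
    {V : X → Type*} [TopologicalSpace (TotalSpace F V)]
    [∀ x, AddCommGroup (V x)] [∀ x, Module ℝ (V x)] [∀ x, Module K (V x)]
    [∀ x, TopologicalSpace (V x)]
    [∀ x, IsTopologicalAddGroup (V x)] [∀ x, ContinuousSMul ℝ (V x)]
    [FiberBundle F V] [VectorBundle ℝ F V] [VectorBundle K F V]
    [ContMDiffVectorBundle ∞ F V 𝓘(ℝ, E)]
    {cov : CovariantDerivative 𝓘(ℝ, E) F V}

variable (K F) in
/-- Composition of endomorphisms, with a sign, as a real bilinear map. -/
def negComp : (F →L[K] F) →ₗ[ℝ] (F →L[K] F) →ₗ[ℝ] (F →L[K] F) :=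
  LinearMap.mk₂ ℝ (fun S T => -(S ∘L T))
    (fun S S' T => by rw [ContinuousLinearMap.add_comp, neg_add])
    (fun c S T => by ext; simp)
    (fun S T T' => by rw [ContinuousLinearMap.comp_add, neg_add])
    (fun c S T => by
      ext w
      simp only [ContinuousLinearMap.comp_apply, smul_apply, neg_apply]
      exact congrArg Neg.neg ((S.restrictScalars ℝ).map_smul c (T w)) |>.trans (smul_neg _ _).symm)

section

variable {A : Type} [NormedAddCommGroup A] [NormedSpace ℝ A] [FiniteDimensional ℝ A]
  {f : A × ℝ → X}

/-- In a trivialization a parallel frame is a matrix solution of `∂Y/∂t = -Γ(∂_t) Y`. Starting from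
the identity at the time of `p`, it stays invertible near `p`. -/
theorem exists_local_frame (hcov : CovariantDerivative.ContMDiffCovariantDerivative cov ∞)
    (hK : IsScalarLinear K cov) (hf : ContMDiff 𝓘(ℝ, A × ℝ) 𝓘(ℝ, E) ∞ f) (p : A × ℝ) :
    ∃ S : Set (A × ℝ), IsOpen S ∧ p ∈ S ∧ ∃ e : ∀ q, F →ₗ[K] V (f q),
      IsFrameOn cov f (0, 1) e S := by
  have hb : f p ∈ (trivializationAt F V (f p)).baseSet := coord_self_mem _
  have hcomp : CompleteSpace F := FiniteDimensional.complete ℝ F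
  have hfin := finiteDimensional_real_end K F
  have hbase := eventually_mem_baseSet hf.continuous.continuousAt hb
  have hM0 : ∀ᶠ q in nhds p, ContDiffAt ℝ ∞ (fun q => connForm K cov (f p) (f q)
      (mfderiv 𝓘(ℝ, A × ℝ) 𝓘(ℝ, E) f q ((0, 1) : A × ℝ))) q :=
    hbase.mono fun q hq => contDiffAt_connForm hcov hK
      (contMDiff_mfderiv_apply hf ((0, 1) : A × ℝ) q) hq
  obtain ⟨M, hM, hMe⟩ := exists_contDiff_eventuallyEq hM0
  obtain ⟨Y, hY, hY0, hY'⟩ := exists_contDiff_bilinearODE (negComp K F) hM 1 p.2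
  have hunit : ∀ᶠ q in nhds p, IsUnit (Y q) :=
    hY.continuous.continuousAt.preimage_mem_nhds
      (Units.isOpen.mem_nhds (by
        change IsUnit (Y (p.1, p.2))
        rw [hY0]
        exact isUnit_one))
  -- On `S` three things hold at once: the trivialization is defined, the cut-off coefficient is the
  -- true connection form, and the solution is invertible.
  obtain ⟨S, hS, hSo, hpS⟩ := mem_nhds_iff.1 ((hbase.and hMe).and hunit)
  let e : ∀ q, F →ₗ[K] V (f q) := fun q =>
    (trivializationAt F V (f p)).symmₗ K (f q) ∘ₗ (Y q : F →ₗ[K] F)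
  have he : ∀ q ∈ S, ∀ w, e q w = ofCoord V (f p) (f q) (Y q w) := fun q hq w =>
    Trivialization.symmₗ_apply _ (hS hq).1.1 _
  have hco : ∀ q ∈ S, ∀ w, coord F (f p) (e q w) = Y q w := fun q hq w => by
    rw [he q hq, coord_ofCoord (hS hq).1.1]
  have hcoe : ∀ q ∈ S, ∀ w, (fun q => coord F (f p) (e q w)) =ᶠ[nhds q] fun q => Y q w :=
    fun q hq w => Filter.eventually_of_mem (hSo.mem_nhds hq) fun r hr => hco r hr w
  have hYw : ∀ w, ContDiff ℝ ∞ fun q => Y q w := fun w => contDiff_iff_contDiffAt.2 fun q =>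
    contDiffAt_clm_apply hY.contDiffAt contDiffAt_const
  have hsm : ∀ q ∈ S, ∀ w, ContMDiffAt 𝓘(ℝ, A × ℝ) (𝓘(ℝ, E).prod 𝓘(ℝ, F)) ∞
      (fun q => (⟨f q, e q w⟩ : TotalSpace F V)) q := fun q hq w =>
    (contMDiffAt_along_iff hf.contMDiffAt (hS hq).1.1).2
      ((hYw w).contDiffAt.congr_of_eventuallyEq (hcoe q hq w))
  refine ⟨S, hSo, hpS, e, fun q hq => ?_, hsm, fun q hq w => ?_⟩
  · have h1 := ContinuousLinearMap.isUnit_iff_bijective.1 (hS hq).2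
    have h2 : (e q : F → V (f q)) = (coordEquiv K F V (hS hq).1.1).symm ∘ Y q :=
      funext fun w => he q hq w
    rw [h2]
    exact (LinearEquiv.bijective _).comp h1
  · refine coord_injective (hS hq).1.1 ?_
    have h0 : coord F (f p) (0 : V (f q)) = 0 := map_zero (coordEquiv K F V (hS hq).1.1)
    rw [coord_covAlong hK ((hsm q hq w).mdifferentiableAt (by simp)) (hS hq).1.1,
      (hcoe q hq w).fderiv_eq, hco q hq, h0,
      fderiv_clm_apply_apply (hY.contDiffAt.differentiableAt (by simp))
        (differentiableAt_const w), hY', (hS hq).1.2]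
    simp [negComp]

theorem IsFrameOn.of_locally {B : Type*} [NormedAddCommGroup B] [NormedSpace ℝ B] {f : B → X}
    {d : B} {e : ∀ q, F →ₗ[K] V (f q)} {S : Set B}
    (h : ∀ q ∈ S, ∃ (e' : ∀ q, F →ₗ[K] V (f q)) (S' : Set B), q ∈ S' ∧ IsFrameOn cov f d e' S' ∧
      ∀ᶠ r in nhds q, e r = e' r) : IsFrameOn cov f d e S := by
  refine ⟨fun q hq => ?_, fun q hq w => ?_, fun q hq w => ?_⟩
  · obtain ⟨e', S', h1, h2, h3⟩ := h q hq
    rw [h3.self_of_nhds]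
    exact h2.bijective q h1
  · obtain ⟨e', S', h1, h2, h3⟩ := h q hq
    refine (h2.smooth q h1 w).congr_of_eventuallyEq (h3.mono fun r hr => ?_)
    simp only [hr]
  · obtain ⟨e', S', h1, h2, h3⟩ := h q hq
    rw [covAlong_congr (h3.mono fun r hr => by rw [hr])]
    exact h2.parallel q h1 w

theorem contMDiffAt_slice {e : ∀ q, F →ₗ[K] V (f q)} {w : F} {x : A} {b : ℝ}
    (h : ContMDiffAt 𝓘(ℝ, A × ℝ) (𝓘(ℝ, E).prod 𝓘(ℝ, F)) ∞
      (fun q => (⟨f q, e q w⟩ : TotalSpace F V)) (x, b)) :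
    ContMDiffAt 𝓘(ℝ, A) (𝓘(ℝ, E).prod 𝓘(ℝ, F)) ∞
      (fun x => (⟨f (x, b), e (x, b) w⟩ : TotalSpace F V)) x :=
  ContMDiffAt.comp x h (contDiff_prodMk_left b).contMDiff.contMDiffAt

/-- A parallel frame can be changed to one with given values at time `b`. -/
theorem IsFrameOn.change (hK : IsScalarLinear K cov) (hf : ContMDiff 𝓘(ℝ, A × ℝ) 𝓘(ℝ, E) ∞ f)
    {e : ∀ q, F →ₗ[K] V (f q)} {U : Set A} {J : Set ℝ} (hU : IsOpen U)
    (h : IsFrameOn cov f (0, 1) e (U ×ˢ J)) {b : ℝ} (hb : b ∈ J)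
    {e₀ : ∀ x, F →ₗ[K] V (f (x, b))} (hbij : ∀ x ∈ U, Function.Bijective (e₀ x))
    (hsm : ∀ x ∈ U, ∀ w, ContMDiffAt 𝓘(ℝ, A) (𝓘(ℝ, E).prod 𝓘(ℝ, F)) ∞
      (fun x => (⟨f (x, b), e₀ x w⟩ : TotalSpace F V)) x) :
    IsFrameOn cov f (0, 1) (fun q => e q ∘ₗ linv (e (q.1, b)) ∘ₗ e₀ q.1) (U ×ˢ J) := by
  have hc : ∀ x ∈ U, ∀ w, ContDiffAt ℝ ∞ (fun x => linv (e (x, b)) (e₀ x w)) x :=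
    fun x hx w => by
      have hev : ∀ᶠ y in nhds x, y ∈ U := hU.mem_nhds hx
      exact contDiffAt_of_frame_apply (f := fun x => f (x, b)) (e := fun x => e (x, b))
        (hf.comp (contDiff_prodMk_left b).contMDiff).contMDiffAt
        (fun w => contMDiffAt_slice (h.smooth (x, b) ⟨hx, hb⟩ w))
        (hev.mono fun y hy => h.bijective (y, b) ⟨hy, hb⟩) (hsm x hx w)
        (hev.mono fun y hy => apply_linv (h.bijective (y, b) ⟨hy, hb⟩) _)
  have hc' : ∀ q ∈ U ×ˢ J, ∀ w, ContDiffAt ℝ ∞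
      (fun q : A × ℝ => linv (e (q.1, b)) (e₀ q.1 w)) q := fun q hq w =>
    ContDiffAt.comp q (hc q.1 hq.1 w) contDiffAt_fst
  refine ⟨fun q hq => ?_, fun q hq w => ?_, fun q hq w => ?_⟩
  · exact (h.bijective q hq).comp
      ((bijective_linv (h.bijective (q.1, b) ⟨hq.1, hb⟩)).comp (hbij q.1 hq.1))
  · exact contMDiffAt_frame_apply hf.contMDiffAt (h.smooth q hq) (hc' q hq w)
  · refine (covAlong_frame_apply hK hf.contMDiffAt (h.smooth q hq) (hc' q hq w) _).trans ?_
    rw [h.parallel q hq, add_zero]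
    -- The new coefficients depend on `q.1` only, so their derivative in the direction of time
    -- vanishes.
    have h1 := (HasFDerivAt.comp q ((hc q.1 hq.1 w).differentiableAt (by simp)).hasFDerivAt
      hasFDerivAt_fst).fderiv
    have h2 : fderiv ℝ (fun q : A × ℝ => linv (e (q.1, b)) (e₀ q.1 w)) q = _ := h1
    rw [h2]
    simp

/-- Existence of a parallel frame along `f` over a neighbourhood of `{x₀} × [a, b]`. -/
def HasFrame (K : Type*) [RCLike K] [NormedSpace K F] [∀ x, Module K (V x)]
    (cov : CovariantDerivative 𝓘(ℝ, E) F V) (f : A × ℝ → X) (x₀ : A) (a b : ℝ) : Prop :=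
  ∃ (U : Set A) (J : Set ℝ) (e : ∀ q, F →ₗ[K] V (f q)), IsOpen U ∧ x₀ ∈ U ∧ IsOpen J ∧
    Set.Icc a b ⊆ J ∧ IsFrameOn cov f (0, 1) e (U ×ˢ J)

/-- The second frame is changed so that it agrees with the first at time `b`. Parallel sections are
determined by one value, so both agree around time `b` and together form one smooth frame. -/
theorem HasFrame.glue (hK : IsScalarLinear K cov) (hf : ContMDiff 𝓘(ℝ, A × ℝ) 𝓘(ℝ, E) ∞ f)
    {x₀ : A} {a b c : ℝ} (hab : a ≤ b) (hbc : b ≤ c) (h1 : HasFrame K cov f x₀ a b)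
    (h2 : HasFrame K cov f x₀ b c) : HasFrame K cov f x₀ a c := by
  obtain ⟨U₁, J₁, e₁, hU₁, hx₁, hJ₁, hJab, h₁⟩ := h1
  obtain ⟨U₂, J₂, e₂, hU₂, hx₂, hJ₂, hJbc, h₂⟩ := h2
  have hb₁ : b ∈ J₁ := hJab ⟨hab, le_rfl⟩
  have hb₂ : b ∈ J₂ := hJbc ⟨le_rfl, hbc⟩
  obtain ⟨δ, hδ, hball⟩ := Metric.mem_nhds_iff.1
    (Filter.inter_mem (hJ₁.mem_nhds hb₁) (hJ₂.mem_nhds hb₂))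
  have hU : IsOpen (U₁ ∩ U₂) := hU₁.inter hU₂
  have h₁' : IsFrameOn cov f (0, 1) e₁ ((U₁ ∩ U₂) ×ˢ J₁) :=
    h₁.mono (Set.prod_mono Set.inter_subset_left subset_rfl)
  have h₂' : IsFrameOn cov f (0, 1) e₂ ((U₁ ∩ U₂) ×ˢ J₂) :=
    h₂.mono (Set.prod_mono Set.inter_subset_right subset_rfl)
  have h₃ := h₂'.change hK hf hU hb₂ (e₀ := fun x => e₁ (x, b))
    (fun x hx => h₁'.bijective (x, b) ⟨hx, hb₁⟩)
    (fun x hx w => contMDiffAt_slice (h₁'.smooth (x, b) ⟨hx, hb₁⟩ w))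
  set e₃ : ∀ q, F →ₗ[K] V (f q) := fun q => e₂ q ∘ₗ linv (e₂ (q.1, b)) ∘ₗ e₁ (q.1, b)
  have hagree : ∀ q : A × ℝ, q.1 ∈ U₁ ∩ U₂ → q.2 ∈ Metric.ball b δ → e₃ q = e₁ q := by
    rintro ⟨x, t⟩ hx ht
    have hsub : Set.uIcc b t ⊆ Metric.ball b δ :=
      (convex_ball b δ).ordConnected.uIcc_subset (Metric.mem_ball_self hδ) ht
    ext w
    have hS : IsOpen {t | (x, t) ∈ (U₁ ∩ U₂) ×ˢ J₂} :=
      (hU.prod hJ₂).preimage (by fun_prop)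
    have hr := h₁'.restrict hK x
    have := (h₂'.restrict hK x).linv_eq hK
      (hf.comp (contDiff_prodMk_right x).contMDiff) hS (s := fun t => e₁ (x, t) w)
      (fun r hr => ⟨hx, (hball (hsub hr)).2⟩)
      (fun r hr' => hr.smooth r ⟨hx, (hball (hsub hr')).1⟩ w)
      (fun r hr' => hr.parallel r ⟨hx, (hball (hsub hr')).1⟩ w)
    change e₂ (x, t) (linv (e₂ (x, b)) (e₁ (x, b) w)) = _
    rw [this]
    exact apply_linv (h₂'.bijective (x, t) ⟨hx, (hball ht).2⟩) _
  -- Strictly before `b` the first frame is used and strictly after `b` the changed second one; on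
  -- the ball around `b` both exist and coincide, so the switch at `b` is invisible.
  refine ⟨U₁ ∩ U₂, J₁ ∩ Set.Iio b ∪ Metric.ball b δ ∪ J₂ ∩ Set.Ioi b,
    fun q => if q.2 < b then e₁ q else e₃ q, hU, ⟨hx₁, hx₂⟩,
    ((hJ₁.inter isOpen_Iio).union Metric.isOpen_ball).union (hJ₂.inter isOpen_Ioi), ?_, ?_⟩
  · intro t ht
    rcases lt_trichotomy t b with h | h | h
    · exact Or.inl (Or.inl ⟨hJab ⟨ht.1, h.le⟩, h⟩)
    · exact Or.inl (Or.inr (h ▸ Metric.mem_ball_self hδ))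
    · exact Or.inr ⟨hJbc ⟨h.le, ht.2⟩, h⟩
  · refine IsFrameOn.of_locally fun q hq => ?_
    rcases hq with ⟨hx, (ht | ht) | ht⟩
    · refine ⟨e₁, (U₁ ∩ U₂) ×ˢ J₁, ⟨hx, ht.1⟩, h₁', ?_⟩
      filter_upwards [(isOpen_Iio.preimage continuous_snd).mem_nhds ht.2] with r hr
      exact if_pos hr
    · refine ⟨e₁, (U₁ ∩ U₂) ×ˢ J₁, ⟨hx, (hball ht).1⟩, h₁', ?_⟩
      filter_upwards [(hU.preimage continuous_fst).mem_nhds hx,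
        (Metric.isOpen_ball.preimage continuous_snd).mem_nhds ht] with r hr hr'
      split_ifs
      · rfl
      · exact hagree r hr hr'
    · refine ⟨e₃, (U₁ ∩ U₂) ×ˢ J₂, ⟨hx, ht.1⟩, h₃, ?_⟩
      filter_upwards [(isOpen_Ioi.preimage continuous_snd).mem_nhds ht.2] with r hr
      exact if_neg (not_lt.2 (le_of_lt hr))

/-- By compactness `[a, b]` has a finite subdivision into pieces carrying local frames. Gluing
shrinks the neighbourhood of `x₀` only finitely often. -/
theorem hasFrame (hcov : CovariantDerivative.ContMDiffCovariantDerivative cov ∞)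
    (hK : IsScalarLinear K cov) (hf : ContMDiff 𝓘(ℝ, A × ℝ) 𝓘(ℝ, E) ∞ f) (x₀ : A) {a b : ℝ}
    (hab : a ≤ b) : HasFrame K cov f x₀ a b := by
  have hloc : ∀ t : ℝ, ∃ (U : Set A) (J : Set ℝ) (e : ∀ q, F →ₗ[K] V (f q)), IsOpen U ∧ x₀ ∈ U ∧
      IsOpen J ∧ t ∈ J ∧ IsFrameOn cov f (0, 1) e (U ×ˢ J) := fun t => by
    obtain ⟨S, hS, hp, e, he⟩ := exists_local_frame hcov hK hf (x₀, t)
    obtain ⟨U, J, hU, hx, hJ, ht, hsub⟩ := mem_nhds_prod_iff'.1 (hS.mem_nhds hp)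
    exact ⟨U, J, e, hU, hx, hJ, ht, he.mono hsub⟩
  choose U J e hU hx hJ ht he using hloc
  obtain ⟨t, ht0, hmono, ⟨m, hm⟩, hsub⟩ := exists_monotone_Icc_subset_open_cover_Icc hab
    (c := fun i : ℝ => Subtype.val ⁻¹' J i) (fun i => (hJ i).preimage continuous_subtype_val)
    (fun s _ => Set.mem_iUnion.2 ⟨s, ht s⟩)
  have hn : ∀ n, HasFrame K cov f x₀ a (t n) := fun n => by
    induction n with
    | zero =>
      refine ⟨U a, J a, e a, hU a, hx a, hJ a, ?_, he a⟩
      rw [ht0, Set.Icc_self]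
      exact Set.singleton_subset_iff.2 (ht a)
    | succ n ih =>
      refine ih.glue hK hf (t n).2.1 (hmono (Nat.le_succ n)) ?_
      obtain ⟨i, hi⟩ := hsub n
      refine ⟨U i, J i, e i, hU i, hx i, hJ i, fun s hs => ?_, he i⟩
      exact hi (show (⟨s, (t n).2.1.trans hs.1, hs.2.trans (t (n + 1)).2.2⟩ : Set.Icc a b) ∈ _
        from ⟨hs.1, hs.2⟩)
  have := hn m
  rwa [hm m le_rfl] at this

end

end Frames

/-! ### Parallel transport and temporal frames -/

section Transport

variable {K : Type*} [RCLike K]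
    {E : Type*} [NormedAddCommGroup E] [NormedSpace ℝ E] [FiniteDimensional ℝ E]
    {X : Type*} [TopologicalSpace X] [T2Space X] [ChartedSpace E X] [IsManifold 𝓘(ℝ, E) ∞ X]
    {F : Type*} [NormedAddCommGroup F] [NormedSpace ℝ F] [FiniteDimensional ℝ F]
    [NormedSpace K F] [IsScalarTower ℝ K F] [FiniteDimensional K F]
    {V : X → Type*} [TopologicalSpace (TotalSpace F V)]
    [∀ x, AddCommGroup (V x)] [∀ x, Module ℝ (V x)] [∀ x, Module K (V x)]
    [∀ x, TopologicalSpace (V x)]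
    [∀ x, IsTopologicalAddGroup (V x)] [∀ x, ContinuousSMul ℝ (V x)]
    [FiberBundle F V] [VectorBundle ℝ F V] [VectorBundle K F V]
    [ContMDiffVectorBundle ∞ F V 𝓘(ℝ, E)]
    {cov : CovariantDerivative 𝓘(ℝ, E) F V}

/-- A parallel section has constant coordinates in a parallel frame. This gives uniqueness of the
transport as well as its matrix in any such frame. -/
theorem IsParallelTransport.eq_frame {γ : ℝ → X} (hK : IsScalarLinear K cov)
    (hγ : ContMDiff 𝓘(ℝ, ℝ) 𝓘(ℝ, E) ∞ γ) {P : ∀ s t : ℝ, V (γ s) →ₗ[K] V (γ t)}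
    (hP : IsParallelTransport cov γ P) {e : ∀ t, F →ₗ[K] V (γ t)} {S : Set ℝ}
    (he : IsFrameOn cov γ 1 e S) (hS : IsOpen S) {s t : ℝ} (hst : Set.uIcc s t ⊆ S) :
    P s t = e t ∘ₗ linv (e s) := by
  ext w
  have h := he.linv_eq hK hγ hS (s := fun t => P s t w) hst (fun r _ => hP.smooth s w r)
    (fun r _ => hP.parallel s w r)
  rw [hP.refl, LinearMap.id_apply] at h
  change _ = e t (linv (e s) w)
  rw [h]
  exact (apply_linv (he.bijective t (hst Set.right_mem_uIcc)) _).symm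

/-- A single curve is regarded as a family that does not depend on its parameter. -/
theorem exists_frame_curve (hcov : CovariantDerivative.ContMDiffCovariantDerivative cov ∞)
    (hK : IsScalarLinear K cov) {γ : ℝ → X} (hγ : ContMDiff 𝓘(ℝ, ℝ) 𝓘(ℝ, E) ∞ γ) (R : ℝ) :
    ∃ (S : Set ℝ) (e : ∀ t, F →ₗ[K] V (γ t)), IsOpen S ∧ Set.Icc (-|R|) |R| ⊆ S ∧
      IsFrameOn cov γ 1 e S := by
  obtain ⟨U, J, e, -, hx, hJ, hsub, he⟩ := hasFrame (A := ℝ) (f := fun q => γ q.2) (F := F)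
    hcov hK (hγ.comp contDiff_snd.contMDiff) 0
    (neg_le_self (abs_nonneg R))
  refine ⟨J, fun t => e (0, t), hJ, hsub, (he.restrict hK 0).mono fun t ht => ⟨hx, ht⟩⟩

/-- Frames exist over each bounded interval; the transports they define do not depend on the
interval, so they fit together for all times. -/
theorem exists_isParallelTransport
    (hcov : CovariantDerivative.ContMDiffCovariantDerivative cov ∞)
    (hK : IsScalarLinear K cov) {γ : ℝ → X} (hγ : ContMDiff 𝓘(ℝ, ℝ) 𝓘(ℝ, E) ∞ γ) :
    ∃ P : ∀ s t : ℝ, V (γ s) →ₗ[K] V (γ t), IsParallelTransport cov γ P := by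
  have hex := fun R : ℝ => exists_frame_curve (F := F) hcov hK hγ R
  choose S e hSo hS he using hex
  have hmem : ∀ {R r s t : ℝ}, |s| ≤ |R| → |t| ≤ |R| → r ∈ Set.uIcc s t → r ∈ S R := by
    intro R r s t hs ht hr
    refine hS R ?_
    have h1 := abs_le.1 hs
    have h2 := abs_le.1 ht
    exact (Set.ordConnected_Icc (a := -|R|) (b := |R|)).uIcc_subset ⟨h1.1, h1.2⟩ ⟨h2.1, h2.2⟩ hr
  have hindep : ∀ {R R' s t : ℝ}, |s| ≤ |R| → |t| ≤ |R| → |s| ≤ |R'| → |t| ≤ |R'| → ∀ w,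
      e R t (linv (e R s) w) = e R' t (linv (e R' s) w) := by
    intro R R' s t h1 h2 h3 h4 w
    have hs : s ∈ S R := hmem h1 h2 Set.left_mem_uIcc
    have h := (he R').linv_eq hK hγ (hSo R') (a := s) (b := t)
      (s := fun t => e R t (linv (e R s) w)) (fun r hr => hmem h3 h4 hr)
      (fun r hr => (he R).smooth r (hmem h1 h2 hr) _)
      (fun r hr => (he R).parallel r (hmem h1 h2 hr) _)
    rw [apply_linv ((he R).bijective s hs)] at h
    rw [h]
    exact (apply_linv ((he R').bijective t (hmem h3 h4 Set.right_mem_uIcc)) _).symm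
  have hle : ∀ a : ℝ, ∀ b : ℝ, |a| ≤ |(|a| + |b|)| ∧ |b| ≤ |(|a| + |b|)| := fun a b => by
    rw [abs_of_nonneg (a := |a| + |b|) (by positivity)]
    exact ⟨le_add_of_nonneg_right (abs_nonneg b), le_add_of_nonneg_left (abs_nonneg a)⟩
  -- The radius `|s| + |t|` is merely one whose interval contains both times; `hindep` allows any
  -- larger one.
  let P : ∀ s t : ℝ, V (γ s) →ₗ[K] V (γ t) := fun s t =>
    e (|s| + |t|) t ∘ₗ linv (e (|s| + |t|) s)
  have hP : ∀ {R s t : ℝ} (w), |s| ≤ |R| → |t| ≤ |R| → P s t w = e R t (linv (e R s) w) :=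
    fun {R s t} w h1 h2 => hindep (hle s t).1 (hle s t).2 h1 h2 w
  have hev : ∀ s t w, ∃ R : ℝ, t ∈ S R ∧
      ∀ᶠ r in nhds t, P s r w = e R r (linv (e R s) w) := fun s t w => by
    -- The extra `1` lets one fixed frame compute the transport for all times near `t`.
    refine ⟨|s| + (|t| + 1), ?_, ?_⟩
    · refine hmem (s := t) (t := t) ?_ ?_ Set.left_mem_uIcc <;>
      · rw [abs_of_nonneg (a := |s| + (|t| + 1)) (by positivity)]
        have := abs_nonneg s
        linarith
    · have hc : ∀ᶠ r in nhds t, |r| < |t| + 1 :=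
        (continuous_abs.tendsto t).eventually_lt_const (lt_add_one _)
      filter_upwards [hc] with r hr
      refine hP w ?_ ?_ <;>
      · rw [abs_of_nonneg (a := |s| + (|t| + 1)) (by positivity)]
        have h1 := abs_nonneg s
        have h2 := abs_nonneg t
        linarith
  refine ⟨P, fun s => ?_, fun s w t => ?_, fun s w t => ?_⟩
  · ext w
    exact apply_linv ((he _).bijective s (hmem (hle s s).1 (hle s s).1 Set.left_mem_uIcc)) _
  · obtain ⟨R, hR, h⟩ := hev s t w
    refine ((he R).smooth t hR (linv (e R s) w)).congr_of_eventuallyEq (h.mono fun r hr => ?_)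
    simp only [hr]
  · obtain ⟨R, hR, h⟩ := hev s t w
    rw [covDerivAlong_eq, covAlong_congr h]
    exact (he R).parallel t hR _

theorem isParallelTransport_parallelTransport
    (hcov : CovariantDerivative.ContMDiffCovariantDerivative cov ∞)
    (hK : IsScalarLinear K cov) {γ : ℝ → X} (hγ : ContMDiff 𝓘(ℝ, ℝ) 𝓘(ℝ, E) ∞ γ) :
    IsParallelTransport cov γ (parallelTransport K cov γ) := by
  have h := exists_isParallelTransport (K := K) (F := F) hcov hK hγ
  rw [parallelTransport, dif_pos h]
  exact h.choose_spec

theorem parallelTransport_eq_frame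
    (hcov : CovariantDerivative.ContMDiffCovariantDerivative cov ∞)
    (hK : IsScalarLinear K cov) {γ : ℝ → X} (hγ : ContMDiff 𝓘(ℝ, ℝ) 𝓘(ℝ, E) ∞ γ)
    {e : ∀ t, F →ₗ[K] V (γ t)} {S : Set ℝ}
    (he : IsFrameOn cov γ 1 e S) (hS : IsOpen S) {s t : ℝ} (hst : Set.uIcc s t ⊆ S) :
    parallelTransport K cov γ s t = e t ∘ₗ linv (e s) :=
  (isParallelTransport_parallelTransport hcov hK hγ).eq_frame hK hγ he hS hst

variable {A : Type} [NormedAddCommGroup A] [NormedSpace ℝ A] [FiniteDimensional ℝ A]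

/-- Parallel transport in time of a smooth frame at time `0` is a parallel frame. -/
theorem isFrameOn_parallelTransport
    (hcov : CovariantDerivative.ContMDiffCovariantDerivative cov ∞)
    (hK : IsScalarLinear K cov) {f : A × ℝ → X} (hf : ContMDiff 𝓘(ℝ, A × ℝ) 𝓘(ℝ, E) ∞ f)
    {e₀ : ∀ x, F →ₗ[K] V (f (x, 0))} (hbij : ∀ x, Function.Bijective (e₀ x))
    (hsm : ∀ x w, ContMDiffAt 𝓘(ℝ, A) (𝓘(ℝ, E).prod 𝓘(ℝ, F)) ∞
      (fun x => (⟨f (x, 0), e₀ x w⟩ : TotalSpace F V)) x) :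
    IsFrameOn cov f (0, 1)
      (fun q => parallelTransport K cov (fun t => f (q.1, t)) 0 q.2 ∘ₗ e₀ q.1) Set.univ := by
  refine IsFrameOn.of_locally fun q _ => ?_
  -- The interval is enlarged by `1` on both sides, so that one frame covers the transports from `0`
  -- to all times near `q.2`.
  have hab : min 0 q.2 - 1 ≤ max 0 q.2 + 1 := by
    have := min_le_max (a := 0) (b := q.2)
    linarith
  obtain ⟨U, J, e, hU, hx, hJ, hsub, he⟩ := hasFrame (F := F) hcov hK hf q.1 hab
  have h0 : (0 : ℝ) ∈ J := hsub ⟨by linarith [min_le_left 0 q.2], by linarith [le_max_left 0 q.2]⟩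
  have h1 : q.2 ∈ J := hsub ⟨by linarith [min_le_right 0 q.2], by linarith [le_max_right 0 q.2]⟩
  refine ⟨_, U ×ˢ J, ⟨hx, h1⟩, he.change hK hf hU h0 (fun x _ => hbij x) (fun x _ => hsm x), ?_⟩
  filter_upwards [(hU.preimage continuous_fst).mem_nhds hx,
    (Metric.isOpen_ball.preimage continuous_snd).mem_nhds
      (show q.2 ∈ Metric.ball q.2 1 from Metric.mem_ball_self one_pos)] with r hr hr'
  have hIcc : Set.uIcc 0 r.2 ⊆ J := by
    refine Set.Subset.trans ?_ hsub
    have h3 := abs_lt.1 (by simpa [Real.dist_eq] using hr' : |r.2 - q.2| < 1)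
    refine Set.ordConnected_Icc.uIcc_subset
      ⟨by linarith [min_le_left 0 q.2], by linarith [le_max_left 0 q.2]⟩
      ⟨by linarith [min_le_right 0 q.2], by linarith [le_max_right 0 q.2]⟩
  have hS : IsOpen {t | (r.1, t) ∈ U ×ˢ J} := (hU.prod hJ).preimage (by fun_prop)
  rw [parallelTransport_eq_frame (γ := fun t => f (r.1, t)) hcov hK (hf.comp (contDiff_prodMk_right r.1).contMDiff)
    (he.restrict hK r.1) hS fun t ht => ⟨hr, hIcc ht⟩]
  rfl

/-- Every smooth family of curves has a global frame which is parallel along the curves. -/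
theorem exists_temporal_frame
    (hcov : CovariantDerivative.ContMDiffCovariantDerivative cov ∞)
    (hK : IsScalarLinear K cov) {f : A × ℝ → X} (hf : ContMDiff 𝓘(ℝ, A × ℝ) 𝓘(ℝ, E) ∞ f) :
    ∃ e : ∀ q, F →ₗ[K] V (f q), IsFrameOn cov f (0, 1) e Set.univ := by
  -- A frame along `x ↦ f (x, 0)` is needed to start with. It is obtained by contracting `A`
  -- radially: a fixed frame over `f (0, 0)` is transported along the rays `t ↦ f (t • x, 0)` to `t
  -- = 1`.
  have hg : ContMDiff 𝓘(ℝ, A × ℝ) 𝓘(ℝ, E) ∞ (fun q : A × ℝ => f (q.2 • q.1, 0)) :=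
    hf.comp ((contDiff_snd.smul contDiff_fst).prodMk contDiff_const).contMDiff
  have hbase : ∀ x : A, f ((0 : ℝ) • x, 0) ∈ (trivializationAt F V (f (0, 0))).baseSet :=
    fun x => by
      rw [zero_smul]
      exact coord_self_mem _
  have h1 := isFrameOn_parallelTransport (F := F) hcov hK hg
    (e₀ := fun x => (trivializationAt F V (f (0, 0))).symmₗ K (f ((0 : ℝ) • x, 0)))
    (fun x => by
      have h : ((trivializationAt F V (f (0, 0))).symmₗ K (f ((0 : ℝ) • x, 0)) : F → _) =
          (coordEquiv K F V (hbase x)).symm := funext fun w =>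
        Trivialization.symmₗ_apply _ (hbase x) _
      rw [h]
      exact LinearEquiv.bijective _)
    (fun x w => by
      refine (contMDiffAt_along_iff (hg.comp (contDiff_prodMk_left (0 : ℝ)).contMDiff).contMDiffAt
        (hbase x)).2 ?_
      refine (contDiffAt_const (c := w)).congr_of_eventuallyEq (Filter.Eventually.of_forall
        fun y => ?_)
      change coord F _ ((trivializationAt F V (f (0, 0))).symmₗ K (f ((0 : ℝ) • y, 0)) w) = w
      rw [Trivialization.symmₗ_apply _ (hbase y)]
      exact coord_ofCoord (hbase y) w)
  -- The transported frame lives over `f ((1 : ℝ) • x, 0)`. Generalizing the map avoids casting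
  -- between these fibres and those over `f (x, 0)`.
  have h2 : ∀ g : A × ℝ → X, (g = fun q => f ((1 : ℝ) • q.1, q.2)) →
      ∃ e : ∀ q, F →ₗ[K] V (g q), IsFrameOn cov g (0, 1) e Set.univ := by
    rintro g rfl
    refine ⟨_, isFrameOn_parallelTransport hcov hK
      (hf.comp ((contDiff_const.smul contDiff_fst).prodMk contDiff_snd).contMDiff)
      (e₀ := fun x => parallelTransport K cov (fun t => f (t • x, 0)) 0 1 ∘ₗ
        (trivializationAt F V (f (0, 0))).symmₗ K (f ((0 : ℝ) • x, 0)))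
      (fun x => h1.bijective (x, 1) trivial) (fun x w => ?_)⟩
    exact contMDiffAt_slice (b := (1 : ℝ)) (h1.smooth (x, 1) trivial w)
  exact h2 f (funext fun q => by rw [one_smul])

end Transport

/-! ### Antisymmetrization -/

section Perm

open Equiv

variable {n : ℕ}

/-- The permutation with `0 ↦ i` and `j + 1 ↦ i.succAbove (σ j)`. -/
def consPerm (i : Fin (n + 1)) (σ : Perm (Fin n)) : Perm (Fin (n + 1)) :=
  i.cycleRange.symm * Perm.decomposeFin.symm (0, σ)

theorem consPerm_zero (i : Fin (n + 1)) (σ : Perm (Fin n)) : consPerm i σ 0 = i := by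
  simp [consPerm]

theorem consPerm_succ (i : Fin (n + 1)) (σ : Perm (Fin n)) (j : Fin n) :
    consPerm i σ j.succ = i.succAbove (σ j) := by
  rw [consPerm, Perm.mul_apply, Perm.decomposeFin_symm_apply_succ, swap_self, refl_apply,
    Fin.cycleRange_symm_succ]

theorem sign_consPerm (i : Fin (n + 1)) (σ : Perm (Fin n)) :
    Perm.sign (consPerm i σ) = (-1) ^ (i : ℕ) * Perm.sign σ := by
  rw [consPerm, Perm.sign_mul, Perm.sign_symm, Fin.sign_cycleRange,
    Perm.decomposeFin.symm_sign, if_pos rfl, one_mul]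

theorem bijective_consPerm :
    Function.Bijective (fun p : Fin (n + 1) × Perm (Fin n) => consPerm p.1 p.2) := by
  rw [Fintype.bijective_iff_injective_and_card]
  refine ⟨?_, (Fintype.card_congr Perm.decomposeFin).symm⟩
  rintro ⟨i, σ⟩ ⟨i', σ'⟩ h
  have hi : i = i' := by
    rw [← consPerm_zero i σ, ← consPerm_zero i' σ']
    exact congrArg (fun ρ : Perm (Fin (n + 1)) => ρ 0) h
  subst hi
  have hσ : σ = σ' := Perm.ext fun j => by
    have h1 := congrArg (fun ρ : Perm (Fin (n + 1)) => ρ j.succ) h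
    simp only [consPerm_succ] at h1
    exact Fin.succAbove_right_injective h1
  rw [hσ]

variable {M : Type*} [AddCommMonoid M]

theorem sum_perm_succ (f : Perm (Fin (n + 1)) → M) :
    ∑ ρ, f ρ = ∑ i, ∑ σ, f (consPerm i σ) := by
  rw [← Fintype.sum_prod_type' (f := fun i σ => f (consPerm i σ))]
  exact (bijective_consPerm.sum_comp f).symm

variable {K : Type*} [Field K]

/-- The sign of a permutation as an element of a field. -/
def sgn (K : Type*) [Field K] {m : ℕ} (σ : Perm (Fin m)) : K := ((Perm.sign σ : ℤ) : K)

theorem sgn_mul {m : ℕ} (σ τ : Perm (Fin m)) : sgn K (σ * τ) = sgn K σ * sgn K τ := by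
  simp [sgn]

theorem sgn_inv {m : ℕ} (σ : Perm (Fin m)) : sgn K σ⁻¹ = sgn K σ := by
  simp [sgn]

theorem sgn_consPerm (i : Fin (n + 1)) (σ : Perm (Fin n)) :
    sgn K (consPerm i σ) = (-1) ^ (i : ℕ) * sgn K σ := by
  simp [sgn, sign_consPerm]

theorem sgn_cycleRange {m : ℕ} (i : Fin m) : sgn K i.cycleRange = (-1) ^ (i : ℕ) := by
  simp [sgn, Fin.sign_cycleRange]

variable {T : Type*}

/-- Permutations are sorted by their value at `0`. This merges the alternating sum of an exterior
derivative with the antisymmetrization of the form into one sum. -/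
theorem sum_antisymm_first (h : T → (Fin n → T) → K) (v : Fin (n + 1) → T) :
    ∑ i : Fin (n + 1), (-1 : K) ^ (i : ℕ) *
      ∑ σ : Perm (Fin n), sgn K σ * h (v i) (fun j => v (i.succAbove (σ j))) =
    ∑ κ : Perm (Fin (n + 1)), sgn K κ * h (v (κ 0)) (fun j => v (κ j.succ)) := by
  rw [sum_perm_succ]
  refine Finset.sum_congr rfl fun i _ => ?_
  rw [Finset.mul_sum]
  refine Finset.sum_congr rfl fun σ _ => ?_
  simp only [sgn_consPerm, consPerm_zero, consPerm_succ, mul_assoc]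

/-- Permutations are sorted by the position `k` at which the distinguished vector lands; passing to
inverses turns positions into values, to which `sum_perm_succ` applies. -/
theorem sum_antisymm_insert (m : (Fin (n + 1) → T) → K) (X : T) (v : Fin n → T) :
    ∑ ρ : Perm (Fin (n + 1)), sgn K ρ * m (fun j => (Fin.cons X v : Fin (n + 1) → T) (ρ j)) =
    ∑ k : Fin (n + 1), (-1 : K) ^ (k : ℕ) *
      ∑ κ : Perm (Fin n), sgn K κ * m (Fin.insertNth k X (fun j => v (κ j))) := by
  rw [← Equiv.sum_comp (Equiv.inv (Perm (Fin (n + 1)))), sum_perm_succ]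
  refine Finset.sum_congr rfl fun k _ => ?_
  rw [Finset.mul_sum, ← Equiv.sum_comp (Equiv.inv (Perm (Fin n)))]
  refine Finset.sum_congr rfl fun σ _ => ?_
  simp only [Equiv.inv_apply, sgn_inv, sgn_consPerm, mul_assoc]
  congr 3
  symm
  rw [Fin.insertNth_eq_iff]
  refine ⟨?_, funext fun j => ?_⟩
  · have h : (consPerm k σ⁻¹)⁻¹ k = 0 := by
      rw [Perm.inv_eq_iff_eq, consPerm_zero]
    rw [h, Fin.cons_zero]
  · have h : (consPerm k σ⁻¹)⁻¹ (k.succAbove j) = (σ j).succ := by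
      rw [Perm.inv_eq_iff_eq, consPerm_succ]
      simp
    rw [Fin.removeNth, h, Fin.cons_succ]

theorem sum_perm_mul_right {m : ℕ} (c : Perm (Fin m)) (f : Perm (Fin m) → M) :
    ∑ κ, f (κ * c) = ∑ κ, f κ :=
  Equiv.sum_comp (Equiv.mulRight c) f

/-- An antisymmetrized sum vanishes if its cyclic sums over three indices do. -/
theorem sum_antisymm_cyclic [CharZero K] {m : ℕ} {a b c : Fin m} (hab : a ≠ b) (hac : a ≠ c)
    (hbc : b ≠ c) (g : Perm (Fin m) → T → T → T → K) (v : Fin m → T)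
    (hg : ∀ κ κ' : Perm (Fin m), (∀ i, i ≠ a → i ≠ b → i ≠ c → κ i = κ' i) → g κ = g κ')
    (hcyc : ∀ κ x y z, g κ x y z + g κ y z x + g κ z x y = 0) :
    ∑ κ, sgn K κ * g κ (v (κ a)) (v (κ b)) (v (κ c)) = 0 := by
  -- An even three-cycle. Reindexing by `s` and `s * s` produces the other two cyclic terms with the
  -- same sign, so three times the sum vanishes.
  let s : Perm (Fin m) := swap a b * swap b c
  have hsa : s a = b := by simp [s, swap_apply_of_ne_of_ne hab hac]
  have hsb : s b = c := by simp [s, swap_apply_of_ne_of_ne hac.symm hbc.symm]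
  have hsc : s c = a := by simp [s]
  have hs : ∀ i, i ≠ a → i ≠ b → i ≠ c → s i = i := fun i h1 h2 h3 => by
    simp [s, swap_apply_of_ne_of_ne h2 h3, swap_apply_of_ne_of_ne h1 h2]
  have hsgn : sgn K s = 1 := by simp [s, sgn, Perm.sign_swap hab, Perm.sign_swap hbc]
  have h1 := sum_perm_mul_right s fun κ => sgn K κ * g κ (v (κ a)) (v (κ b)) (v (κ c))
  have h2 := sum_perm_mul_right (s * s) fun κ => sgn K κ * g κ (v (κ a)) (v (κ b)) (v (κ c))
  simp only [sgn_mul, hsgn, mul_one, Perm.mul_apply, hsa, hsb, hsc] at h1 h2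
  have e1 : ∀ κ, g (κ * s) = g κ := fun κ => hg _ _ fun i h1 h2 h3 => by
    rw [Perm.mul_apply, hs i h1 h2 h3]
  have e2 : ∀ κ, g (κ * (s * s)) = g κ := fun κ => by
    rw [← mul_assoc, e1, e1]
  simp only [e1] at h1
  simp only [e2] at h2
  have h3 : (3 : K) * ∑ κ, sgn K κ * g κ (v (κ a)) (v (κ b)) (v (κ c)) = 0 := by
    have : ∑ κ, sgn K κ * (g κ (v (κ a)) (v (κ b)) (v (κ c)) + g κ (v (κ b)) (v (κ c)) (v (κ a)) +
        g κ (v (κ c)) (v (κ a)) (v (κ b))) = 0 :=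
      Finset.sum_eq_zero fun κ _ => by rw [hcyc, mul_zero]
    simp only [mul_add, Finset.sum_add_distrib] at this
    rw [h1, h2] at this
    linear_combination this
  simpa using h3

end Perm

/-! ### Ordered products -/

section OrderedProd

variable {R : Type*} [Ring R]

/-- The product `w 0 * w 1 * ⋯`. -/
def oprod {n : ℕ} (w : Fin n → R) : R := (List.ofFn w).prod

theorem oprod_cons {n : ℕ} (a : R) (w : Fin n → R) :
    oprod (Fin.cons a w : Fin (n + 1) → R) = a * oprod w := by
  simp [oprod, List.ofFn_succ]

theorem oprod_insertNth_zero {n : ℕ} (a : R) (w : Fin n → R) :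
    oprod (Fin.insertNth 0 a w : Fin (n + 1) → R) = a * oprod w := by
  rw [Fin.insertNth_zero', oprod_cons]

theorem oprod_insertNth_last {n : ℕ} (a : R) (w : Fin n → R) :
    oprod (Fin.insertNth (Fin.last n) a w : Fin (n + 1) → R) = oprod w * a := by
  induction n with
  | zero =>
    rw [show Fin.last 0 = 0 from rfl, oprod_insertNth_zero]
    simp [oprod]
  | succ n ih =>
    rw [← Fin.cons_self_tail w, ← Fin.succ_last, Fin.insertNth_succ_cons, oprod_cons, oprod_cons,
      ih, mul_assoc]

/-- Multiplying the factor `j` from the left puts `a` into the gap before it, while multiplication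
from the right uses the gap after it. Commutators thus become differences of insertions into
neighbouring gaps. -/
theorem oprod_update_mul_left {n : ℕ} (a : R) (w : Fin n → R) (j : Fin n) :
    oprod (Function.update w j (a * w j)) = oprod (Fin.insertNth j.castSucc a w : _ → R) := by
  induction n with
  | zero => exact j.elim0
  | succ n ih =>
    rw [← Fin.cons_self_tail w]
    cases j using Fin.cases with
    | zero =>
      rw [Fin.cons_zero, Fin.update_cons_zero, Fin.castSucc_zero, oprod_insertNth_zero, oprod_cons,
        oprod_cons, mul_assoc]
    | succ j =>
      rw [Fin.cons_succ, ← Fin.cons_update, Fin.castSucc_succ, Fin.insertNth_succ_cons,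
        oprod_cons, oprod_cons, ih]

theorem oprod_update_mul_right {n : ℕ} (a : R) (w : Fin n → R) (j : Fin n) :
    oprod (Function.update w j (w j * a)) = oprod (Fin.insertNth j.succ a w : _ → R) := by
  induction n with
  | zero => exact j.elim0
  | succ n ih =>
    rw [← Fin.cons_self_tail w]
    rw [Fin.insertNth_succ_cons]
    cases j using Fin.cases with
    | zero =>
      rw [Fin.cons_zero, Fin.update_cons_zero, oprod_cons, oprod_cons, oprod_insertNth_zero,
        mul_assoc]
    | succ j =>
      rw [Fin.cons_succ, ← Fin.cons_update, oprod_cons, oprod_cons, ih]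

theorem oprod_update_add {n : ℕ} (w : Fin n → R) (j : Fin n) (a b : R) :
    oprod (Function.update w j (a + b)) =
      oprod (Function.update w j a) + oprod (Function.update w j b) :=
  (MultilinearMap.mkPiAlgebraFin ℤ n R).map_update_add w j a b

theorem oprod_update_sub {n : ℕ} (w : Fin n → R) (j : Fin n) (a b : R) :
    oprod (Function.update w j (a - b)) =
      oprod (Function.update w j a) - oprod (Function.update w j b) :=
  (MultilinearMap.mkPiAlgebraFin ℤ n R).map_update_sub w j a b

theorem oprod_insertNth_sub {n : ℕ} (w : Fin n → R) (j : Fin (n + 1)) (a b : R) :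
    oprod (Fin.insertNth j (a - b) w : _ → R) =
      oprod (Fin.insertNth j a w : _ → R) - oprod (Fin.insertNth j b w : _ → R) := by
  have h := oprod_update_sub (Fin.insertNth j a w : Fin (n + 1) → R) j a b
  simpa only [Fin.update_insertNth] using h

/-- Telescoping of a traced product with commutators. -/
theorem trace_telescope {M : Type*} [AddCommGroup M] (tr : R →+ M)
    (htr : ∀ a b, tr (a * b) = tr (b * a)) {n : ℕ} (q : R) (w : Fin n → R) (a : ℝ → R)
    (t : Fin n → ℝ) (s₁ s₀ : ℝ) :
    tr ((q * a s₁ - a s₀ * q) * oprod w) -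
      ∑ j, tr (q * oprod (Function.update w j (a (t j) * w j - w j * a (t j)))) =
    ∑ j : Fin (n + 1), tr (q * oprod (Fin.insertNth j
      (a ((Fin.cons s₁ t : Fin (n + 1) → ℝ) j) - a ((Fin.snoc t s₀ : Fin (n + 1) → ℝ) j)) w)) := by
  simp only [oprod_insertNth_sub, oprod_update_sub, mul_sub, sub_mul, map_sub,
    Finset.sum_sub_distrib, oprod_update_mul_left, oprod_update_mul_right]
  rw [Fin.sum_univ_succ (f := fun j : Fin (n + 1) => tr (q * oprod (Fin.insertNth j
      (a ((Fin.cons s₁ t : Fin (n + 1) → ℝ) j)) w))),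
    Fin.sum_univ_castSucc (f := fun j : Fin (n + 1) => tr (q * oprod (Fin.insertNth j
      (a ((Fin.snoc t s₀ : Fin (n + 1) → ℝ) j)) w)))]
  simp only [Fin.cons_zero, Fin.cons_succ, Fin.snoc_castSucc, Fin.snoc_last,
    oprod_insertNth_zero, oprod_insertNth_last]
  -- Cyclicity of the trace carries `a s₀` from the front to the last gap; after that both sides are
  -- the same signed insertions.
  rw [mul_assoc (a s₀), htr (a s₀), mul_assoc, mul_assoc]
  abel

end OrderedProd

/-! ### The simplex with decreasing coordinates -/

section Simplex

/-- The simplex `{1 ≥ t_0 ≥ t_1 ≥ ⋯ ≥ 0}`. -/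
def decSimplex (N : ℕ) : Set (Fin N → ℝ) := {t | Antitone t ∧ ∀ i, t i ∈ Set.Icc (0 : ℝ) 1}

theorem isCompact_decSimplex (N : ℕ) : IsCompact (decSimplex N) := by
  have h : IsCompact (Set.pi Set.univ fun _ : Fin N => Set.Icc (0 : ℝ) 1) :=
    isCompact_univ_pi fun _ => isCompact_Icc
  refine h.of_isClosed_subset ?_ fun t ht i _ => ht.2 i
  have hS : decSimplex N = (⋂ i, ⋂ j, ⋂ _ : i ≤ j, {t : Fin N → ℝ | t j ≤ t i}) ∩
      ⋂ i, (fun t : Fin N → ℝ => t i) ⁻¹' Set.Icc 0 1 := by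
    ext t
    simp only [decSimplex, Antitone, Set.mem_ofPred_eq, Set.mem_inter_iff, Set.mem_iInter,
      Set.mem_preimage]
  rw [hS]
  exact IsClosed.inter (isClosed_iInter fun i => isClosed_iInter fun j => isClosed_iInter fun _ =>
    isClosed_le (continuous_apply j) (continuous_apply i))
    (isClosed_iInter fun i => isClosed_Icc.preimage (continuous_apply i))

theorem measurableSet_decSimplex (N : ℕ) : MeasurableSet (decSimplex N) :=
  (isCompact_decSimplex N).measurableSet

variable {W : Type*} [NormedAddCommGroup W] [NormedSpace ℝ W]

/-- Reversing the coordinates makes later times come first, so that the transport products read from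
left to right as `oprod`. -/
theorem setIntegral_simplex {N : ℕ} (h : (Fin N → ℝ) → W) :
    ∫ τ in simplex N, h (fun j => τ j.rev) = ∫ t in decSimplex N, h t := by
  have hm := volume_measurePreserving_piCongrLeft (fun _ : Fin N => ℝ) Fin.revPerm
  have hc : ∀ τ : Fin N → ℝ,
      MeasurableEquiv.piCongrLeft (fun _ : Fin N => ℝ) Fin.revPerm τ = fun j => τ j.rev := by
    intro τ
    funext j
    have := MeasurableEquiv.piCongrLeft_apply_apply (β := fun _ : Fin N => ℝ)
      Fin.revPerm τ j.rev
    simpa using this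
  rw [← hm.setIntegral_preimage_emb (MeasurableEquiv.measurableEmbedding _) h (decSimplex N)]
  simp only [hc]
  congr 2
  ext τ
  simp only [Set.mem_preimage, hc]
  constructor
  · rintro ⟨h1, h2⟩
    exact ⟨fun i j hij => h1 (Fin.rev_le_rev.2 hij), fun i => h2 _⟩
  · rintro ⟨h1, h2⟩
    refine ⟨fun i j hij => ?_, fun i => ?_⟩
    · simpa using h1 (Fin.rev_le_rev.2 hij)
    · simpa using h2 i.rev

/-- A time inserted at position `j` ranges over the gap between its neighbours, with `1` and `0` as
the missing neighbours at the two ends. -/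
theorem insertNth_mem_decSimplex {N : ℕ} (j : Fin (N + 1)) (s : ℝ) (t : Fin N → ℝ) :
    (Fin.insertNth j s t : Fin (N + 1) → ℝ) ∈ decSimplex (N + 1) ↔ t ∈ decSimplex N ∧
      s ∈ Set.Icc ((Fin.snoc t 0 : Fin (N + 1) → ℝ) j) ((Fin.cons 1 t : Fin (N + 1) → ℝ) j) := by
  constructor
  · rintro ⟨h1, h2⟩
    refine ⟨⟨fun a b hab => ?_, fun a => ?_⟩, ?_, ?_⟩
    · simpa using h1 ((Fin.strictMono_succAbove j).monotone hab)
    · simpa using h2 (j.succAbove a)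
    · cases j using Fin.lastCases with
      | last => simpa using (h2 (Fin.last N)).1
      | cast i =>
        have := h1 (Fin.castSucc_lt_succ (i := i)).le
        rw [Fin.insertNth_apply_same, ← Fin.succAbove_castSucc_self,
          Fin.insertNth_apply_succAbove] at this
        simpa using this
    · cases j using Fin.cases with
      | zero => simpa using (h2 0).2
      | succ i =>
        have := h1 (Fin.castSucc_lt_succ (i := i)).le
        rw [Fin.insertNth_apply_same, ← Fin.succAbove_succ_self,
          Fin.insertNth_apply_succAbove] at this
        simpa using this
  · rintro ⟨⟨h1, h2⟩, h3, h4⟩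
    have hlo : ∀ i, j < j.succAbove i → t i ≤ s := fun i hi => by
      have hji : j ≤ i.castSucc := by
        by_contra hcon
        rw [Fin.succAbove_of_castSucc_lt _ _ (not_le.1 hcon)] at hi
        exact hcon hi.le
      refine le_trans ?_ h3
      cases j using Fin.lastCases with
      | last => exact absurd hji (not_le.2 (Fin.castSucc_lt_last i))
      | cast k => simpa using h1 (Fin.castSucc_le_castSucc_iff.1 hji)
    have hhi : ∀ i, j.succAbove i < j → s ≤ t i := fun i hi => by
      have hji : i.castSucc < j := by
        by_contra hcon
        rw [Fin.succAbove_of_le_castSucc _ _ (not_lt.1 hcon)] at hi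
        exact hcon (lt_trans (Fin.castSucc_lt_succ) hi)
      refine h4.trans ?_
      cases j using Fin.cases with
      | zero => exact absurd hji (by simp)
      | succ k => simpa using h1 (Fin.castSucc_lt_succ_iff.1 hji)
    refine ⟨fun a b hab => ?_, fun a => ?_⟩
    · rcases Fin.eq_self_or_eq_succAbove j a with rfl | ⟨a, rfl⟩
      · rcases Fin.eq_self_or_eq_succAbove a b with rfl | ⟨b, rfl⟩
        · exact le_rfl
        · simpa using hlo b (lt_of_le_of_ne hab (Fin.succAbove_ne _ _).symm)
      · rcases Fin.eq_self_or_eq_succAbove j b with rfl | ⟨b, rfl⟩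
        · simpa using hhi a (lt_of_le_of_ne hab (Fin.succAbove_ne _ _))
        · simpa using h1 ((Fin.strictMono_succAbove j).le_iff_le.1 hab)
    · rcases Fin.eq_self_or_eq_succAbove j a with rfl | ⟨a, rfl⟩
      · rw [Fin.insertNth_apply_same]
        refine ⟨le_trans ?_ h3, h4.trans ?_⟩
        · cases a using Fin.lastCases with
          | last => simp
          | cast k => simpa using (h2 k).1
        · cases a using Fin.cases with
          | zero => simp
          | succ k => simpa using (h2 k).2
      · simpa using h2 a

theorem snoc_le_cons_of_mem_decSimplex {N : ℕ} {t : Fin N → ℝ} (ht : t ∈ decSimplex N)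
    (j : Fin (N + 1)) :
    (Fin.snoc t 0 : Fin (N + 1) → ℝ) j ≤ (Fin.cons 1 t : Fin (N + 1) → ℝ) j := by
  cases j using Fin.cases with
  | zero =>
    rw [Fin.cons_zero]
    cases N with
    | zero => rw [show (0 : Fin 1) = Fin.last 0 from rfl, Fin.snoc_last]; exact zero_le_one
    | succ N => rw [← Fin.castSucc_zero, Fin.snoc_castSucc]; exact (ht.2 0).2
  | succ i =>
    rw [Fin.cons_succ]
    cases N with
    | zero => exact i.elim0
    | succ N =>
      cases i using Fin.lastCases with
      | last => rw [Fin.succ_last, Fin.snoc_last]; exact (ht.2 _).1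
      | cast k =>
        rw [Fin.succ_castSucc, Fin.snoc_castSucc]
        exact ht.1 (Fin.castSucc_lt_succ).le

/-- Integration over `decSimplex (N + 1)` with the coordinate `j` integrated first. -/
theorem setIntegral_decSimplex_succ {N : ℕ} (j : Fin (N + 1)) {H : (Fin (N + 1) → ℝ) → W}
    (hH : Continuous H) :
    ∫ t in decSimplex (N + 1), H t = ∫ t in decSimplex N,
      ∫ s in (Fin.snoc t 0 : Fin (N + 1) → ℝ) j..(Fin.cons 1 t : Fin (N + 1) → ℝ) j,
        H (Fin.insertNth j s t) := by
  have hm := (volume_preserving_piFinSuccAbove (fun _ : Fin (N + 1) => ℝ) j).symm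
  have hint : Integrable ((decSimplex (N + 1)).indicator H) :=
    (hH.continuousOn.integrableOn_compact (isCompact_decSimplex _)).integrable_indicator
      (measurableSet_decSimplex _)
  have hint' := (hm.integrable_comp_emb (MeasurableEquiv.measurableEmbedding _)).2 hint
  rw [← integral_indicator (measurableSet_decSimplex _), ← hm.integral_comp'
    -- Fubini for the extended integrand, with the coordinate `j` split off from the others.
    (g := (decSimplex (N + 1)).indicator H)]
  refine (integral_prod_symm _ hint').trans ?_
  rw [← integral_indicator (measurableSet_decSimplex _)]
  refine integral_congr_ae (Filter.Eventually.of_forall fun t => ?_)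
  have hval : ∀ s : ℝ, (decSimplex (N + 1)).indicator H
      ((MeasurableEquiv.piFinSuccAbove (fun _ : Fin (N + 1) => ℝ) j).symm (s, t)) =
      (decSimplex (N + 1)).indicator H (Fin.insertNth j s t) := fun s => rfl
  simp only [Function.comp_apply, hval]
  by_cases ht : t ∈ decSimplex N
  · rw [Set.indicator_of_mem ht, intervalIntegral.integral_of_le
      (snoc_le_cons_of_mem_decSimplex ht j), ← integral_Icc_eq_integral_Ioc,
      ← integral_indicator measurableSet_Icc]
    congr 1
    funext s
    simp only [Set.indicator, insertNth_mem_decSimplex, ht, true_and]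
  · rw [Set.indicator_of_notMem ht]
    simp only [Set.indicator, insertNth_mem_decSimplex, ht, false_and, if_false, integral_zero]

end Simplex

/-! ### Iterated integrals of ordered products -/

section Pairs

variable {T : Type*}

/-- The consecutive pairs `(w 0, w 1), (w 2, w 3), …` of a tuple. -/
def pairs {N : ℕ} (w : Fin (2 * N) → T) (j : Fin N) : T × T :=
  (w ⟨2 * j, by omega⟩, w ⟨2 * j + 1, by omega⟩)

theorem pairs_apply_succ {N : ℕ} (w : Fin (2 * N + 2) → T) (i : Fin (N + 1)) :
    pairs (N := N + 1) w i = (w ⟨2 * i, by omega⟩, w ⟨2 * i + 1, by omega⟩) :=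
  rfl

/-- The cycle sends `2 * j` to `0` and raises smaller indices by one. So the partner of the inserted
vector is always `u (κ 0)`, and the other pairs are formed from the tail in its original order,
whichever half of the pair `j` receives the insertion. -/
theorem pairs_insertNth {N : ℕ} (j : Fin (N + 1)) (k : Fin (2 * N + 2)) (c : T)
    (u : Fin (2 * N + 1) → T) (κ : Equiv.Perm (Fin (2 * N + 1))) (hk : (k : ℕ) = 2 * j ∨ (k : ℕ) = 2 * j + 1) (i : Fin N) :
    pairs (N := N + 1) (Fin.insertNth k c fun m => u (κ (Fin.cycleRange ⟨2 * j, by omega⟩ m)))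
      (j.succAbove i) = pairs (fun m : Fin (2 * N) => u (κ m.succ)) i := by
  have h1 : (⟨2 * (j.succAbove i : ℕ), by omega⟩ : Fin (2 * N + 2)) =
      k.succAbove ⟨2 * i + if (i : ℕ) < j then 0 else 1, by split_ifs <;> omega⟩ := by
    ext
    simp only [Fin.succAbove, Fin.lt_def, Fin.val_castSucc]
    split_ifs <;> simp <;> omega
  have h2 : (⟨2 * (j.succAbove i : ℕ) + 1, by omega⟩ : Fin (2 * N + 2)) =
      k.succAbove ⟨2 * i + 1 + if (i : ℕ) < j then 0 else 1, by split_ifs <;> omega⟩ := by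
    ext
    simp only [Fin.succAbove, Fin.lt_def, Fin.val_castSucc]
    split_ifs <;> simp <;> omega
  have h3 : Fin.cycleRange (⟨2 * j, by omega⟩ : Fin (2 * N + 1))
      ⟨2 * i + if (i : ℕ) < j then 0 else 1, by split_ifs <;> omega⟩ = ⟨2 * i + 1, by omega⟩ := by
    split_ifs with h
    · rw [Fin.cycleRange_of_lt (by simp [Fin.lt_def]; omega)]
      ext
      rw [Fin.val_add_one_of_lt (by simp [Fin.lt_def])]
      simp
    · rw [Fin.cycleRange_of_gt (by simp [Fin.lt_def]; omega)]
  have h4 : Fin.cycleRange (⟨2 * j, by omega⟩ : Fin (2 * N + 1))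
      ⟨2 * i + 1 + if (i : ℕ) < j then 0 else 1, by split_ifs <;> omega⟩ =
      ⟨2 * i + 2, by omega⟩ := by
    split_ifs with h
    · rw [Fin.cycleRange_of_lt (by simp [Fin.lt_def]; omega)]
      ext
      rw [Fin.val_add_one_of_lt (by simp [Fin.lt_def]; omega)]
    · rw [Fin.cycleRange_of_gt (by simp [Fin.lt_def]; omega)]
  rw [pairs_apply_succ, h1, h2, Fin.insertNth_apply_succAbove, Fin.insertNth_apply_succAbove,
    h3, h4]
  rfl

theorem pairs_insertNth_even {N : ℕ} (j : Fin (N + 1)) (c : T) (u : Fin (2 * N + 1) → T)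
    (κ : Equiv.Perm (Fin (2 * N + 1))) :
    pairs (N := N + 1) (Fin.insertNth (⟨2 * j, by omega⟩ : Fin (2 * N + 2)) c
      fun m => u (κ (Fin.cycleRange ⟨2 * j, by omega⟩ m))) =
      Fin.insertNth j (c, u (κ 0)) (pairs fun m : Fin (2 * N) => u (κ m.succ)) := by
  refine Fin.eq_insertNth_iff.2 ⟨?_, funext fun i => pairs_insertNth j _ c u κ (Or.inl rfl) i⟩
  have h : (⟨2 * j + 1, by omega⟩ : Fin (2 * N + 2)) =
      (⟨2 * j, by omega⟩ : Fin (2 * N + 2)).succAbove ⟨2 * j, by omega⟩ := by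
    ext
    simp [Fin.succAbove]
  rw [pairs_apply_succ, Fin.insertNth_apply_same, h, Fin.insertNth_apply_succAbove,
    Fin.cycleRange_self]

theorem pairs_insertNth_odd {N : ℕ} (j : Fin (N + 1)) (c : T) (u : Fin (2 * N + 1) → T)
    (κ : Equiv.Perm (Fin (2 * N + 1))) :
    pairs (N := N + 1) (Fin.insertNth (⟨2 * j + 1, by omega⟩ : Fin (2 * N + 2)) c
      fun m => u (κ (Fin.cycleRange ⟨2 * j, by omega⟩ m))) =
      Fin.insertNth j (u (κ 0), c) (pairs fun m : Fin (2 * N) => u (κ m.succ)) := by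
  refine Fin.eq_insertNth_iff.2 ⟨?_, funext fun i => pairs_insertNth j _ c u κ (Or.inr rfl) i⟩
  have h : (⟨2 * j, by omega⟩ : Fin (2 * N + 2)) =
      (⟨2 * j + 1, by omega⟩ : Fin (2 * N + 2)).succAbove ⟨2 * j, by omega⟩ := by
    ext
    simp [Fin.succAbove, Fin.lt_def]
  rw [pairs_apply_succ, Fin.insertNth_apply_same, h, Fin.insertNth_apply_succAbove,
    Fin.cycleRange_self]

theorem sum_even_odd {M : Type*} [AddCommMonoid M] {N : ℕ} (f : Fin (2 * N) → M) :
    ∑ k, f k = ∑ j : Fin N, (f ⟨2 * j, by omega⟩ + f ⟨2 * j + 1, by omega⟩) := by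
  induction N with
  | zero => rfl
  | succ N ih =>
    rw [Fin.sum_univ_castSucc (n := N)]
    refine (Fin.sum_univ_castSucc (n := 2 * N + 1) f).trans ?_
    rw [Fin.sum_univ_castSucc (n := 2 * N), add_assoc]
    refine congrArg₂ _ (ih fun k => f k.castSucc.castSucc) rfl

end Pairs

/-! ### Derivatives of integrals and of ordered products -/

section Deriv

theorem fderiv_setIntegral {P : Type} [NormedAddCommGroup P] [NormedSpace ℝ P]
    [FiniteDimensional ℝ P] {n : ℕ} {S : Set (Fin n → ℝ)} (hS : IsCompact S)
    {W : Type*} [NormedAddCommGroup W] [NormedSpace ℝ W] [CompleteSpace W]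
    {H : P → (Fin n → ℝ) → W} (hH : ContDiff ℝ ∞ (Function.uncurry H)) (x u : P) :
    fderiv ℝ (fun x => ∫ a in S, H x a) x u = ∫ a in S, fderiv ℝ (fun y => H y a) x u := by
  rw [(hasFDerivAt_setIntegral_of_contDiff hS (hH.of_le (by simp)) x).fderiv]
  have h : ContDiff ℝ ∞ (Function.uncurry fun (a : Fin n → ℝ) (z : P) => H z a) :=
    hH.comp (contDiff_snd.prodMk contDiff_fst)
  have hd : Continuous fun a => fderiv ℝ (fun z => H z a) x :=
    (ContDiff.fderiv (m := ∞) (n := 0) h contDiff_const (by simp)).continuous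
  exact ContinuousLinearMap.integral_apply (hd.continuousOn.integrableOn_compact hS) u

variable {B : Type*} [NormedAddCommGroup B] [NormedSpace ℝ B]
  {G : Type*} [NormedRing G] [NormedAlgebra ℝ G]

theorem contDiff_oprod {n : ℕ} {w : Fin n → B → G} (hw : ∀ j, ContDiff ℝ ∞ (w j)) :
    ContDiff ℝ ∞ fun y => oprod fun j => w j y := by
  induction n with
  | zero => simpa [oprod] using contDiff_const
  | succ n ih =>
    have h : (fun y => oprod fun j => w j y) = fun y => w 0 y * oprod fun j => w j.succ y := by
      funext y
      rw [← oprod_cons]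
      exact congrArg oprod (Fin.cons_self_tail fun j => w j y).symm
    rw [h]
    exact (hw 0).mul (ih fun j => hw j.succ)

theorem continuous_oprod {Z : Type*} [TopologicalSpace Z] {n : ℕ} {w : Fin n → Z → G}
    (hw : ∀ j, Continuous (w j)) : Continuous fun y => oprod fun j => w j y := by
  simpa only [oprod, List.ofFn_eq_map] using continuous_list_prod (List.finRange n) fun j _ => hw j

/-- The noncommutative Leibniz rule: each term differentiates one factor in its place. -/
theorem hasFDerivAt_oprod {n : ℕ} {w : Fin n → B → G} {w' : Fin n → B →L[ℝ] G} {x : B}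
    (hw : ∀ j, HasFDerivAt (w j) (w' j) x) :
    ∃ L : B →L[ℝ] G, HasFDerivAt (fun y => oprod fun j => w j y) L x ∧
      ∀ u, L u = ∑ j, oprod (Function.update (fun j => w j x) j (w' j u)) := by
  induction n with
  | zero => exact ⟨0, by simpa [oprod] using hasFDerivAt_const _ _, fun u => by simp⟩
  | succ n ih =>
    obtain ⟨L, hL, hL'⟩ := ih (w := fun j => w j.succ) fun j => hw j.succ
    have h : ∀ y, (oprod fun j => w j y) = w 0 y * oprod fun j => w j.succ y := by
      intro y
      rw [← oprod_cons]
      exact congrArg oprod (Fin.cons_self_tail fun j => w j y).symm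
    simp only [h]
    refine ⟨_, (hw 0).mul' hL, fun u => ?_⟩
    have hx : (fun j => w j x) = Fin.cons (w 0 x) fun j => w j.succ x :=
      (Fin.cons_self_tail fun j => w j x).symm
    rw [Fin.sum_univ_succ, hx, Fin.update_cons_zero, oprod_cons]
    simp only [← Fin.cons_update, oprod_cons, ← Finset.mul_sum]
    rw [← hL']
    simp [add_comm]

theorem fderiv_oprod {n : ℕ} {w : Fin n → B → G} {x : B}
    (hw : ∀ j, DifferentiableAt ℝ (w j) x) (u : B) :
    fderiv ℝ (fun y => oprod fun j => w j y) x u =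
      ∑ j, oprod (Function.update (fun j => w j x) j (fderiv ℝ (w j) x u)) := by
  obtain ⟨L, hL, hL'⟩ := hasFDerivAt_oprod fun j => (hw j).hasFDerivAt
  rw [hL.fderiv, hL']

end Deriv

/-! ### Iterated integrals of a connection in temporal gauge -/

/-- The data of a connection over `A × ℝ` without `dt`-component: the holonomy `q` of the
interval `[0, 1]`, the connection form `a` in the directions of `A`, and the curvature `curv`. -/
structure TemporalGauge (A : Type*) [NormedAddCommGroup A] [NormedSpace ℝ A]
    (G : Type*) [NormedRing G] [NormedAlgebra ℝ G] where
  /-- the holonomy -/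
  q : A → G
  /-- the connection form -/
  a : A × ℝ → A → G
  /-- the curvature -/
  curv : A × ℝ → A × ℝ → A × ℝ → G
  contDiff_q : ContDiff ℝ ∞ q
  contDiff_curv : ∀ u v, ContDiff ℝ ∞ fun p => curv p u v
  swap : ∀ p u v, curv p u v = -curv p v u
  fderiv_q : ∀ x v, fderiv ℝ q x v = q x * a (x, 1) v - a (x, 0) v * q x
  hasDerivAt_a : ∀ x v t, HasDerivAt (fun t => a (x, t) v) (curv (x, t) (0, 1) (v, 0)) t
  bianchi : ∀ x t u v w,
    (fderiv ℝ (fun y => curv (y, t) (v, 0) (w, 0)) x u +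
      (a (x, t) u * curv (x, t) (v, 0) (w, 0) - curv (x, t) (v, 0) (w, 0) * a (x, t) u)) +
    (fderiv ℝ (fun y => curv (y, t) (w, 0) (u, 0)) x v +
      (a (x, t) v * curv (x, t) (w, 0) (u, 0) - curv (x, t) (w, 0) (u, 0) * a (x, t) v)) +
    (fderiv ℝ (fun y => curv (y, t) (u, 0) (v, 0)) x w +
      (a (x, t) w * curv (x, t) (u, 0) (v, 0) - curv (x, t) (u, 0) (v, 0) * a (x, t) w)) = 0

namespace TemporalGauge

variable {K : Type*} [RCLike K] {A : Type} [NormedAddCommGroup A] [NormedSpace ℝ A]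
  [FiniteDimensional ℝ A] {G : Type*} [NormedRing G] [NormedAlgebra ℝ G]

/-- The curvatures `curv(P_j)` at the times `t_j`. -/
def factors (𝔤 : TemporalGauge A G) {N : ℕ} (P : Fin N → (A × ℝ) × (A × ℝ)) (x : A)
    (t : Fin N → ℝ) (j : Fin N) : G :=
  𝔤.curv (x, t j) (P j).1 (P j).2

/-- The integrand of the iterated integral. -/
def integrand (𝔤 : TemporalGauge A G) (tr : G →L[ℝ] K) {N : ℕ} (P : Fin N → (A × ℝ) × (A × ℝ))
    (x : A) (t : Fin N → ℝ) : K :=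
  tr (𝔤.q x * oprod (𝔤.factors P x t))

/-- The iterated integral. -/
def chen (𝔤 : TemporalGauge A G) (tr : G →L[ℝ] K) {N : ℕ} (P : Fin N → (A × ℝ) × (A × ℝ))
    (x : A) : K :=
  ∫ t in decSimplex N, 𝔤.integrand tr P x t

variable (𝔤 : TemporalGauge A G) (tr : G →L[ℝ] K) {N : ℕ} (P : Fin N → (A × ℝ) × (A × ℝ))

theorem contDiff_integrand : ContDiff ℝ ∞ (Function.uncurry (𝔤.integrand tr P)) := by
  refine tr.contDiff.comp ((𝔤.contDiff_q.comp contDiff_fst).mul ?_)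
  refine contDiff_oprod (w := fun j (z : A × (Fin N → ℝ)) => 𝔤.factors P z.1 z.2 j) fun j => ?_
  exact (𝔤.contDiff_curv _ _).comp
    (contDiff_fst.prodMk ((contDiff_apply ℝ ℝ j).comp contDiff_snd))

theorem contDiff_chen : ContDiff ℝ ∞ (𝔤.chen tr P) :=
  contDiff_setIntegral (isCompact_decSimplex N) (𝔤.contDiff_integrand tr P)

theorem continuous_curv (x : A) (u v : A × ℝ) : Continuous fun s => 𝔤.curv (x, s) u v :=
  (𝔤.contDiff_curv u v).continuous.comp (Continuous.prodMk_right x)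

theorem continuous_a (x v : A) : Continuous fun s => 𝔤.a (x, s) v :=
  continuous_iff_continuousAt.2 fun t => (𝔤.hasDerivAt_a x v t).continuousAt

/-- The derivative of the holonomy contributes the connection form at the two ends of the interval;
the remaining terms differentiate one curvature factor each. -/
theorem fderiv_integrand (x : A) (t : Fin N → ℝ) (u : A) :
    fderiv ℝ (fun y => 𝔤.integrand tr P y t) x u =
      tr ((𝔤.q x * 𝔤.a (x, 1) u - 𝔤.a (x, 0) u * 𝔤.q x) * oprod (𝔤.factors P x t)) +
      ∑ j, tr (𝔤.q x * oprod (Function.update (𝔤.factors P x t) j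
        (fderiv ℝ (fun y => 𝔤.curv (y, t j) (P j).1 (P j).2) x u))) := by
  have hcurv : ∀ j, DifferentiableAt ℝ (fun y => 𝔤.factors P y t j) x := fun j =>
    (((𝔤.contDiff_curv _ _).comp (contDiff_prodMk_left (t j))).differentiable (by simp)) x
  have hprod : DifferentiableAt ℝ (fun y => oprod (𝔤.factors P y t)) x := by
    obtain ⟨L, hL, -⟩ := hasFDerivAt_oprod fun j => (hcurv j).hasFDerivAt
    exact hL.differentiableAt
  have hq : DifferentiableAt ℝ 𝔤.q x := (𝔤.contDiff_q.differentiable (by simp)) x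
  have h := tr.hasFDerivAt.comp x (hq.hasFDerivAt.mul' hprod.hasFDerivAt)
  refine (congrArg (fun L : A →L[ℝ] K => L u) h.fderiv).trans ?_
  simp only [ContinuousLinearMap.comp_apply, add_apply, smul_apply, op_smul_eq_mul, smul_eq_mul]
  rw [map_add, 𝔤.fderiv_q, add_comm]
  refine congrArg₂ _ rfl ?_
  rw [← map_sum, ← Finset.mul_sum]
  exact congrArg (fun z => tr (𝔤.q x * z)) (fderiv_oprod hcurv u)

theorem factors_insertNth (j : Fin (N + 1)) (c : (A × ℝ) × (A × ℝ)) (x : A) (s : ℝ)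
    (t : Fin N → ℝ) :
    𝔤.factors (Fin.insertNth j c P) x (Fin.insertNth j s t) =
      Fin.insertNth j (𝔤.curv (x, s) c.1 c.2) (𝔤.factors P x t) := by
  refine Fin.eq_insertNth_iff.2 ⟨?_, funext fun i => ?_⟩
  · simp [factors]
  · simp [factors, Fin.removeNth]

/-- Insertion of an element into an ordered product, as a linear map. -/
theorem exists_insert_clm [FiniteDimensional ℝ G] (b : G) (w : Fin N → G) (j : Fin (N + 1)) :
    ∃ L : G →L[ℝ] K, ∀ z, L z = tr (b * oprod (Fin.insertNth j z w : Fin (N + 1) → G)) := by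
  let M := MultilinearMap.mkPiAlgebraFin ℝ (N + 1) G
  refine ⟨tr.comp ((LinearMap.mulLeft ℝ b).comp
    (M.toLinearMap (Fin.insertNth j 0 w : Fin (N + 1) → G) j)).toContinuousLinearMap, fun z => ?_⟩
  change tr (b * oprod (Function.update (Fin.insertNth j 0 w : Fin (N + 1) → G) j z)) = _
  rw [Fin.update_insertNth]

/-- The inserted factor is the time derivative of the connection form, so its integral over a gap is
the difference of `a` at the ends of the gap. -/
theorem integral_insertNth [FiniteDimensional ℝ G] (j : Fin (N + 1)) (x u : A) (t : Fin N → ℝ)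
    (s₀ s₁ : ℝ) :
    ∫ s in s₀..s₁, 𝔤.integrand tr (Fin.insertNth j ((0, 1), (u, 0)) P) x (Fin.insertNth j s t) =
      tr (𝔤.q x * oprod (Fin.insertNth j (𝔤.a (x, s₁) u - 𝔤.a (x, s₀) u)
        (𝔤.factors P x t))) := by
  have : CompleteSpace G := FiniteDimensional.complete ℝ G
  obtain ⟨L, hL⟩ := exists_insert_clm tr (𝔤.q x) (𝔤.factors P x t) j
  simp only [integrand, factors_insertNth, ← hL]
  have hc := 𝔤.continuous_curv x (0, 1) (u, 0)
  rw [L.intervalIntegral_comp_comm (hc.intervalIntegrable _ _),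
    intervalIntegral.integral_eq_sub_of_hasDerivAt (fun s _ => 𝔤.hasDerivAt_a x u s)
      (hc.intervalIntegrable _ _)]

theorem integrableOn_insertNth (j : Fin (N + 1)) (x u : A) :
    IntegrableOn (fun t : Fin N → ℝ => tr (𝔤.q x * oprod (Fin.insertNth j
      (𝔤.a (x, (Fin.cons 1 t : Fin (N + 1) → ℝ) j) u -
        𝔤.a (x, (Fin.snoc t 0 : Fin (N + 1) → ℝ) j) u)
        (𝔤.factors P x t)))) (decSimplex N) := by
  refine Continuous.continuousOn ?_ |>.integrableOn_compact (isCompact_decSimplex N)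
  refine tr.continuous.comp (continuous_const.mul
    (continuous_oprod (w := fun i t => (Fin.insertNth j
      (𝔤.a (x, (Fin.cons 1 t : Fin (N + 1) → ℝ) j) u -
        𝔤.a (x, (Fin.snoc t 0 : Fin (N + 1) → ℝ) j) u)
        (𝔤.factors P x t) : Fin (N + 1) → G) i) fun i => ?_))
  rcases Fin.eq_self_or_eq_succAbove j i with rfl | ⟨i, rfl⟩
  · simp only [Fin.insertNth_apply_same]
    refine ((𝔤.continuous_a x u).comp ?_).sub ((𝔤.continuous_a x u).comp ?_)
    · cases i using Fin.cases with
      | zero => exact continuous_const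
      | succ k => simpa using continuous_apply k
    · cases i using Fin.lastCases with
      | last => simpa using continuous_const
      | cast k => simpa using continuous_apply k
  · simp only [Fin.insertNth_apply_succAbove]
    exact (𝔤.continuous_curv x _ _).comp (continuous_apply i)

/-- Integrating the inserted time first collapses an (N + 1)-fold integral to an N-fold one. These
are exactly the gap terms produced by `trace_telescope`. -/
theorem chen_insertNth [FiniteDimensional ℝ G] (j : Fin (N + 1)) (x u : A) :
    𝔤.chen tr (Fin.insertNth j ((0, 1), (u, 0)) P) x = ∫ t in decSimplex N,
      tr (𝔤.q x * oprod (Fin.insertNth j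
        (𝔤.a (x, (Fin.cons 1 t : Fin (N + 1) → ℝ) j) u -
          𝔤.a (x, (Fin.snoc t 0 : Fin (N + 1) → ℝ) j) u) (𝔤.factors P x t))) := by
  rw [chen, setIntegral_decSimplex_succ j]
  · simp only [integral_insertNth]
  · exact (𝔤.contDiff_integrand tr _).continuous.comp (Continuous.prodMk_right x)

theorem chen_insertNth_swap (j : Fin (N + 1)) (x : A) (b c : A × ℝ) :
    𝔤.chen tr (Fin.insertNth j (b, c) P) x = -𝔤.chen tr (Fin.insertNth j (c, b) P) x := by
  rw [chen, chen, ← integral_neg]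
  refine integral_congr_ae (Filter.Eventually.of_forall fun t => ?_)
  have key : ∀ d : (A × ℝ) × (A × ℝ), 𝔤.factors (Fin.insertNth j d P) x t =
      Fin.insertNth j (𝔤.curv (x, t j) d.1 d.2) (𝔤.factors P x (Fin.removeNth j t)) := fun d => by
    conv_lhs => rw [← Fin.insertNth_self_removeNth j t]
    rw [factors_insertNth]
  have h0 : (0 : G) - 𝔤.curv (x, t j) c b = 𝔤.curv (x, t j) b c := by rw [zero_sub, ← 𝔤.swap]
  -- Negation in one slot is obtained from additivity as `0 - z`, which needs the product with a
  -- zero inserted to vanish.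
  have hz : oprod (Fin.insertNth j (0 : G) (𝔤.factors P x (Fin.removeNth j t)) : _ → G) = 0 := by
    have := oprod_insertNth_sub (𝔤.factors P x (Fin.removeNth j t)) j (0 : G) 0
    simpa using this
  simp only [integrand, key]
  rw [← h0, oprod_insertNth_sub, hz, zero_sub, mul_neg, map_neg]

/-- The part of the exterior derivative that vanishes by the Bianchi identity. -/
theorem sum_bianchi (x : A) (t : Fin N → ℝ) (v : Fin (2 * N + 1) → A) (j : Fin N) :
    ∑ κ : Equiv.Perm (Fin (2 * N + 1)), sgn K κ *
      tr (𝔤.q x * oprod (Function.update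
        (𝔤.factors (pairs fun m : Fin (2 * N) => ((v (κ m.succ), (0 : ℝ)))) x t) j
        (fderiv ℝ (fun y => 𝔤.curv (y, t j) (v (κ (⟨2 * j, by omega⟩ : Fin (2 * N)).succ), 0)
            (v (κ (⟨2 * j + 1, by omega⟩ : Fin (2 * N)).succ), 0)) x (v (κ 0)) +
          (𝔤.a (x, t j) (v (κ 0)) *
            𝔤.factors (pairs fun m : Fin (2 * N) => ((v (κ m.succ), (0 : ℝ)))) x t j -
          𝔤.factors (pairs fun m : Fin (2 * N) => ((v (κ m.succ), (0 : ℝ)))) x t j *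
            𝔤.a (x, t j) (v (κ 0)))))) = 0 := by
  -- The three cyclically permuted indices are the direction of differentiation and the two
  -- arguments of the factor `j`; the other factors do not involve them.
  refine sum_antisymm_cyclic (a := 0) (b := (⟨2 * j, by omega⟩ : Fin (2 * N)).succ)
    (c := (⟨2 * j + 1, by omega⟩ : Fin (2 * N)).succ) (Fin.succ_ne_zero _).symm
    (Fin.succ_ne_zero _).symm (by simp [Fin.ext_iff])
    (fun κ u₀ u₁ u₂ => tr (𝔤.q x * oprod (Function.update
        (𝔤.factors (pairs fun m : Fin (2 * N) => ((v (κ m.succ), (0 : ℝ)))) x t) j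
        (fderiv ℝ (fun y => 𝔤.curv (y, t j) (u₁, 0) (u₂, 0)) x u₀ +
          (𝔤.a (x, t j) u₀ * 𝔤.curv (x, t j) (u₁, 0) (u₂, 0) -
          𝔤.curv (x, t j) (u₁, 0) (u₂, 0) * 𝔤.a (x, t j) u₀))))) v ?_ ?_
  · intro κ κ' h
    funext u₀ u₁ u₂
    congr 3
    funext i
    rcases eq_or_ne i j with rfl | hij
    · simp
    · have hij' : (i : ℕ) ≠ j := fun h => hij (Fin.ext h)
      simp only [Function.update_of_ne hij, factors, pairs]
      rw [h _ (Fin.succ_ne_zero _) (by simp [Fin.ext_iff]; omega) (by simp [Fin.ext_iff]; omega),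
        h _ (Fin.succ_ne_zero _) (by simp [Fin.ext_iff]; omega) (by simp [Fin.ext_iff]; omega)]
  · intro κ u₀ u₁ u₂
    rw [← map_add, ← map_add, ← mul_add, ← mul_add, ← oprod_update_add, ← oprod_update_add,
      𝔤.bianchi]
    have hz := oprod_update_sub
      (𝔤.factors (pairs fun m : Fin (2 * N) => ((v (κ m.succ), (0 : ℝ)))) x t) j 0 0
    rw [sub_self, sub_self] at hz
    rw [hz, mul_zero, map_zero]

/-- By the Bianchi identity the covariant derivatives of the factors contribute nothing after
antisymmetrization. Subtracting them leaves the end terms and minus the commutators, which telescope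
into gap terms. -/
theorem sum_fderiv_integrand (htr : ∀ b c, tr (b * c) = tr (c * b)) (x : A) (t : Fin N → ℝ)
    (v : Fin (2 * N + 1) → A) :
    ∑ κ : Equiv.Perm (Fin (2 * N + 1)), sgn K κ *
      fderiv ℝ (fun y => 𝔤.integrand tr
        (pairs fun m : Fin (2 * N) => ((v (κ m.succ), (0 : ℝ)))) y t) x (v (κ 0)) =
    ∑ κ : Equiv.Perm (Fin (2 * N + 1)), sgn K κ * ∑ j : Fin (N + 1),
      tr (𝔤.q x * oprod (Fin.insertNth j
        (𝔤.a (x, (Fin.cons 1 t : Fin (N + 1) → ℝ) j) (v (κ 0)) -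
          𝔤.a (x, (Fin.snoc t 0 : Fin (N + 1) → ℝ) j) (v (κ 0)))
        (𝔤.factors (pairs fun m : Fin (2 * N) => ((v (κ m.succ), (0 : ℝ)))) x t))) := by
  have hb : ∑ κ : Equiv.Perm (Fin (2 * N + 1)), sgn K κ * ∑ j : Fin N,
      tr (𝔤.q x * oprod (Function.update
        (𝔤.factors (pairs fun m : Fin (2 * N) => ((v (κ m.succ), (0 : ℝ)))) x t) j
        (fderiv ℝ (fun y => 𝔤.curv (y, t j) (v (κ (⟨2 * j, by omega⟩ : Fin (2 * N)).succ), 0)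
            (v (κ (⟨2 * j + 1, by omega⟩ : Fin (2 * N)).succ), 0)) x (v (κ 0)) +
          (𝔤.a (x, t j) (v (κ 0)) *
            𝔤.factors (pairs fun m : Fin (2 * N) => ((v (κ m.succ), (0 : ℝ)))) x t j -
          𝔤.factors (pairs fun m : Fin (2 * N) => ((v (κ m.succ), (0 : ℝ)))) x t j *
            𝔤.a (x, t j) (v (κ 0)))))) = 0 := by
    simp only [Finset.mul_sum]
    rw [Finset.sum_comm]
    exact Finset.sum_eq_zero fun j _ => 𝔤.sum_bianchi tr x t v j
  rw [← sub_eq_zero, ← hb, ← Finset.sum_sub_distrib]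
  refine Finset.sum_congr rfl fun κ _ => ?_
  rw [← mul_sub, fderiv_integrand]
  have h := trace_telescope (tr : G →+ K) htr (𝔤.q x)
    (𝔤.factors (pairs fun m : Fin (2 * N) => ((v (κ m.succ), (0 : ℝ)))) x t)
    (fun s => 𝔤.a (x, s) (v (κ 0))) t 1 0
  simp only [AddMonoidHom.coe_coe] at h
  rw [← h]
  congr 1
  simp only [oprod_update_add, mul_add, map_add, Finset.sum_add_distrib, pairs]
  ring

/-- The integrated form of `sum_fderiv_integrand`: the signed sum must be formed under the integral,
because the Bianchi cancellation takes place at each fixed tuple of times. -/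
theorem sum_fderiv_chen [FiniteDimensional ℝ G] (htr : ∀ b c, tr (b * c) = tr (c * b)) (x : A)
    (v : Fin (2 * N + 1) → A) :
    ∑ κ : Equiv.Perm (Fin (2 * N + 1)), sgn K κ *
      fderiv ℝ (𝔤.chen tr (pairs fun m : Fin (2 * N) => ((v (κ m.succ), (0 : ℝ))))) x (v (κ 0)) =
    ∑ κ : Equiv.Perm (Fin (2 * N + 1)), sgn K κ * ∑ j : Fin (N + 1),
      𝔤.chen tr (Fin.insertNth j ((0, 1), (v (κ 0), 0))
        (pairs fun m : Fin (2 * N) => ((v (κ m.succ), (0 : ℝ))))) x := by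
  have h1 : ∀ (P : Fin N → (A × ℝ) × (A × ℝ)) (u : A), fderiv ℝ (𝔤.chen tr P) x u =
      ∫ t in decSimplex N, fderiv ℝ (fun y => 𝔤.integrand tr P y t) x u := fun P u =>
    fderiv_setIntegral (isCompact_decSimplex N) (𝔤.contDiff_integrand tr P) x u
  have hint : ∀ (P : Fin N → (A × ℝ) × (A × ℝ)) (u : A),
      IntegrableOn (fun t => fderiv ℝ (fun y => 𝔤.integrand tr P y t) x u) (decSimplex N) := by
    intro P u
    refine Continuous.continuousOn ?_ |>.integrableOn_compact (isCompact_decSimplex N)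
    have h : ContDiff ℝ ∞ (Function.uncurry fun (t : Fin N → ℝ) (y : A) =>
        𝔤.integrand tr P y t) :=
      (𝔤.contDiff_integrand tr P).comp (contDiff_snd.prodMk contDiff_fst)
    exact (ContDiff.fderiv (m := ∞) (n := 0) h contDiff_const (by simp)).continuous.clm_apply
      continuous_const
  simp only [h1, chen_insertNth]
  rw [Finset.sum_congr rfl fun κ _ => (integral_const_mul (sgn K κ) _).symm,
    ← integral_finsetSum _ fun κ _ => (hint _ _).const_mul _]
  simp only [𝔤.sum_fderiv_integrand tr htr x _ v]
  rw [integral_finsetSum _ fun κ _ => (integrable_finsetSum _ fun j _ =>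
    𝔤.integrableOn_insertNth tr _ j x _).const_mul _]
  refine Finset.sum_congr rfl fun κ _ => ?_
  rw [integral_const_mul, integral_finsetSum _ fun j _ => 𝔤.integrableOn_insertNth tr _ j x _]

/-- The time direction can enter a factor as first or as second argument. The odd position carries
the sign -1 and the antisymmetry of the curvature another one, so both contribute equally; this is
the factor 2. -/
theorem sum_chen_insert (x : A) (v : Fin (2 * N + 1) → A) :
    ∑ ρ : Equiv.Perm (Fin (2 * N + 2)), sgn K ρ * 𝔤.chen tr (pairs (N := N + 1)
      fun m : Fin (2 * N + 2) => (Fin.cons ((0 : A), (1 : ℝ)) (fun i => (v i, (0 : ℝ))) :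
        Fin (2 * N + 2) → A × ℝ) (ρ m)) x =
    2 * ∑ κ : Equiv.Perm (Fin (2 * N + 1)), sgn K κ * ∑ j : Fin (N + 1),
      𝔤.chen tr (Fin.insertNth j ((0, 1), (v (κ 0), 0))
        (pairs fun m : Fin (2 * N) => ((v (κ m.succ), (0 : ℝ))))) x := by
  have h := sum_antisymm_insert (n := 2 * N + 1) (K := K)
    (fun w => 𝔤.chen tr (pairs (N := N + 1) w) x) ((0 : A), (1 : ℝ)) fun i => (v i, (0 : ℝ))
  refine h.trans ?_
  refine (sum_even_odd (N := N + 1) _).trans ?_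
  have he : ∀ j : Fin (N + 1), (∑ κ : Equiv.Perm (Fin (2 * N + 1)), sgn K κ *
      𝔤.chen tr (pairs (N := N + 1) (Fin.insertNth (⟨2 * j, by omega⟩ : Fin (2 * N + 2))
        ((0 : A), (1 : ℝ)) fun m => (v (κ m), (0 : ℝ)))) x) =
      ∑ κ : Equiv.Perm (Fin (2 * N + 1)), sgn K κ *
        𝔤.chen tr (Fin.insertNth j ((0, 1), (v (κ 0), 0))
          (pairs fun m : Fin (2 * N) => ((v (κ m.succ), (0 : ℝ))))) x := fun j => by
    -- The reindexing cycle has sign `(-1) ^ (2 * j) = 1`, so no sign arises from bringing the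
    -- partner vector to the front.
    rw [← sum_perm_mul_right (Fin.cycleRange ⟨2 * j, by omega⟩)]
    refine Finset.sum_congr rfl fun κ _ => ?_
    have hp := pairs_insertNth_even j ((0 : A), (1 : ℝ)) (fun i => (v i, (0 : ℝ))) κ
    rw [sgn_mul, sgn_cycleRange, Even.neg_one_pow (even_two_mul _), mul_one, ← hp]
    rfl
  have ho : ∀ j : Fin (N + 1), (∑ κ : Equiv.Perm (Fin (2 * N + 1)), sgn K κ *
      𝔤.chen tr (pairs (N := N + 1) (Fin.insertNth (⟨2 * j + 1, by omega⟩ : Fin (2 * N + 2))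
        ((0 : A), (1 : ℝ)) fun m => (v (κ m), (0 : ℝ)))) x) =
      -∑ κ : Equiv.Perm (Fin (2 * N + 1)), sgn K κ *
        𝔤.chen tr (Fin.insertNth j ((0, 1), (v (κ 0), 0))
          (pairs fun m : Fin (2 * N) => ((v (κ m.succ), (0 : ℝ))))) x := fun j => by
    rw [← sum_perm_mul_right (Fin.cycleRange ⟨2 * j, by omega⟩), ← Finset.sum_neg_distrib]
    refine Finset.sum_congr rfl fun κ _ => ?_
    have hp := pairs_insertNth_odd j ((0 : A), (1 : ℝ)) (fun i => (v i, (0 : ℝ))) κ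
    rw [sgn_mul, sgn_cycleRange, Even.neg_one_pow (even_two_mul _), mul_one, ← mul_neg,
      ← chen_insertNth_swap, ← hp]
    rfl
  have hj : ∀ j : Fin (N + 1), (-1 : K) ^ (2 * (j : ℕ)) *
        (∑ κ : Equiv.Perm (Fin (2 * N + 1)), sgn K κ *
          𝔤.chen tr (pairs (N := N + 1) (Fin.insertNth (⟨2 * j, by omega⟩ : Fin (2 * N + 2))
            ((0 : A), (1 : ℝ)) fun m => (v (κ m), (0 : ℝ)))) x) +
      (-1 : K) ^ (2 * (j : ℕ) + 1) * (∑ κ : Equiv.Perm (Fin (2 * N + 1)), sgn K κ *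
          𝔤.chen tr (pairs (N := N + 1) (Fin.insertNth (⟨2 * j + 1, by omega⟩ : Fin (2 * N + 2))
            ((0 : A), (1 : ℝ)) fun m => (v (κ m), (0 : ℝ)))) x) =
      2 * ∑ κ : Equiv.Perm (Fin (2 * N + 1)), sgn K κ *
        𝔤.chen tr (Fin.insertNth j ((0, 1), (v (κ 0), 0))
          (pairs fun m : Fin (2 * N) => ((v (κ m.succ), (0 : ℝ))))) x := fun j => by
    rw [he, ho, pow_succ, Even.neg_one_pow (even_two_mul _)]
    ring
  refine (Finset.sum_congr rfl fun j _ => hj j).trans ?_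
  rw [← Finset.mul_sum, Finset.sum_comm]
  simp only [Finset.mul_sum]

/-- The exterior derivative of the antisymmetrized iterated integral. -/
theorem extDeriv_chen [FiniteDimensional ℝ G] (htr : ∀ b c, tr (b * c) = tr (c * b)) (x : A)
    (v : Fin (2 * N + 1) → A) :
    ∑ i : Fin (2 * N + 1), (-1 : K) ^ (i : ℕ) * ∑ σ : Equiv.Perm (Fin (2 * N)), sgn K σ *
      fderiv ℝ (𝔤.chen tr (pairs fun m => ((v (i.succAbove (σ m)), (0 : ℝ))))) x (v i) =
    2⁻¹ * ∑ ρ : Equiv.Perm (Fin (2 * N + 2)), sgn K ρ * 𝔤.chen tr (pairs (N := N + 1)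
      fun m : Fin (2 * N + 2) => (Fin.cons ((0 : A), (1 : ℝ)) (fun i => (v i, (0 : ℝ))) :
        Fin (2 * N + 2) → A × ℝ) (ρ m)) x := by
  rw [sum_chen_insert, ← sum_fderiv_chen _ _ htr, inv_mul_cancel_left₀ two_ne_zero]
  exact sum_antisymm_first (fun u w => fderiv ℝ (𝔤.chen tr (pairs fun m => (w m, (0 : ℝ)))) x u) v

end TemporalGauge

/-! ### Curvature and Bianchi identity of a matrix-valued connection form -/

section Flat

variable {B : Type*} [NormedAddCommGroup B] [NormedSpace ℝ B]
  {G : Type*} [NormedRing G] [NormedAlgebra ℝ G]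

/-- The curvature of the connection form `α` in the directions `u`, `v`. -/
def formCurv (α : B → B → G) (u v p : B) : G :=
  fderiv ℝ (fun q => α q v) p u - fderiv ℝ (fun q => α q u) p v +
    (α p u * α p v - α p v * α p u)

theorem fderiv_formCurv {α : B → B → G} (hα : ∀ v, ContDiff ℝ ∞ fun p => α p v) (p u v w : B) :
    fderiv ℝ (formCurv α v w) p u =
      fderiv ℝ (fderiv ℝ fun q => α q w) p u v - fderiv ℝ (fderiv ℝ fun q => α q v) p u w +
      ((α p v * fderiv ℝ (fun q => α q w) p u + fderiv ℝ (fun q => α q v) p u * α p w) -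
        (α p w * fderiv ℝ (fun q => α q v) p u + fderiv ℝ (fun q => α q w) p u * α p v)) := by
  have h1 : ∀ v, HasFDerivAt (fun q => α q v) (fderiv ℝ (fun q => α q v) p) p := fun v =>
    ((hα v).differentiable (by simp) p).hasFDerivAt
  have h2 : ∀ v w, HasFDerivAt (fun q => fderiv ℝ (fun q => α q v) q w)
      ((ContinuousLinearMap.apply ℝ G w).comp (fderiv ℝ (fderiv ℝ fun q => α q v) p)) p :=
    fun v w => (ContinuousLinearMap.apply ℝ G w).hasFDerivAt.comp p
      ((((hα v).fderiv_right (m := ∞) (by simp)).differentiable (by simp)) p).hasFDerivAt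
  have h := ((h2 w v).sub (h2 v w)).add (((h1 v).mul' (h1 w)).sub ((h1 w).mul' (h1 v)))
  refine (congrArg (fun L : B →L[ℝ] G => L u) h.fderiv).trans ?_
  simp

/-- Second derivatives cancel in the cyclic sum by symmetry. The rest is the cancellation of
products of `α` with its derivatives and the Jacobi identity for the cubic terms. -/
theorem formCurv_bianchi {α : B → B → G} (hα : ∀ v, ContDiff ℝ ∞ fun p => α p v) (p u v w : B) :
    (fderiv ℝ (formCurv α v w) p u + (α p u * formCurv α v w p - formCurv α v w p * α p u)) +
    (fderiv ℝ (formCurv α w u) p v + (α p v * formCurv α w u p - formCurv α w u p * α p v)) +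
    (fderiv ℝ (formCurv α u v) p w + (α p w * formCurv α u v p - formCurv α u v p * α p w)) =
      0 := by
  have hsymm : ∀ a b c, fderiv ℝ (fderiv ℝ fun q => α q a) p b c =
      fderiv ℝ (fderiv ℝ fun q => α q a) p c b := fun a b c =>
    (hα a).contDiffAt.isSymmSndFDerivAt (by simp; norm_cast) b c
  rw [fderiv_formCurv hα, fderiv_formCurv hα, fderiv_formCurv hα, hsymm w u v, hsymm u v w,
    hsymm v w u]
  simp only [formCurv]
  noncomm_ring

end Flat

/-! ### The real algebra of endomorphisms and its trace -/

section End

variable (K : Type*) [RCLike K] (F : Type*) [NormedAddCommGroup F] [NormedSpace ℝ F]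
  [NormedSpace K F] [IsScalarTower ℝ K F]

instance instNormedAlgebraRealEnd : NormedAlgebra ℝ (F →L[K] F) :=
  { (inferInstance : Algebra ℝ (F →L[K] F)) with
    norm_smul_le := fun c T => norm_smul_le c T }

variable [FiniteDimensional K F]

/-- The trace of `K`-linear operators as a real linear functional. -/
def traceL : (F →L[K] F) →L[ℝ] K :=
  (LinearMap.toContinuousLinearMap
    ((LinearMap.trace K F).comp (ContinuousLinearMap.coeLM K))).restrictScalars ℝ

variable {K F}

theorem traceL_apply (T : F →L[K] F) : traceL K F T = LinearMap.trace K F (T : F →ₗ[K] F) := rfl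

theorem traceL_mul_comm (S T : F →L[K] F) : traceL K F (S * T) = traceL K F (T * S) := by
  simp only [traceL_apply]
  exact LinearMap.trace_mul_comm K (S : F →ₗ[K] F) (T : F →ₗ[K] F)

end End

/-! ### The connection in a frame along a map -/

section Gauge

variable {K : Type*} [RCLike K]
    {E : Type*} [NormedAddCommGroup E] [NormedSpace ℝ E] [FiniteDimensional ℝ E]
    {X : Type*} [TopologicalSpace X] [T2Space X] [ChartedSpace E X] [IsManifold 𝓘(ℝ, E) ∞ X]
    {F : Type*} [NormedAddCommGroup F] [NormedSpace ℝ F] [FiniteDimensional ℝ F]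
    [NormedSpace K F] [IsScalarTower ℝ K F] [FiniteDimensional K F]
    {V : X → Type*} [TopologicalSpace (TotalSpace F V)]
    [∀ x, AddCommGroup (V x)] [∀ x, Module ℝ (V x)] [∀ x, Module K (V x)]
    [∀ x, TopologicalSpace (V x)]
    [∀ x, IsTopologicalAddGroup (V x)] [∀ x, ContinuousSMul ℝ (V x)]
    [FiberBundle F V] [VectorBundle ℝ F V] [VectorBundle K F V]
    [ContMDiffVectorBundle ∞ F V 𝓘(ℝ, E)]
    {B : Type*} [NormedAddCommGroup B] [NormedSpace ℝ B]
    {cov : CovariantDerivative 𝓘(ℝ, E) F V}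

/-- A smooth global frame along `f`. -/
structure IsSmoothFrame (E : Type*) [NormedAddCommGroup E] [NormedSpace ℝ E]
    {X : Type*} [TopologicalSpace X] [ChartedSpace E X]
    {V : X → Type*} [TopologicalSpace (TotalSpace F V)] [∀ x, AddCommGroup (V x)]
    [∀ x, Module K (V x)] [∀ x, TopologicalSpace (V x)] [FiberBundle F V]
    (f : B → X) (e : ∀ q, F →ₗ[K] V (f q)) : Prop where
  base : ContMDiff 𝓘(ℝ, B) 𝓘(ℝ, E) ∞ f
  bijective : ∀ q, Function.Bijective (e q)
  smooth : ∀ q w, ContMDiffAt 𝓘(ℝ, B) (𝓘(ℝ, E).prod 𝓘(ℝ, F)) ∞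
      (fun q => (⟨f q, e q w⟩ : TotalSpace F V)) q

theorem IsFrameOn.isSmoothFrame {f : B → X} {d : B} {e : ∀ q, F →ₗ[K] V (f q)}
    (h : IsFrameOn cov f d e Set.univ) (hf : ContMDiff 𝓘(ℝ, B) 𝓘(ℝ, E) ∞ f) :
    IsSmoothFrame E f e :=
  ⟨hf, fun q => h.bijective q (Set.mem_univ q), fun q => h.smooth q (Set.mem_univ q)⟩

/-- An endomorphism of `V y` in a frame. -/
def inFrame {y : X} (e₀ : F →ₗ[K] V y) (e₁ : F →ₗ[K] V y) (T : V y →ₗ[K] V y) : F →L[K] F :=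
  LinearMap.toContinuousLinearMap (linv e₀ ∘ₗ T ∘ₗ e₁)

theorem inFrame_apply {y : X} (e₀ e₁ : F →ₗ[K] V y) (T : V y →ₗ[K] V y) (w : F) :
    inFrame e₀ e₁ T w = linv e₀ (T (e₁ w)) := rfl

theorem apply_inFrame {y : X} {e₀ : F →ₗ[K] V y} (h : Function.Bijective e₀) (e₁ : F →ₗ[K] V y)
    (T : V y →ₗ[K] V y) (w : F) : e₀ (inFrame e₀ e₁ T w) = T (e₁ w) :=
  apply_linv h _

/-- The connection form in a frame along `f`. -/
def gaugeConn (cov : CovariantDerivative 𝓘(ℝ, E) F V) {f : B → X} (e : ∀ q, F →ₗ[K] V (f q))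
    (p v : B) : F →L[K] F :=
  LinearMap.toContinuousLinearMap (linv (e p) ∘ₗ
    (coordEquiv K F V (coord_self_mem (f p))).symm.toLinearMap ∘ₗ
    ((fderiv ℝ (frameCoord K e (f p)) p v +
      connForm K cov (f p) (f p) (mfderiv 𝓘(ℝ, B) 𝓘(ℝ, E) f p v) ∘L frameCoord K e (f p) p :
        F →L[K] F) : F →ₗ[K] F))

variable {f : B → X} {e : ∀ q, F →ₗ[K] V (f q)}

/-- The characterization that is used from here on: the connection form is determined by `∇_v (e w)
= e (α(v) w)`, independently of the trivializations that enter its definition. -/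
theorem frame_gaugeConn (hK : IsScalarLinear K cov) (he : IsSmoothFrame E f e) (p v : B) (w : F) :
    e p (gaugeConn cov e p v w) = covAlong cov f (fun q => e q w) p v := by
  have hb := coord_self_mem (F := F) (V := V) (f p)
  refine (apply_linv (he.bijective p) _).trans (coord_injective (F := F) hb ?_)
  rw [coord_covAlong hK ((he.smooth p w).mdifferentiableAt (by simp)) hb v]
  refine (coord_ofCoord hb _).trans ?_
  have hfc := contDiffAt_frameCoord (he.base p) hb (he.smooth p)
  have h1 : fderiv ℝ (fun q => coord F (f p) (e q w)) p v =
      fderiv ℝ (frameCoord K e (f p)) p v w := by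
    rw [(coord_frame_apply_eventuallyEq (he.base p) hb fun _ => w).fderiv_eq,
      fderiv_clm_apply_apply (hfc.differentiableAt (by simp)) (differentiableAt_const w)]
    simp
  rw [h1, ← frameCoord_apply hb]
  rfl

theorem contDiff_gaugeConn (hcov : CovariantDerivative.ContMDiffCovariantDerivative cov ∞)
    (hK : IsScalarLinear K cov) (he : IsSmoothFrame E f e) (v : B) :
    ContDiff ℝ ∞ fun p => gaugeConn cov e p v :=
  contDiff_clm_of_apply fun w => contDiff_iff_contDiffAt.2 fun p =>
    contDiffAt_of_frame_apply (he.base p) (he.smooth p)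
      (Filter.Eventually.of_forall he.bijective)
      (contMDiffAt_covAlong hcov hK he.base (he.smooth p w) v)
      (Filter.Eventually.of_forall fun q => frame_gaugeConn hK he q v w)

theorem covAlong_frame_apply_eq (hK : IsScalarLinear K cov) (he : IsSmoothFrame E f e) {c : B → F}
    {p : B} (hc : ContDiffAt ℝ ∞ c p) (v : B) :
    covAlong cov f (fun q => e q (c q)) p v =
      e p (fderiv ℝ c p v + gaugeConn cov e p v (c p)) := by
  rw [covAlong_frame_apply hK (he.base p) (he.smooth p) hc, map_add, frame_gaugeConn hK he]

/-- The commutator of covariant derivatives, applied to the frame sections `e w`, is computed twice: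
as curvature, and by the Leibniz rule as `dα + α ∧ α`. -/
theorem curvature_frame (hcov : CovariantDerivative.ContMDiffCovariantDerivative cov ∞)
    (hK : IsScalarLinear K cov) (he : IsSmoothFrame E f e) (p u v : B) :
    inFrame (e p) (e p) (curvature K cov (f p) (mfderiv 𝓘(ℝ, B) 𝓘(ℝ, E) f p u)
      (mfderiv 𝓘(ℝ, B) 𝓘(ℝ, E) f p v)) = formCurv (gaugeConn cov e) u v p := by
  ext w
  apply (he.bijective p).1
  rw [apply_inFrame (he.bijective p)]
  refine (covAlong_comm hcov hK he.base (he.smooth p w) u v).symm.trans ?_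
  have hd : ∀ v, ContDiff ℝ ∞ fun q => gaugeConn cov e q v w := fun v =>
    contDiff_iff_contDiffAt.2 fun q => contDiffAt_clm_apply
      (contDiff_gaugeConn hcov hK he v).contDiffAt contDiffAt_const
  have hfd : ∀ u v, fderiv ℝ (fun q => gaugeConn cov e q v w) p u =
      fderiv ℝ (fun q => gaugeConn cov e q v) p u w := fun u v => by
    rw [fderiv_clm_apply_apply ((contDiff_gaugeConn hcov hK he v).differentiable (by simp) p)
      (differentiableAt_const w)]
    simp
  simp only [← frame_gaugeConn hK he]
  rw [covAlong_frame_apply_eq hK he (hd v).contDiffAt u,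
    covAlong_frame_apply_eq hK he (hd u).contDiffAt v, ← map_sub, hfd, hfd]
  congr 1
  simp only [formCurv, add_apply, sub_apply, mul_apply_eq_comp]
  abel

theorem contDiff_inFrame_curvature
    (hcov : CovariantDerivative.ContMDiffCovariantDerivative cov ∞)
    (hK : IsScalarLinear K cov) (he : IsSmoothFrame E f e)
    {u v : ∀ q, TangentSpace 𝓘(ℝ, E) (f q)}
    (hu : ContMDiff 𝓘(ℝ, B) 𝓘(ℝ, E).tangent ∞
      (fun q => (⟨f q, u q⟩ : TangentBundle 𝓘(ℝ, E) X)))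
    (hv : ContMDiff 𝓘(ℝ, B) 𝓘(ℝ, E).tangent ∞
      (fun q => (⟨f q, v q⟩ : TangentBundle 𝓘(ℝ, E) X))) :
    ContDiff ℝ ∞ fun p => inFrame (e p) (e p) (curvature K cov (f p) (u p) (v p)) :=
  contDiff_clm_of_apply fun w => contDiff_iff_contDiffAt.2 fun p =>
    contDiffAt_of_frame_apply (he.base p) (he.smooth p)
      (Filter.Eventually.of_forall he.bijective)
      (contMDiffAt_curvature_along hcov hK (hu p) (hv p) (he.smooth p w))
      (Filter.Eventually.of_forall fun q => apply_inFrame (he.bijective q) _ _ w)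

/-! ### The grading operator along a map -/

theorem contMDiffAt_grading (Ξ : Grading K E F V) {s : ∀ q, V (f q)} {p : B}
    (hs : ContMDiffAt 𝓘(ℝ, B) (𝓘(ℝ, E).prod 𝓘(ℝ, F)) ∞
      (fun q => (⟨f q, s q⟩ : TotalSpace F V)) p) :
    ContMDiffAt 𝓘(ℝ, B) (𝓘(ℝ, E).prod 𝓘(ℝ, F)) ∞
      (fun q => (⟨f q, Ξ.op (f q) (s q)⟩ : TotalSpace F V)) p :=
  ContMDiffAt.comp p (Ξ.smooth ⟨f p, s p⟩) hs

/-- Compatibility of `Ξ` with `∇` is assumed for sections over `X`. A section along `f` is locally a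
combination of pulled-back ones with variable coefficients, and the Leibniz rule passes the identity
on. -/
theorem covAlong_grading {Ξ : Grading K E F V} (hΞ : IsGradedConnection cov Ξ)
    (hf : ContMDiff 𝓘(ℝ, B) 𝓘(ℝ, E) ∞ f) {s : ∀ q, V (f q)} {p : B}
    (hs : ContMDiffAt 𝓘(ℝ, B) (𝓘(ℝ, E).prod 𝓘(ℝ, F)) ∞
      (fun q => (⟨f q, s q⟩ : TotalSpace F V)) p) (v : B) :
    covAlong cov f (fun q => Ξ.op (f q) (s q)) p v = Ξ.op (f p) (covAlong cov f s p v) := by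
  have hK : IsScalarLinear K cov := hΞ.smul
  have hb := coord_self_mem (F := F) (V := V) (f p)
  let ε : ∀ q, F →ₗ[K] V (f q) := fun q => (trivializationAt F V (f p)).symmₗ K (f q)
  have hbase := eventually_mem_baseSet (F := F) (V := V) (hf p).continuousAt hb
  have hε : ∀ᶠ q in nhds p, ∀ w, ε q w = ofCoord V (f p) (f q) w :=
    hbase.mono fun q hq w => Trivialization.symmₗ_apply (R := K) _ hq w
  have hsm : ∀ w, ContMDiffAt 𝓘(ℝ, B) (𝓘(ℝ, E).prod 𝓘(ℝ, F)) ∞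
      (fun q => (⟨f q, ε q w⟩ : TotalSpace F V)) p := fun w => by
    refine (ContMDiffAt.comp p (contMDiffAt_ofCoord hb w) (hf p)).congr_of_eventuallyEq ?_
    exact hε.mono fun q hq => congrArg (TotalSpace.mk (f q)) (hq w)
  have hc : ContDiffAt ℝ ∞ (fun q => coord F (f p) (s q)) p :=
    (contMDiffAt_along_iff (hf p) hb).1 hs
  have hsε : ∀ᶠ q in nhds p, s q = ε q (coord F (f p) (s q)) := by
    filter_upwards [hε, hbase] with q h1 h2
    rw [h1, ofCoord_coord h2]
  have hw : ∀ w, covAlong cov f (fun q => Ξ.op (f q) (ε q w)) p v =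
      Ξ.op (f p) (covAlong cov f (fun q => ε q w) p v) := fun w => by
    have hmd := mdifferentiableAt_ofCoord (E := E) (V := V) hb w
    have hmd' : MDifferentiableAt 𝓘(ℝ, E) (𝓘(ℝ, E).prod 𝓘(ℝ, F))
        (fun z => (⟨z, Ξ.op z (ofCoord V (f p) z w)⟩ : TotalSpace F V)) (f p) :=
      MDifferentiableAt.comp (f p)
        ((Ξ.smooth ⟨f p, ofCoord V (f p) (f p) w⟩).mdifferentiableAt (by simp)) hmd
    rw [covAlong_congr (hε.mono fun q hq => hq w),
      covAlong_congr (s' := fun q => Ξ.op (f q) (ofCoord V (f p) (f q) w))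
        (hε.mono fun q hq => congrArg (Ξ.op (f q)) (hq w)),
      covAlong_pullback hK (σ := fun z => ofCoord V (f p) z w) hmd
        ((hf p).mdifferentiableAt (by simp)),
      covAlong_pullback hK (σ := fun z => Ξ.op z (ofCoord V (f p) z w)) hmd'
        ((hf p).mdifferentiableAt (by simp))]
    exact hΞ.grading _ _ hmd _
  rw [covAlong_congr hsε, covAlong_congr (s' := fun q => (Ξ.op (f q) ∘ₗ ε q)
      (coord F (f p) (s q))) (hsε.mono fun q hq => congrArg (Ξ.op (f q)) hq),
    covAlong_frame_apply hK (hf p) hsm hc,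
    covAlong_frame_apply hK (e := fun q => Ξ.op (f q) ∘ₗ ε q) (hf p)
      (fun w => contMDiffAt_grading Ξ (hsm w)) hc, map_add]
  exact congrArg₂ _ rfl (hw _)

theorem contDiff_inFrame_grading (Ξ : Grading K E F V) {e' : ∀ q, F →ₗ[K] V (f q)}
    (he : IsSmoothFrame E f e) (he' : IsSmoothFrame E f e') :
    ContDiff ℝ ∞ fun p => inFrame (e p) (e' p) (Ξ.op (f p)) :=
  contDiff_clm_of_apply fun w => contDiff_iff_contDiffAt.2 fun p =>
    contDiffAt_of_frame_apply (he.base p) (he.smooth p)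
      (Filter.Eventually.of_forall he.bijective)
      (contMDiffAt_grading Ξ (he'.smooth p w))
      (Filter.Eventually.of_forall fun q => apply_inFrame (he.bijective q) _ _ w)

/-- Differentiating `Ξ e' = e q` with `∇Ξ = 0` gives `e q α' = e (dq + α q)`. The two frames may
differ; for loops they are the frames at times `0` and `1`. -/
theorem fderiv_inFrame_grading {Ξ : Grading K E F V} (hΞ : IsGradedConnection cov Ξ)
    {e' : ∀ q, F →ₗ[K] V (f q)} (he : IsSmoothFrame E f e) (he' : IsSmoothFrame E f e')
    (p v : B) :
    fderiv ℝ (fun p => inFrame (e p) (e' p) (Ξ.op (f p))) p v =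
      inFrame (e p) (e' p) (Ξ.op (f p)) * gaugeConn cov e' p v -
        gaugeConn cov e p v * inFrame (e p) (e' p) (Ξ.op (f p)) := by
  have hK : IsScalarLinear K cov := hΞ.smul
  have hq := contDiff_inFrame_grading Ξ he he'
  rw [eq_sub_iff_add_eq]
  ext w
  apply (he.bijective p).1
  have h1 := covAlong_grading hΞ he.base (he'.smooth p w) v
  have h2 := covAlong_frame_apply_eq hK he
    (contDiffAt_clm_apply hq.contDiffAt (contDiffAt_const (c := w)) (p := p)) v
  simp only [apply_inFrame (he.bijective _)] at h2
  rw [h1, fderiv_clm_apply_apply (hq.differentiable (by simp) p) (differentiableAt_const w)] at h2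
  simp only [add_apply, mul_apply_eq_comp]
  rw [apply_inFrame (he.bijective p), frame_gaugeConn hK he', h2]
  simp

end Gauge

/-! ### The Bismut–Chern forms in a parallel frame -/

section Holonomy

variable {K : Type*} [RCLike K]
    {E : Type*} [NormedAddCommGroup E] [NormedSpace ℝ E] [FiniteDimensional ℝ E]
    {X : Type*} [TopologicalSpace X] [T2Space X] [ChartedSpace E X] [IsManifold 𝓘(ℝ, E) ∞ X]
    {F : Type*} [NormedAddCommGroup F] [NormedSpace ℝ F] [FiniteDimensional ℝ F]
    [NormedSpace K F] [IsScalarTower ℝ K F] [FiniteDimensional K F]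
    {V : X → Type*} [TopologicalSpace (TotalSpace F V)]
    [∀ x, AddCommGroup (V x)] [∀ x, Module ℝ (V x)] [∀ x, Module K (V x)]
    [∀ x, TopologicalSpace (V x)]
    [∀ x, IsTopologicalAddGroup (V x)] [∀ x, ContinuousSMul ℝ (V x)]
    [FiberBundle F V] [VectorBundle ℝ F V] [VectorBundle K F V]
    [ContMDiffVectorBundle ∞ F V 𝓘(ℝ, E)]
    {B : Type*} [NormedAddCommGroup B] [NormedSpace ℝ B]
    {cov : CovariantDerivative 𝓘(ℝ, E) F V}

/-- A frame of a fibre as a frame of an equal fibre. -/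
def castFrame {y₁ y₀ : X} (h : y₁ = y₀) (e : F →ₗ[K] V y₁) : F →ₗ[K] V y₀ := h ▸ e

theorem isSmoothFrame_castFrame {f₁ f₀ : B → X} (h : f₁ = f₀) {e : ∀ q, F →ₗ[K] V (f₁ q)}
    (he : IsSmoothFrame E f₁ e) : IsSmoothFrame E f₀ fun q => castFrame (congrFun h q) (e q) := by
  subst h
  exact he

theorem gaugeConn_castFrame {f₁ f₀ : B → X} (h : f₁ = f₀) (e : ∀ q, F →ₗ[K] V (f₁ q)) :
    gaugeConn cov (fun q => castFrame (congrFun h q) (e q)) = gaugeConn cov e := by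
  subst h
  rfl

section Slice

variable {A : Type} [NormedAddCommGroup A] [NormedSpace ℝ A] [FiniteDimensional ℝ A] {f : A × ℝ → X}
  {e : ∀ q, F →ₗ[K] V (f q)}

theorem IsSmoothFrame.slice (he : IsSmoothFrame E f e) (b : ℝ) :
    IsSmoothFrame E (fun x => f (x, b)) fun x => e (x, b) :=
  ⟨he.base.comp (contDiff_prodMk_left b).contMDiff, fun x => he.bijective (x, b),
    fun x w => contMDiffAt_slice (he.smooth (x, b) w)⟩

/-- The slice at a fixed time is a composition with an affine embedding, whose differential sends
`v` to `(v, 0)`. -/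
theorem gaugeConn_slice (hK : IsScalarLinear K cov) (he : IsSmoothFrame E f e) (b : ℝ) (x v : A) :
    gaugeConn cov (fun x => e (x, b)) x v = gaugeConn cov e (x, b) (v, 0) := by
  ext w
  apply (he.bijective (x, b)).1
  rw [frame_gaugeConn hK he]
  refine (frame_gaugeConn hK (he.slice b) x v w).trans ?_
  have h : HasFDerivAt (fun y : A => (y, b)) (ContinuousLinearMap.inl ℝ A ℝ) x :=
    hasFDerivAt_prodMk_left x b
  refine (covAlong_comp hK (φ := fun y : A => (y, b)) (s := fun q => e q w)
    ((he.smooth (x, b) w).mdifferentiableAt (by simp)) h.differentiableAt v).trans ?_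
  rw [h.fderiv]
  rfl

end Slice

/-- Stated for an arbitrary equality of base points, so that the identification of the fibres over
`γ 1` and `γ 0` can be eliminated; what remains is cyclicity of the trace. -/
theorem trace_castFrame {y₁ y₀ : X} (h : y₁ = y₀) {e₀ : F →ₗ[K] V y₀} (e₁ : F →ₗ[K] V y₁)
    (T : V y₀ →ₗ[K] V y₀) (P : F →L[K] F) {A : V y₀ →ₗ[K] V y₁}
    (hA : A = e₁ ∘ₗ (P : F →ₗ[K] F) ∘ₗ linv e₀) :
    LinearMap.trace K (V y₀) (T ∘ₗ (h ▸ A)) =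
      traceL K F (inFrame e₀ (castFrame h e₁) T * P) := by
  subst h
  subst hA
  have : Module.Free K (V y₁) := Module.Free.of_divisionRing K _
  have : Module.Finite K (V y₁) :=
    Module.Finite.equiv (coordEquiv K F V (coord_self_mem y₁)).symm
  rw [traceL_apply]
  exact LinearMap.trace_comp_comm' (R := K) (linv e₀) (T ∘ₗ e₁ ∘ₗ (P : F →ₗ[K] F))

theorem loopStr_eq (Ξ : Grading K E F V) (γ : SmoothLoop E X) (h : γ 1 = γ 0)
    (e₀ : F →ₗ[K] V (γ 0)) (e₁ : F →ₗ[K] V (γ 1)) (P : F →L[K] F) :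
    loopStr Ξ γ (e₁ ∘ₗ (P : F →ₗ[K] F) ∘ₗ linv e₀) =
      traceL K F (inFrame e₀ (castFrame h e₁) (Ξ.op (γ 0)) * P) :=
  trace_castFrame h e₁ (Ξ.op (γ 0)) P rfl

/-- In a parallel frame every transport is `e t ∘ₗ linv (e s)`. Between consecutive factors the
frames cancel, and only the curvature matrices remain, with the latest time leftmost. -/
theorem transportProd_eq (hcov : CovariantDerivative.ContMDiffCovariantDerivative cov ∞)
    (hK : IsScalarLinear K cov) {γ : ℝ → X} (hγ : ContMDiff 𝓘(ℝ, ℝ) 𝓘(ℝ, E) ∞ γ)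
    {e : ∀ t, F →ₗ[K] V (γ t)} (he : IsFrameOn cov γ 1 e Set.univ) (N : ℕ)
    (R : Fin N → ∀ t : ℝ, V (γ t) →ₗ[K] V (γ t)) (τ : Fin N → ℝ) (t : ℝ) :
    transportProd cov γ N R τ t = e t ∘ₗ
      ((oprod fun j : Fin N => inFrame (e (τ j.rev)) (e (τ j.rev)) (R j.rev (τ j.rev)) :
        F →L[K] F) : F →ₗ[K] F) ∘ₗ linv (e 0) := by
  induction N generalizing t with
  | zero =>
    rw [transportProd, parallelTransport_eq_frame hcov hK hγ he isOpen_univ (Set.subset_univ _)]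
    rfl
  | succ N ih =>
    rw [transportProd, parallelTransport_eq_frame hcov hK hγ he isOpen_univ (Set.subset_univ _), ih]
    have h : (fun j : Fin (N + 1) =>
        inFrame (e (τ j.rev)) (e (τ j.rev)) (R j.rev (τ j.rev))) =
        Fin.cons (inFrame (e (τ (Fin.last N))) (e (τ (Fin.last N)))
          (R (Fin.last N) (τ (Fin.last N))))
        fun j : Fin N => inFrame (e (Fin.init τ j.rev)) (e (Fin.init τ j.rev))
          (Fin.init R j.rev (Fin.init τ j.rev)) := by
      funext j
      cases j using Fin.cases with
      | zero => rw [Fin.cons_zero, Fin.rev_zero]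
      | succ j => rw [Fin.cons_succ, Fin.rev_succ]; rfl
    rw [h, oprod_cons]
    rfl

/-- The holonomy of a loop followed by the grading operator, in a frame. -/
def loopHol (Ξ : Grading K E F V) (γ : SmoothLoop E X) (e : ∀ t, F →ₗ[K] V (γ t)) : F →L[K] F :=
  inFrame (e 0) (castFrame (show γ 1 = γ 0 by simpa using γ.periodic 0) (e 1)) (Ξ.op (γ 0))

/-- The curvature of a pair of tangent vectors in a frame. -/
def loopCurv (cov : CovariantDerivative 𝓘(ℝ, E) F V) (γ : SmoothLoop E X)
    (e : ∀ t, F →ₗ[K] V (γ t)) (u v : LoopTangent γ) (t : ℝ) : F →L[K] F :=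
  inFrame (e t) (e t) (curvature K cov (γ t) (u.1 t) (v.1 t))

/-- Two reversals meet: the tuple lists the highest vector first, and the product has the latest
time first. Their joint effect is conjugation of the permutation by the reversal, which preserves
the sign and also exchanges the two slots of each pair as required. -/
theorem BCh_eq (hcov : CovariantDerivative.ContMDiffCovariantDerivative cov ∞)
    (hK : IsScalarLinear K cov) (Ξ : Grading K E F V) (N : ℕ) (γ : SmoothLoop E X)
    {e : ∀ t, F →ₗ[K] V (γ t)} (he : IsFrameOn cov γ 1 e Set.univ)
    (U : Fin (2 * N) → LoopTangent γ) :
    BCh cov Ξ N γ U = ((-2 : K) ^ N)⁻¹ * ∑ ρ : Equiv.Perm (Fin (2 * N)), sgn K ρ *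
      ∫ t in decSimplex N, traceL K F (loopHol Ξ γ e * oprod fun j => loopCurv cov γ e
        (pairs (fun m => U (ρ m)) j).1 (pairs (fun m => U (ρ m)) j).2 (t j)) := by
  have hrev : Function.Bijective fun σ : Equiv.Perm (Fin (2 * N)) =>
      Fin.revPerm * σ * Fin.revPerm :=
    ((Equiv.mulLeft Fin.revPerm).trans (Equiv.mulRight Fin.revPerm)).bijective
  rw [BCh]
  congr 1
  refine Finset.sum_bijective _ hrev (by simp) fun σ _ => ?_
  have hs : sgn K (Fin.revPerm * σ * Fin.revPerm) = ((Equiv.Perm.sign σ : ℤ) : K) := by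
    rw [sgn_mul, sgn_mul, mul_right_comm, ← sgn_mul]
    have : (Fin.revPerm * Fin.revPerm : Equiv.Perm (Fin (2 * N))) = 1 := by
      ext i
      simp
    rw [this]
    simp [sgn]
  rw [hs]
  congr 1
  rw [← setIntegral_simplex]
  refine integral_congr_ae (Filter.Eventually.of_forall fun τ => ?_)
  simp only [transportProd_eq hcov hK γ.smooth he]
  refine (loopStr_eq Ξ γ (by simpa using γ.periodic 0) _ _ _).trans ?_
  refine congrArg (fun w => traceL K F (loopHol Ξ γ e * oprod w)) (funext fun j => ?_)
  have h1 : (Fin.revPerm * σ * Fin.revPerm : Equiv.Perm (Fin (2 * N))) ⟨2 * (j : ℕ), by omega⟩ =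
      Fin.rev (σ ⟨2 * (j.rev : ℕ) + 1, by omega⟩) := by
    simp only [Equiv.Perm.mul_apply, Fin.revPerm_apply]
    congr 2
    ext
    simp only [Fin.val_rev]
    omega
  have h2 : (Fin.revPerm * σ * Fin.revPerm : Equiv.Perm (Fin (2 * N))) ⟨2 * (j : ℕ) + 1, by omega⟩ =
      Fin.rev (σ ⟨2 * (j.rev : ℕ), by omega⟩) := by
    simp only [Equiv.Perm.mul_apply, Fin.revPerm_apply]
    congr 2
    ext
    simp only [Fin.val_rev]
    omega
  simp only [loopCurv, pairs, h1, h2]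

end Holonomy

/-! ### The Bismut–Chern forms are alternating and multilinear -/

section Alternating

variable {K : Type*} [RCLike K]
    {E : Type*} [NormedAddCommGroup E] [NormedSpace ℝ E] [FiniteDimensional ℝ E]
    {X : Type*} [TopologicalSpace X] [T2Space X] [ChartedSpace E X] [IsManifold 𝓘(ℝ, E) ∞ X]
    {F : Type*} [NormedAddCommGroup F] [NormedSpace ℝ F] [FiniteDimensional ℝ F]
    [NormedSpace K F] [IsScalarTower ℝ K F] [FiniteDimensional K F]
    {V : X → Type*} [TopologicalSpace (TotalSpace F V)]
    [∀ x, AddCommGroup (V x)] [∀ x, Module ℝ (V x)] [∀ x, Module K (V x)]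
    [∀ x, IsScalarTower ℝ K (V x)]
    [∀ x, TopologicalSpace (V x)]
    [∀ x, IsTopologicalAddGroup (V x)] [∀ x, ContinuousSMul ℝ (V x)]
    [FiberBundle F V] [VectorBundle ℝ F V] [VectorBundle K F V]
    [ContMDiffVectorBundle ∞ F V 𝓘(ℝ, E)]
    {cov : CovariantDerivative 𝓘(ℝ, E) F V}

theorem loopCurv_swap (hcov : CovariantDerivative.ContMDiffCovariantDerivative cov ∞)
    (hK : IsScalarLinear K cov) (γ : SmoothLoop E X) (e : ∀ t, F →ₗ[K] V (γ t))
    (u v : LoopTangent γ) (t : ℝ) : loopCurv cov γ e u v t = -loopCurv cov γ e v u t := by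
  ext w
  rw [loopCurv, curvature_swap hcov hK]
  exact map_neg (linv (e t)) _

theorem loopCurv_add_left (hcov : CovariantDerivative.ContMDiffCovariantDerivative cov ∞)
    (hK : IsScalarLinear K cov) (γ : SmoothLoop E X) (e : ∀ t, F →ₗ[K] V (γ t))
    (u u' v : LoopTangent γ) (t : ℝ) :
    loopCurv cov γ e (u + u') v t = loopCurv cov γ e u v t + loopCurv cov γ e u' v t := by
  ext w
  have h : curvature K cov (γ t) ((u + u').1 t) (v.1 t) =
      curvature K cov (γ t) (u.1 t) (v.1 t) + curvature K cov (γ t) (u'.1 t) (v.1 t) :=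
    curvature_add_left hcov hK (γ t) (u.1 t) (u'.1 t) (v.1 t)
  rw [loopCurv, h]
  exact map_add (linv (e t)) _ _

theorem loopCurv_smul_left (hcov : CovariantDerivative.ContMDiffCovariantDerivative cov ∞)
    (hK : IsScalarLinear K cov) (γ : SmoothLoop E X) (e : ∀ t, F →ₗ[K] V (γ t))
    (c : ℝ) (u v : LoopTangent γ) (t : ℝ) :
    loopCurv cov γ e (c • u) v t = c • loopCurv cov γ e u v t := by
  ext w
  have h : curvature K cov (γ t) ((c • u).1 t) (v.1 t) (e t w) =
      c • curvature K cov (γ t) (u.1 t) (v.1 t) (e t w) :=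
    curvature_smul_left hcov hK (γ t) c (u.1 t) (v.1 t) (e t w)
  rw [loopCurv, inFrame_apply, h, ← algebraMap_smul K c, map_smul, algebraMap_smul]
  rfl

/-- `loopCurv` as a linear function of the first vector. -/
def loopCurvLeft (hcov : CovariantDerivative.ContMDiffCovariantDerivative cov ∞)
    (hK : IsScalarLinear K cov) (γ : SmoothLoop E X) (e : ∀ t, F →ₗ[K] V (γ t))
    (v : LoopTangent γ) (t : ℝ) : LoopTangent γ →ₗ[ℝ] F →L[K] F where
  toFun u := loopCurv cov γ e u v t
  map_add' u u' := loopCurv_add_left hcov hK γ e u u' v t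
  map_smul' c u := loopCurv_smul_left hcov hK γ e c u v t

/-- Each argument occurs in exactly one curvature factor, the one with index `i / 2`. Linearity in
the second slot is reduced to the first by antisymmetry. -/
theorem loopCurv_update (hcov : CovariantDerivative.ContMDiffCovariantDerivative cov ∞)
    (hK : IsScalarLinear K cov) (γ : SmoothLoop E X) (e : ∀ t, F →ₗ[K] V (γ t)) {N : ℕ}
    (U : Fin (2 * N) → LoopTangent γ) (i : Fin (2 * N)) (t : Fin N → ℝ) :
    ∃ (j : Fin N) (L : LoopTangent γ →ₗ[ℝ] F →L[K] F), ∀ u,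
      (fun k => loopCurv cov γ e (pairs (Function.update U i u) k).1
        (pairs (Function.update U i u) k).2 (t k)) =
      Function.update (fun k => loopCurv cov γ e (pairs U k).1 (pairs U k).2 (t k)) j (L u) := by
  have hne : ∀ k : Fin N, (k : ℕ) ≠ i / 2 → ∀ u,
      pairs (Function.update U i u) k = pairs U k := fun k hk u => by
    refine Prod.ext (Function.update_of_ne ?_ _ _) (Function.update_of_ne ?_ _ _)
    · simp only [ne_eq, Fin.ext_iff]
      omega
    · simp only [ne_eq, Fin.ext_iff]
      omega
  refine ⟨⟨i / 2, by omega⟩, ?_⟩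
  rcases Nat.even_or_odd' (i : ℕ) with ⟨c, hc | hc⟩
  · refine ⟨loopCurvLeft hcov hK γ e (U ⟨2 * (i / 2) + 1, by omega⟩) (t ⟨i / 2, by omega⟩),
      fun u => funext fun k => ?_⟩
    rcases eq_or_ne k ⟨i / 2, by omega⟩ with rfl | hk
    · rw [Function.update_self]
      have h1 : (⟨2 * (i / 2), by omega⟩ : Fin (2 * N)) = i := Fin.ext (by simp; omega)
      have h2 : (⟨2 * (i / 2) + 1, by omega⟩ : Fin (2 * N)) ≠ i := by
        simp only [ne_eq, Fin.ext_iff]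
        omega
      simp only [pairs, h1, Function.update_self, Function.update_of_ne h2]
      rfl
    · rw [Function.update_of_ne hk, hne k fun h => hk (Fin.ext h)]
  · refine ⟨-loopCurvLeft hcov hK γ e (U ⟨2 * (i / 2), by omega⟩) (t ⟨i / 2, by omega⟩),
      fun u => funext fun k => ?_⟩
    rcases eq_or_ne k ⟨i / 2, by omega⟩ with rfl | hk
    · rw [Function.update_self]
      have h1 : (⟨2 * (i / 2) + 1, by omega⟩ : Fin (2 * N)) = i := Fin.ext (by simp; omega)
      have h2 : (⟨2 * (i / 2), by omega⟩ : Fin (2 * N)) ≠ i := by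
        simp only [ne_eq, Fin.ext_iff]
        omega
      simp only [pairs, h1, Function.update_self, Function.update_of_ne h2]
      exact loopCurv_swap hcov hK γ e _ _ _
    · rw [Function.update_of_ne hk, hne k fun h => hk (Fin.ext h)]

/-- The integrand of the Bismut–Chern form in a frame. -/
def loopIntegrand (cov : CovariantDerivative 𝓘(ℝ, E) F V) (Ξ : Grading K E F V)
    (γ : SmoothLoop E X) (e : ∀ t, F →ₗ[K] V (γ t)) {N : ℕ} (U : Fin (2 * N) → LoopTangent γ)
    (t : Fin N → ℝ) : K :=
  traceL K F (loopHol Ξ γ e * oprod fun j => loopCurv cov γ e (pairs U j).1 (pairs U j).2 (t j))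

theorem exists_loopIntegrand_update
    (hcov : CovariantDerivative.ContMDiffCovariantDerivative cov ∞)
    (hK : IsScalarLinear K cov) (Ξ : Grading K E F V) (γ : SmoothLoop E X)
    (e : ∀ t, F →ₗ[K] V (γ t)) {N : ℕ}
    (U : Fin (2 * N) → LoopTangent γ) (i : Fin (2 * N)) (t : Fin N → ℝ) :
    ∃ L : LoopTangent γ →ₗ[ℝ] K, ∀ u, loopIntegrand cov Ξ γ e (Function.update U i u) t = L u := by
  obtain ⟨j, L, hL⟩ := loopCurv_update hcov hK γ e U i t
  refine ⟨(traceL K F : (F →L[K] F) →ₗ[ℝ] K) ∘ₗ LinearMap.mulLeft ℝ (loopHol Ξ γ e) ∘ₗ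
    (MultilinearMap.mkPiAlgebraFin ℝ N (F →L[K] F)).toLinearMap
      (fun k => loopCurv cov γ e (pairs U k).1 (pairs U k).2 (t k)) j ∘ₗ L, fun u => ?_⟩
  rw [loopIntegrand, hL]
  rfl

theorem continuous_loopIntegrand
    (hcov : CovariantDerivative.ContMDiffCovariantDerivative cov ∞)
    (hK : IsScalarLinear K cov) (Ξ : Grading K E F V) (γ : SmoothLoop E X)
    {e : ∀ t, F →ₗ[K] V (γ t)} (he : IsFrameOn cov γ 1 e Set.univ) {N : ℕ}
    (U : Fin (2 * N) → LoopTangent γ) : Continuous (loopIntegrand cov Ξ γ e U) := by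
  refine (traceL K F).continuous.comp (continuous_const.mul (continuous_oprod
    (w := fun j (t : Fin N → ℝ) => loopCurv cov γ e (pairs U j).1 (pairs U j).2 (t j)) fun j => ?_))
  exact (contDiff_inFrame_curvature hcov hK (he.isSmoothFrame γ.smooth) (pairs U j).1.2.1
    (pairs U j).2.2.1).continuous.comp (continuous_apply j)

/-- The iterated integral in a frame as a multilinear map. -/
def loopMultilinear (hcov : CovariantDerivative.ContMDiffCovariantDerivative cov ∞)
    (hK : IsScalarLinear K cov) (Ξ : Grading K E F V) (γ : SmoothLoop E X)
    {e : ∀ t, F →ₗ[K] V (γ t)} (he : IsFrameOn cov γ 1 e Set.univ) (N : ℕ) :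
    MultilinearMap ℝ (fun _ : Fin (2 * N) => LoopTangent γ) K where
  toFun U := ∫ t in decSimplex N, loopIntegrand cov Ξ γ e U t
  map_update_add' := by
    intro inst U i u u'
    obtain rfl : inst = instDecidableEqFin _ := Subsingleton.elim _ _
    have hint : ∀ u, IntegrableOn (loopIntegrand cov Ξ γ e (Function.update U i u))
        (decSimplex N) := fun u =>
      (continuous_loopIntegrand hcov hK Ξ γ he _).continuousOn.integrableOn_compact
        (isCompact_decSimplex N)
    rw [← integral_add (hint u) (hint u')]
    refine integral_congr_ae (Filter.Eventually.of_forall fun t => ?_)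
    obtain ⟨L, hL⟩ := exists_loopIntegrand_update hcov hK Ξ γ e U i t
    simp only [hL, map_add]
  map_update_smul' := by
    intro inst U i c u
    obtain rfl : inst = instDecidableEqFin _ := Subsingleton.elim _ _
    rw [← integral_smul]
    refine integral_congr_ae (Filter.Eventually.of_forall fun t => ?_)
    obtain ⟨L, hL⟩ := exists_loopIntegrand_update hcov hK Ξ γ e U i t
    simp only [hL, map_smul]

/-- A single loop is a family with parameter space `Fin 0 → ℝ`. -/
theorem exists_loop_frame (hcov : CovariantDerivative.ContMDiffCovariantDerivative cov ∞)
    (hK : IsScalarLinear K cov) (γ : SmoothLoop E X) :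
    ∃ e : ∀ t, F →ₗ[K] V (γ t), IsFrameOn cov γ 1 e Set.univ := by
  have hf : ContMDiff 𝓘(ℝ, (Fin 0 → ℝ) × ℝ) 𝓘(ℝ, E) ∞ fun p : (Fin 0 → ℝ) × ℝ => γ p.2 :=
    γ.smooth.comp contDiff_snd.contMDiff
  obtain ⟨e, he⟩ := exists_temporal_frame hcov hK hf
  exact ⟨fun t => e (0, t), (he.restrict hK 0).mono fun t _ => Set.mem_univ _⟩

/-- In a frame the sum over permutations is literally the alternatization of the multilinear
iterated integral. -/
theorem BCh_alternating (hcov : CovariantDerivative.ContMDiffCovariantDerivative cov ∞)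
    (hK : IsScalarLinear K cov) (Ξ : Grading K E F V) (N : ℕ) (γ : SmoothLoop E X) :
    ∃ A : LoopTangent γ [⋀^Fin (2 * N)]→ₗ[ℝ] K, ∀ U, BCh cov Ξ N γ U = A U := by
  obtain ⟨e, he⟩ := exists_loop_frame hcov hK γ
  refine ⟨((-2 : K) ^ N)⁻¹ •
    MultilinearMap.alternatization (loopMultilinear hcov hK Ξ γ he N), fun U => ?_⟩
  rw [BCh_eq hcov hK Ξ N γ he, AlternatingMap.smul_apply, smul_eq_mul,
    MultilinearMap.alternatization_apply]
  congr 1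
  refine Finset.sum_congr rfl fun σ _ => ?_
  rw [sgn, Units.smul_def, zsmul_eq_mul]
  rfl

end Alternating

/-! ### The velocity field along a plot, and operations on forms -/

section PlotVelocity

variable {E : Type*} [NormedAddCommGroup E] [NormedSpace ℝ E]
  {X : Type*} [TopologicalSpace X] [ChartedSpace E X] [IsManifold 𝓘(ℝ, E) ∞ X]

/-- The map `ℝᵐ × ℝ → X` underlying a plot. -/
def Plot.total {m : ℕ} (Φ : Plot E X m) (p : (Fin m → ℝ) × ℝ) : X := Φ.toFun p.1 p.2

/-- The derivative of a plot in a direction of `ℝᵐ × ℝ`. -/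
def Plot.pushTotal {m : ℕ} (Φ : Plot E X m) (w : (Fin m → ℝ) × ℝ) : PlotField Φ where
  toFun x t := mfderiv 𝓘(ℝ, (Fin m → ℝ) × ℝ) 𝓘(ℝ, E) Φ.total (x, t) w
  smooth := contMDiff_mfderiv_apply Φ.smooth w
  periodic x := (periodic_mk_iff (Φ.periodic x) _).2 fun t => by
    have key : ∀ q, q = ((x, t + 1) : (Fin m → ℝ) × ℝ) →
        (mfderiv 𝓘(ℝ, (Fin m → ℝ) × ℝ) 𝓘(ℝ, E) Φ.total q w : E) =
        mfderiv 𝓘(ℝ, (Fin m → ℝ) × ℝ) 𝓘(ℝ, E) Φ.total (x, t) w →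
        (mfderiv 𝓘(ℝ, (Fin m → ℝ) × ℝ) 𝓘(ℝ, E) Φ.total (x, t + 1) w : E) =
        mfderiv 𝓘(ℝ, (Fin m → ℝ) × ℝ) 𝓘(ℝ, E) Φ.total (x, t) w := by
      rintro q rfl h
      exact h
    exact key _ (by simp) (mfderiv_add_period Φ.smooth (c := ((0 : Fin m → ℝ), (1 : ℝ)))
      (fun p => by simpa using Φ.periodic p.1 p.2) (x, t) w)

/-- The chain rule along `t ↦ (x, t)`: the rotation field is the image of `∂_t`, so inserting it
becomes inserting the direction `(0, 1)`. -/
theorem Plot.velocity_loop {m : ℕ} (Φ : Plot E X m) (x : Fin m → ℝ) :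
    velocity (Φ.loop x) = (Φ.pushTotal (0, 1)).at x := by
  refine Subtype.ext (funext fun t => ?_)
  have hg : HasMFDerivAt 𝓘(ℝ, ℝ) 𝓘(ℝ, (Fin m → ℝ) × ℝ) (fun s : ℝ => (x, s)) t
      (ContinuousLinearMap.inr ℝ (Fin m → ℝ) ℝ) := (hasFDerivAt_prodMk_right x t).hasMFDerivAt
  have hf : HasMFDerivAt 𝓘(ℝ, (Fin m → ℝ) × ℝ) 𝓘(ℝ, E) Φ.total (x, t)
      (mfderiv 𝓘(ℝ, (Fin m → ℝ) × ℝ) 𝓘(ℝ, E) Φ.total (x, t)) :=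
    (Φ.smooth.mdifferentiable (by simp) (x, t)).hasMFDerivAt
  have h := (HasMFDerivAt.comp t hf hg).mfderiv
  exact congrArg (fun L : ℝ →L[ℝ] E => L 1) h

theorem cons_velocity_push {m k : ℕ} (Φ : Plot E X m) (x : Fin m → ℝ) (v : Fin k → Fin m → ℝ) :
    (Fin.cons (velocity (Φ.loop x)) fun i => (Φ.push (v i)).at x :
      Fin (k + 1) → LoopTangent (Φ.loop x)) = fun i => (Φ.pushTotal
        ((Fin.cons (0, 1) fun i => (v i, (0 : ℝ)) : Fin (k + 1) → (Fin m → ℝ) × ℝ) i)).at x := by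
  funext i
  cases i using Fin.cases with
  | zero => exact Φ.velocity_loop x
  | succ i => rfl

variable {K : Type*} [RCLike K] {k : ℕ}

theorem IsForm.zero : IsForm (0 : Cochain E X K k) :=
  ⟨fun _ => ⟨0, fun _ => rfl⟩, fun _ _ _ => contDiff_const⟩

theorem IsForm.neg {θ : Cochain E X K k} (h : IsForm θ) : IsForm (-θ) where
  alternating γ := by
    obtain ⟨A, hA⟩ := h.alternating γ
    exact ⟨-A, fun U => congrArg Neg.neg (hA U)⟩
  smooth m Φ W := (h.smooth m Φ W).neg

theorem IsForm.insertVelocity {θ : Cochain E X K (k + 1)} (h : IsForm θ) :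
    IsForm (insertVelocity θ) where
  alternating γ := by
    obtain ⟨A, hA⟩ := h.alternating γ
    exact ⟨A.curryLeft (velocity γ), fun U => hA _⟩
  smooth m Φ W := by
    have h1 := h.smooth m Φ (Fin.cons (Φ.pushTotal (0, 1)) W)
    convert h1 using 2 with x
    refine congrArg (θ (Φ.loop x)) (funext fun i => ?_)
    cases i using Fin.cases with
    | zero => exact Φ.velocity_loop x
    | succ i => rfl

theorem HasExtDeriv.zero : HasExtDeriv (0 : Cochain E X K k) 0 :=
  ⟨IsForm.zero, IsForm.zero, fun m Φ x v => by simp⟩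

end PlotVelocity

/-! ### Exterior derivative of the Bismut–Chern forms -/

section Main

variable {K : Type*} [RCLike K]
    {E : Type*} [NormedAddCommGroup E] [NormedSpace ℝ E] [FiniteDimensional ℝ E]
    {X : Type*} [TopologicalSpace X] [T2Space X] [ChartedSpace E X] [IsManifold 𝓘(ℝ, E) ∞ X]
    {F : Type*} [NormedAddCommGroup F] [NormedSpace ℝ F] [FiniteDimensional ℝ F]
    [NormedSpace K F] [IsScalarTower ℝ K F] [FiniteDimensional K F]
    {V : X → Type*} [TopologicalSpace (TotalSpace F V)]
    [∀ x, AddCommGroup (V x)] [∀ x, Module ℝ (V x)] [∀ x, Module K (V x)]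
    [∀ x, IsScalarTower ℝ K (V x)]
    [∀ x, TopologicalSpace (V x)]
    [∀ x, IsTopologicalAddGroup (V x)] [∀ x, ContinuousSMul ℝ (V x)]
    [FiberBundle F V] [VectorBundle ℝ F V] [VectorBundle K F V]
    [ContMDiffVectorBundle ∞ F V 𝓘(ℝ, E)]
    {cov : CovariantDerivative 𝓘(ℝ, E) F V}

theorem Plot.exists_frame (hcov : CovariantDerivative.ContMDiffCovariantDerivative cov ∞)
    (hK : IsScalarLinear K cov) {m : ℕ} (Φ : Plot E X m) :
    ∃ e : ∀ q, F →ₗ[K] V (Φ.total q), IsFrameOn cov Φ.total (0, 1) e Set.univ :=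
  exists_temporal_frame hcov hK Φ.smooth

variable {m : ℕ} {Φ : Plot E X m} {e : ∀ q, F →ₗ[K] V (Φ.total q)}

theorem IsFrameOn.loop (hK : IsScalarLinear K cov)
    (he : IsFrameOn cov Φ.total (0, 1) e Set.univ) (x : Fin m → ℝ) :
    IsFrameOn cov (Φ.loop x) 1 (fun t => e (x, t)) Set.univ :=
  (he.restrict hK x).mono fun _ _ => Set.mem_univ _

theorem Plot.total_one (Φ : Plot E X m) : (fun x => Φ.total (x, 1)) = fun x => Φ.total (x, 0) :=
  funext fun x => by simpa [Plot.total] using Φ.periodic x 0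

theorem contDiff_loopHol (Ξ : Grading K E F V)
    (he : IsFrameOn cov Φ.total (0, 1) e Set.univ) :
    ContDiff ℝ ∞ fun x => loopHol Ξ (Φ.loop x) fun t => e (x, t) :=
  contDiff_inFrame_grading Ξ ((he.isSmoothFrame Φ.smooth).slice 0)
    (isSmoothFrame_castFrame Φ.total_one ((he.isSmoothFrame Φ.smooth).slice 1))

/-- The case of the frames at times `0` and `1` along the common curve of base points `x ↦ Φ(x, 0) =
Φ(x, 1)`. -/
theorem fderiv_loopHol {Ξ : Grading K E F V} (hΞ : IsGradedConnection cov Ξ)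
    (he : IsFrameOn cov Φ.total (0, 1) e Set.univ) (x v : Fin m → ℝ) :
    fderiv ℝ (fun x => loopHol Ξ (Φ.loop x) fun t => e (x, t)) x v =
      loopHol Ξ (Φ.loop x) (fun t => e (x, t)) * gaugeConn cov e (x, 1) (v, 0) -
        gaugeConn cov e (x, 0) (v, 0) * loopHol Ξ (Φ.loop x) fun t => e (x, t) := by
  have hs := he.isSmoothFrame Φ.smooth
  have h := fderiv_inFrame_grading hΞ (hs.slice 0)
    (isSmoothFrame_castFrame Φ.total_one (hs.slice 1)) x v
  rw [gaugeConn_castFrame Φ.total_one, gaugeConn_slice hΞ.smul hs,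
    gaugeConn_slice hΞ.smul hs] at h
  exact h

theorem BCh_smooth (hcov : CovariantDerivative.ContMDiffCovariantDerivative cov ∞)
    (hK : IsScalarLinear K cov) (Ξ : Grading K E F V) (N : ℕ) (Φ : Plot E X m)
    (W : Fin (2 * N) → PlotField Φ) :
    ContDiff ℝ ∞ fun x => BCh cov Ξ N (Φ.loop x) fun i => (W i).at x := by
  obtain ⟨e, he⟩ := Φ.exists_frame hcov hK
  simp only [BCh_eq hcov hK Ξ N _ (he.loop hK _)]
  refine contDiff_const.mul (ContDiff.sum fun ρ _ => contDiff_const.mul ?_)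
  refine contDiff_setIntegral (isCompact_decSimplex N) ?_
  refine (traceL K F).contDiff.comp (((contDiff_loopHol Ξ he).comp contDiff_fst).mul ?_)
  refine contDiff_oprod (w := fun j (z : (Fin m → ℝ) × (Fin N → ℝ)) =>
    loopCurv cov (Φ.loop z.1) (fun t => e (z.1, t)) (pairs (fun m => (W (ρ m)).at z.1) j).1
      (pairs (fun m => (W (ρ m)).at z.1) j).2 (z.2 j)) fun j => ?_
  exact (contDiff_inFrame_curvature hcov hK (he.isSmoothFrame Φ.smooth)
    (pairs (fun m => W (ρ m)) j).1.smooth (pairs (fun m => W (ρ m)) j).2.smooth).comp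
    (contDiff_fst.prodMk ((contDiff_apply ℝ ℝ j).comp contDiff_snd))

theorem isForm_BCh (hcov : CovariantDerivative.ContMDiffCovariantDerivative cov ∞)
    (hK : IsScalarLinear K cov) (Ξ : Grading K E F V) (N : ℕ) : IsForm (BCh cov Ξ N) :=
  ⟨BCh_alternating hcov hK Ξ N, fun _ Φ W => BCh_smooth hcov hK Ξ N Φ W⟩

/-- The temporal gauge of a plot in a frame that is parallel along the loops. -/
def plotGauge (hcov : CovariantDerivative.ContMDiffCovariantDerivative cov ∞)
    {Ξ : Grading K E F V} (hΞ : IsGradedConnection cov Ξ)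
    (he : IsFrameOn cov Φ.total (0, 1) e Set.univ) :
    TemporalGauge (Fin m → ℝ) (F →L[K] F) where
  q x := loopHol Ξ (Φ.loop x) fun t => e (x, t)
  a p v := gaugeConn cov e p (v, 0)
  curv p u v := inFrame (e p) (e p) (curvature K cov (Φ.total p)
    (mfderiv 𝓘(ℝ, (Fin m → ℝ) × ℝ) 𝓘(ℝ, E) Φ.total p u)
    (mfderiv 𝓘(ℝ, (Fin m → ℝ) × ℝ) 𝓘(ℝ, E) Φ.total p v))
  contDiff_q := contDiff_loopHol Ξ he
  contDiff_curv u v := contDiff_inFrame_curvature hcov hΞ.smul (he.isSmoothFrame Φ.smooth)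
    (contMDiff_mfderiv_apply Φ.smooth u) (contMDiff_mfderiv_apply Φ.smooth v)
  swap p u v := by
    rw [curvature_swap hcov hΞ.smul]
    ext w
    exact map_neg (linv (e p)) _
  fderiv_q := fderiv_loopHol hΞ he
  hasDerivAt_a x v t := by
    have hs := he.isSmoothFrame Φ.smooth
    -- The frame is parallel in time, so the dt-component vanishes identically. Of the formula for
    -- the curvature only the time derivative of `a` survives.
    have h0 : (fun p => gaugeConn cov e p (0, 1)) = fun _ => 0 := by
      funext p
      ext w
      apply (hs.bijective p).1
      rw [frame_gaugeConn hΞ.smul hs, he.parallel p (Set.mem_univ p)]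
      simp
    have h1 : HasFDerivAt (fun p => gaugeConn cov e p (v, 0))
        (fderiv ℝ (fun p => gaugeConn cov e p (v, 0)) (x, t)) (x, t) :=
      ((contDiff_gaugeConn hcov hΞ.smul hs (v, 0)).differentiable (by simp) _).hasFDerivAt
    have h2 := h1.comp_hasDerivAt t ((hasDerivAt_const t x).prodMk (hasDerivAt_id t))
    refine h2.congr_deriv ?_
    rw [curvature_frame hcov hΞ.smul hs, formCurv, h0, congrFun h0 (x, t)]
    simp
  bianchi x t u v w := by
    have hs := he.isSmoothFrame Φ.smooth
    have hα := contDiff_gaugeConn hcov hΞ.smul hs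
    -- The Bianchi identity on the whole of `ℝᵐ × ℝ` is restricted to directions without time
    -- component.
    have hd : ∀ u v w : Fin m → ℝ,
        fderiv ℝ (fun y => formCurv (gaugeConn cov e) (v, 0) (w, 0) (y, t)) x u =
          fderiv ℝ (formCurv (gaugeConn cov e) (v, 0) (w, 0)) (x, t) (u, 0) := fun u v w => by
      have hc : ContDiff ℝ ∞ (formCurv (gaugeConn cov e) (v, 0) (w, 0)) := by
        have := contDiff_inFrame_curvature hcov hΞ.smul hs
          (contMDiff_mfderiv_apply Φ.smooth (v, 0)) (contMDiff_mfderiv_apply Φ.smooth (w, 0))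
        exact (funext fun p => curvature_frame hcov hΞ.smul hs p (v, 0) (w, 0)) ▸ this
      have h := ((hc.differentiable (by simp)) (x, t)).hasFDerivAt.comp x
        (hasFDerivAt_prodMk_left (𝕜 := ℝ) x t)
      exact congrArg (fun L : (Fin m → ℝ) →L[ℝ] (F →L[K] F) => L u) h.fderiv
    simp only [curvature_frame hcov hΞ.smul hs, hd]
    exact formCurv_bianchi hα (x, t) (u, 0) (v, 0) (w, 0)

/-- Directions with a time component are admitted, so that one formula covers both the form itself
and its contraction with the velocity. -/
theorem BCh_pushTotal (hcov : CovariantDerivative.ContMDiffCovariantDerivative cov ∞)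
    {Ξ : Grading K E F V} (hΞ : IsGradedConnection cov Ξ)
    (he : IsFrameOn cov Φ.total (0, 1) e Set.univ) (N : ℕ) (x : Fin m → ℝ)
    (w : Fin (2 * N) → (Fin m → ℝ) × ℝ) :
    BCh cov Ξ N (Φ.loop x) (fun i => (Φ.pushTotal (w i)).at x) =
      ((-2 : K) ^ N)⁻¹ * ∑ ρ : Equiv.Perm (Fin (2 * N)), sgn K ρ *
        (plotGauge hcov hΞ he).chen (traceL K F) (pairs fun m => w (ρ m)) x :=
  BCh_eq hcov hΞ.smul Ξ N (Φ.loop x) (he.loop hΞ.smul x) _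

theorem BCh_extDeriv (hcov : CovariantDerivative.ContMDiffCovariantDerivative cov ∞)
    {Ξ : Grading K E F V} (hΞ : IsGradedConnection cov Ξ) (N : ℕ) (Φ : Plot E X m)
    (x : Fin m → ℝ) (v : Fin (2 * N + 1) → Fin m → ℝ) :
    (-insertVelocity (BCh cov Ξ (N + 1))) (Φ.loop x) (fun i => (Φ.push (v i)).at x) =
      ∑ i : Fin (2 * N + 1), (-1 : K) ^ (i : ℕ) *
        fderiv ℝ (fun y => BCh cov Ξ N (Φ.loop y)
          (fun j => (Φ.push (v (i.succAbove j))).at y)) x (v i) := by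
  obtain ⟨e, he⟩ := Φ.exists_frame hcov hΞ.smul
  have : FiniteDimensional ℝ (F →L[K] F) := finiteDimensional_real_end K F
  let 𝔤 := plotGauge hcov hΞ he
  have hL : (-insertVelocity (BCh cov Ξ (N + 1))) (Φ.loop x) (fun i => (Φ.push (v i)).at x) =
      -(((-2 : K) ^ (N + 1))⁻¹ * ∑ ρ : Equiv.Perm (Fin (2 * N + 2)), sgn K ρ *
        𝔤.chen (traceL K F) (pairs (N := N + 1) fun l : Fin (2 * N + 2) =>
          (Fin.cons (0, 1) (fun i => (v i, (0 : ℝ))) :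
            Fin (2 * N + 2) → (Fin m → ℝ) × ℝ) (ρ l)) x) := by
    refine congrArg Neg.neg ((congrArg (BCh cov Ξ (N + 1) (Φ.loop x))
      (cons_velocity_push Φ x v)).trans ?_)
    exact BCh_pushTotal hcov hΞ he (N + 1) x _
  have hR : ∀ i : Fin (2 * N + 1), fderiv ℝ (fun y => BCh cov Ξ N (Φ.loop y)
      (fun j => (Φ.push (v (i.succAbove j))).at y)) x (v i) =
      ((-2 : K) ^ N)⁻¹ * ∑ σ : Equiv.Perm (Fin (2 * N)), sgn K σ *
        fderiv ℝ (𝔤.chen (traceL K F) (pairs fun m => (v (i.succAbove (σ m)), (0 : ℝ)))) x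
          (v i) := fun i => by
    have h1 : (fun y => BCh cov Ξ N (Φ.loop y) (fun j => (Φ.push (v (i.succAbove j))).at y)) =
        fun y => ((-2 : K) ^ N)⁻¹ * ∑ σ : Equiv.Perm (Fin (2 * N)), sgn K σ *
          𝔤.chen (traceL K F) (pairs fun m => (v (i.succAbove (σ m)), (0 : ℝ))) y :=
      funext fun y => BCh_pushTotal hcov hΞ he N y fun j => (v (i.succAbove j), 0)
    have hd : ∀ P : Fin N → ((Fin m → ℝ) × ℝ) × ((Fin m → ℝ) × ℝ),
        HasFDerivAt (𝔤.chen (traceL K F) P) (fderiv ℝ (𝔤.chen (traceL K F) P) x) x := fun P =>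
      ((𝔤.contDiff_chen (traceL K F) P).differentiable (by simp) x).hasFDerivAt
    have h2 := (HasFDerivAt.fun_sum (u := Finset.univ) fun (σ : Equiv.Perm (Fin (2 * N))) _ =>
      (hd (pairs fun m => (v (i.succAbove (σ m)), (0 : ℝ)))).const_mul (sgn K σ)).const_mul
        ((-2 : K) ^ N)⁻¹
    rw [h1, h2.fderiv]
    simp
  rw [hL]
  simp only [hR, mul_left_comm _ ((-2 : K) ^ N)⁻¹]
  -- The constants match because `(-2)^{-N} * 2⁻¹ = -(-2)^{-(N+1)}`, which is the origin of the
  -- minus sign.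
  rw [← Finset.mul_sum,
    𝔤.extDeriv_chen (traceL K F) traceL_mul_comm x v, pow_succ, mul_inv]
  ring

theorem hasExtDeriv_BCh (hcov : CovariantDerivative.ContMDiffCovariantDerivative cov ∞)
    {Ξ : Grading K E F V} (hΞ : IsGradedConnection cov Ξ) (N : ℕ) :
    HasExtDeriv (BCh cov Ξ N) (-insertVelocity (BCh cov Ξ (N + 1))) :=
  ⟨isForm_BCh hcov hΞ.smul Ξ N, (isForm_BCh hcov hΞ.smul Ξ (N + 1)).insertVelocity.neg,
    fun _ Φ x v => BCh_extDeriv hcov hΞ N Φ x v⟩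

theorem BChCharacter_of_ne (cov : CovariantDerivative 𝓘(ℝ, E) F V) (Ξ : Grading K E F V) (N : ℤ)
    (k : ℕ) (h : 2 * N ≠ k) : BChCharacter cov Ξ N k = 0 := by
  cases N with
  | ofNat N =>
    rw [BChCharacter, dif_neg]
    intro h'
    apply h
    simp [← h']
  | negSucc N => rfl

theorem BChCharacter_two_mul (cov : CovariantDerivative 𝓘(ℝ, E) F V) (Ξ : Grading K E F V)
    (N : ℕ) : BChCharacter cov Ξ N (2 * N) = BCh cov Ξ N :=
  dif_pos rfl

/-- The coefficient of `T ^ N` in degree `k` can be nonzero only for `k = 2 * N`. Contraction lowers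
the degree by one and `T⁻¹` lowers the power by one, so each identity is either that for `BCh` or
trivially zero. -/
theorem hasEquivariantDeriv_BChCharacter
    (hcov : CovariantDerivative.ContMDiffCovariantDerivative cov ∞)
    {Ξ : Grading K E F V} (hΞ : IsGradedConnection cov Ξ) :
    HasEquivariantDeriv (BChCharacter cov Ξ) 0 := by
  have h0 : ∀ k, -insertVelocity (0 : Cochain E X K (k + 1)) = 0 := fun k => neg_zero
  refine ⟨fun N k => -insertVelocity (BChCharacter cov Ξ (N + 1) (k + 1)), fun N k => ?_,
    fun N => ?_, fun N k => (neg_add_cancel _).symm⟩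
  · by_cases h : 2 * N = k
    · obtain ⟨n, rfl⟩ : ∃ n : ℕ, N = n := ⟨N.toNat, by omega⟩
      obtain rfl : k = 2 * n := by omega
      rw [BChCharacter_two_mul]
      have h1 := BChCharacter_two_mul cov Ξ (n + 1)
      have h2 : BChCharacter cov Ξ ((n : ℤ) + 1) (2 * n + 1 + 1) = BCh cov Ξ (n + 1) := h1
      change HasExtDeriv _ (-insertVelocity (BChCharacter cov Ξ ((n : ℤ) + 1) (2 * n + 1 + 1)))
      rw [h2]
      exact hasExtDeriv_BCh hcov hΞ n
    · change HasExtDeriv _ (-insertVelocity (BChCharacter cov Ξ (N + 1) (k + 1 + 1)))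
      rw [BChCharacter_of_ne cov Ξ N k h,
        BChCharacter_of_ne cov Ξ (N + 1) (k + 1 + 1) (by push_cast; omega), h0]
      exact HasExtDeriv.zero
  -- The degree `0` part of `D` vanishes by parity, since the character has no component of degree
  -- `1`.
  · change -insertVelocity (BChCharacter cov Ξ (N + 1) (0 + 1)) = 0
    rw [BChCharacter_of_ne cov Ξ (N + 1) (0 + 1) (by push_cast; omega), h0]

end Main

end LoopSpace

end

theorem mainTheorem6 {K : Type*} [RCLike K]
    {E : Type*} [NormedAddCommGroup E] [NormedSpace ℝ E] [FiniteDimensional ℝ E]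
    {X : Type*} [TopologicalSpace X] [T2Space X] [ChartedSpace E X] [IsManifold 𝓘(ℝ, E) ∞ X]
    {F : Type*} [NormedAddCommGroup F] [NormedSpace ℝ F] [FiniteDimensional ℝ F]
    [NormedSpace K F] [IsScalarTower ℝ K F]
    {V : X → Type*} [TopologicalSpace (TotalSpace F V)]
    [∀ x, AddCommGroup (V x)] [∀ x, Module ℝ (V x)] [∀ x, Module K (V x)]
    [∀ x, IsScalarTower ℝ K (V x)] [∀ x, TopologicalSpace (V x)]
    [∀ x, IsTopologicalAddGroup (V x)] [∀ x, ContinuousSMul ℝ (V x)]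
    [FiberBundle F V] [VectorBundle ℝ F V] [VectorBundle K F V]
    [ContMDiffVectorBundle ∞ F V 𝓘(ℝ, E)]
    (cov : CovariantDerivative 𝓘(ℝ, E) F V)
    (hcov : CovariantDerivative.ContMDiffCovariantDerivative cov ∞)
    (Ξ : LoopSpace.Grading K E F V) (hΞ : LoopSpace.IsGradedConnection cov Ξ) :
    (∀ N : ℕ, LoopSpace.IsForm (LoopSpace.BCh cov Ξ N)) ∧
    (∀ N : ℕ, LoopSpace.HasExtDeriv (LoopSpace.BCh cov Ξ N)
      (-LoopSpace.insertVelocity (LoopSpace.BCh cov Ξ (N + 1)))) ∧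
    LoopSpace.HasEquivariantDeriv (LoopSpace.BChCharacter cov Ξ) 0 := by
  have : FiniteDimensional K F := FiniteDimensional.right ℝ K F
  exact ⟨LoopSpace.isForm_BCh hcov hΞ.smul Ξ, LoopSpace.hasExtDeriv_BCh hcov hΞ,
    LoopSpace.hasEquivariantDeriv_BChCharacter hcov hΞ⟩
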